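/- **Theorem 3.2.** Let $H$ be a real or complex Hilbert space, $1\le p<\infty$, and let $\mathcal E:=H\times L^p([-1,0];H)$. Let $B$ generate a linear contraction $C_0$-semigroup on $H$, let $\eta:[-1,0]\to\mathcal L(H)$ be of bounded variation, and let $\Phi f:=\int_{-1}^0 d\eta(\sigma)\,f(\sigma)$ be the associated linear delay operator. Suppose that $\Phi f\in D(B)$ for all $f\in W^{1,p}([-1,0];H)$. Define on $\mathcal E$ $$\mathcal A_1=\begin{pmatrix}B&0\\0&0\end{pmatrix},\quad \mathcal A_2=\begin{pmatrix}0&\Phi\\0&\tfrac{d}{d\sigma}\end{pmatrix},\quad \mathcal G=\begin{pmatrix}B&\Phi\\0&\tfrac{d}{d\sigma}\end{pmatrix}$$ with domains $D(\mathcal A_1)=D(B)\times L^p([-1,0];H)$, $D(\mathcal A_2)=\{(x,f)\in H\times W^{1,p}([-1,0];H): f(0)=x\}$ and $D(\mathcal G)=\{(x,f)\in D(B)\times W^{1,p}([-1,0];H): f(0)=x\}$. Then $\mathcal A_1,\mathcal A_2,\mathcal G$ generate $C_0$-semigroups $\mathcal T_1,\mathcal T_2,\mathcal T$ on $\mathcal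 E$, and the sequential splitting $u^{\mathrm{sq}}(kh)=\mathcal P_1(\mathcal T_1(h)\mathcal T_2(h))^k\binom xf$, where $\mathcal P_1\binom xf:=x$, is of first order on $D(\mathcal G^2)$. More precisely, for every $T_0\ge 0$ there is a constant $C$ such that for all $z=\binom xf\in D(\mathcal G^2)$, with $\|z\|_{\mathcal G^2}:=\|z\|+\|\mathcal G^2z\|$, * (local error of the split solution) $\big\|\mathcal P_1\big(\mathcal T_1(h)\mathcal T_2(h)z-\mathcal T(h)z\big)\big\|_H\le C\,h^2\,\|z\|_{\mathcal G^2}$ for all $h\in[0,T_0]$; * (local error of the whole state) $\big\|\mathcal T_1(h)\mathcal T_2(h)z-\mathcal T(h)z\big\|_{\mathcal E}\le C\,h^{1+1/p}\,\|z\|_{\mathcal G^2}$ for all $h\in[0,T_0]$ (so $O(h^2)$ for $p=1$); * (first order convergence) $\big\|\big(\mathcal T_1(\tfrac tn)\mathcal T_2(\tfrac tn)\big)^nz-\mathcal T(t)z\big\|_{\mathcal E}\le \tfrac Cn\,\|z\|_{\mathcal G^2}$ for all $t\in[0,T_0]$ and $n\ge1$. -/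

import Mathlib

open Set Filter Topology MeasureTheory
open scoped NNReal ENNReal

namespace DelaySplitting

/-! ### Linear `C₀`-semigroups and their generators -/

section Semigroup

/-- A linear strongly continuous one-parameter semigroup (`C₀`-semigroup) on `X`. -/
structure C0Semigroup (𝕜 : Type*) [RCLike 𝕜] (X : Type*) [NormedAddCommGroup X]
    [NormedSpace 𝕜 X] where
  /-- the family of bounded linear operators, `t ≥ 0` -/
  op : ℝ≥0 → X →L[𝕜] X
  op_zero : op 0 = ContinuousLinearMap.id 𝕜 X
  op_add : ∀ s t : ℝ≥0, op (s + t) = (op s).comp (op t)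
  tendsto_zero : ∀ x : X, Tendsto (fun t : ℝ≥0 => op t x) (𝓝 0) (𝓝 x)

variable {𝕜 : Type*} [RCLike 𝕜] {X : Type*} [NormedAddCommGroup X] [NormedSpace 𝕜 X]

/-- `A`, an operator given by its graph, is the generator of `T`: `x ∈ D(A)` and `A x = y` hold
exactly when `(T(t) x - x) / t → y` as `t ↓ 0`. -/
def C0Semigroup.HasGenerator (T : C0Semigroup 𝕜 X) (A : Set (X × X)) : Prop :=
  ∀ x y : X, (x, y) ∈ A ↔
    Tendsto (fun t : ℝ≥0 => (((t : ℝ) : 𝕜))⁻¹ • (T.op t x - x)) (𝓝[>] 0) (𝓝 y)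

/-- The linear operator `B` (with domain `B.domain`) generates a linear contraction
`C₀`-semigroup. -/
def GeneratesContractionSemigroup (B : X →ₗ.[𝕜] X) : Prop :=
  ∃ V : C0Semigroup 𝕜 X, (∀ t : ℝ≥0, ‖V.op t‖ ≤ 1) ∧ V.HasGenerator (B.graph : Set (X × X))

end Semigroup

/-! ### The delay operator `Φ f = ∫_{-1}^0 dη(σ) f(σ)` -/

section Delay

variable {𝕜 : Type*} [RCLike 𝕜] {H : Type*} [NormedAddCommGroup H] [NormedSpace 𝕜 H]

/-- `I` is the Riemann–Stieltjes integral `∫_a^b dη(σ) f(σ)`: the limit of the sums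
`∑ (η(t_{i+1}) - η(t_i)) f(s_i)` over tagged partitions `a = t_0 ≤ s_0 ≤ t_1 ≤ ⋯ ≤ t_n = b`
as the mesh tends to zero. -/
def HasStieltjesIntegral (η : ℝ → H →L[𝕜] H) (f : ℝ → H) (a b : ℝ) (I : H) : Prop :=
  ∀ ε > 0, ∃ δ > 0, ∀ (n : ℕ) (t s : ℕ → ℝ), t 0 = a → t n = b →
    (∀ i < n, t i ≤ s i ∧ s i ≤ t (i + 1) ∧ t (i + 1) - t i < δ) →
    ‖∑ i ∈ Finset.range n, (η (t (i + 1)) - η (t i)) (f (s i)) - I‖ < ε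

open Classical in
/-- The delay operator `Φ f = ∫_{-1}^0 dη(σ) f(σ)` (the integral exists whenever `η` is of bounded
variation and `f` is continuous on `[-1,0]`). -/
noncomputable def delayOp (η : ℝ → H →L[𝕜] H) (f : ℝ → H) : H :=
  if h : ∃ I : H, HasStieltjesIntegral η f (-1) 0 I then h.choose else 0

end Delay

/-! ### The state space `H × L^p([-1,0]; H)` and the operators on it -/

section StateSpace

/-- Lebesgue measure on the history interval `[-1,0]`. -/
noncomputable def histMeasure : Measure ℝ := volume.restrict (Icc (-1) 0)

/-- The space of histories `L^p([-1,0]; H)`. -/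
abbrev Hist (H : Type*) [NormedAddCommGroup H] (p : ℝ≥0∞) : Type _ := Lp H p histMeasure

/-- The state space `H × L^p([-1,0]; H)`, with the maximum of the two norms. -/
abbrev State (H : Type*) [NormedAddCommGroup H] (p : ℝ≥0∞) : Type _ := H × Hist H p

variable {H : Type*} [NormedAddCommGroup H] {p : ℝ≥0∞}

/-- `f ∈ W^{1,p}([-1,0]; H)` with derivative `g ∈ L^p([-1,0]; H)`, and `F` is, on `[-1,0]`, the
(unique) absolutely continuous representative of the class `f`. -/
def IsSobolevRep [NormedSpace ℝ H] (F : ℝ → H) (f g : Hist H p) : Prop :=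
  (f : ℝ → H) =ᵐ[histMeasure] F ∧
    ∀ σ ∈ Icc (-1 : ℝ) 0, F σ = F 0 + ∫ s in (0 : ℝ)..σ, (g : ℝ → H) s

variable {𝕜 : Type*} [RCLike 𝕜] [NormedSpace 𝕜 H]

/-- The graph of `A₁ (x, f) = (B x, 0)` with domain `D(A₁) = D(B) × L^p([-1,0]; H)`. -/
def graphA₁ (p : ℝ≥0∞) (B : H →ₗ.[𝕜] H) : Set (State H p × State H p) :=
  {q | ∃ (x : B.domain) (f : Hist H p), q = (((x : H), f), (B x, 0))}

/-- The graph of `A₂ (x, f) = (Φ f, f')` with domain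
`D(A₂) = {(x, f) ∈ H × W^{1,p}([-1,0]; H) : f(0) = x}`. -/
def graphA₂ [NormedSpace ℝ H] (p : ℝ≥0∞) (η : ℝ → H →L[𝕜] H) :
    Set (State H p × State H p) :=
  {q | ∃ (x : H) (F : ℝ → H) (f g : Hist H p), IsSobolevRep F f g ∧ F 0 = x ∧
    q = ((x, f), (delayOp η F, g))}

/-- The graph of the delay generator `G (x, f) = (B x + Φ f, f')` with domain
`D(G) = {(x, f) ∈ D(B) × W^{1,p}([-1,0]; H) : f(0) = x}`. -/
def graphG [NormedSpace ℝ H] (p : ℝ≥0∞) (B : H →ₗ.[𝕜] H) (η : ℝ → H →L[𝕜] H) :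
    Set (State H p × State H p) :=
  {q | ∃ (x : B.domain) (F : ℝ → H) (f g : Hist H p), IsSobolevRep F f g ∧ F 0 = (x : H) ∧
    q = (((x : H), f), (B x + delayOp η F, g))}

end StateSpace

end DelaySplitting

open DelaySplitting

set_option linter.unusedSectionVars false

/-! The equation `u' = B u + Φ u_t` is solved in mild form, `u(t) = V(t) x + ∫_0^t V(t-s) Φ u_s ds`,
and the semigroup of `G` carries a state to the current value ("head") and history of its solution.
`Φ` is bounded for the supremum norm, in general not on `L^p`, so the construction rests on an
averaged bound: `∫_0^t ‖Φ u_s‖ ds` is at most `K` times the largest integral of `‖u‖` over a window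
`[σ, σ+t]`, `σ ∈ [-1,0]` (`isDelayFunctional_delayLin`). With Gronwall it bounds the solution by the
head and the `L^1` norm of the history (`IsMildSolution.norm_le`), and the flow extends by density
from continuous histories to all states (`delaySemigroup`). Taking `V` trivial yields the semigroup
of `A₂`, so one construction and one generator computation (`gen_delaySemigroup_iff`) serve both
`A₂` and `G`.

Local error. Let `y` and `u` be the solutions of the pure and the full delay equation with the same
history. The heads differ by `∫_0^h V(h-s) (V(s) Φ y_s - Φ u_s) ds`. The integrand is `O(s)` for two
reasons: `y_s - u_s` is `O(s)` in supremum norm, and `Φ y_s` lies in `D(B)` with `B Φ` bounded on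
`W^{1,p}` by the closed graph theorem (`exists_bound_generator_delay`). Hence `O(h^2)` for the head.
The histories agree except on `(-h, 0]`, where they differ by `O(h)`, and the `L^p` norm of such a
tail contributes the factor `h^{1/p}` (`exists_local_error`).

Global error. Summing state errors of order `h^{1+1/p}` would only give `n^{-1/p}`. Instead the head
and the supremum of the history error are followed separately (`norm_splitting_pow_sub_le`). Old
history is merely translated, and each `O(h)` history error is made once, on the newly written
window; it returns to the head only through `Φ`, with a factor `h` (`splitting_step_bound`). So only
the `O(h^2)` head errors accumulate, which gives order one.

These estimates use the graph norm of `G` alone; `D(G^2)` enters only in bounding `‖G z‖` by `‖z‖ +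
‖G² z‖` (`C0Semigroup.Gen.norm_le_of_sq`). -/

namespace DelaySplitting

/-! ### Orbits and generators of a semigroup -/

section SemigroupGeneral

variable {𝕜 : Type*} [RCLike 𝕜] {X : Type*} [NormedAddCommGroup X] [NormedSpace 𝕜 X]

/-- The orbit of `x` under `T`, as a function of a real parameter. -/
noncomputable def C0Semigroup.orbit (T : C0Semigroup 𝕜 X) (x : X) (s : ℝ) : X :=
  T.op s.toNNReal x

namespace C0Semigroup

variable (T : C0Semigroup 𝕜 X)

theorem op_zero_apply (x : X) : T.op 0 x = x := by simp [T.op_zero]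

theorem op_add_apply (s t : ℝ≥0) (x : X) : T.op (s + t) x = T.op s (T.op t x) := by
  simp [T.op_add]

theorem orbit_zero (x : X) : T.orbit x 0 = x := by simp [orbit, T.op_zero]

theorem orbit_coe (x : X) (t : ℝ≥0) : T.orbit x t = T.op t x := by simp [orbit]

theorem orbit_add (x : X) {s t : ℝ} (hs : 0 ≤ s) (ht : 0 ≤ t) :
    T.orbit x (s + t) = T.op s.toNNReal (T.orbit x t) := by
  simp [orbit, Real.toNNReal_add hs ht, T.op_add_apply]

theorem tendsto_orbit_zero (x : X) : Tendsto (T.orbit x) (𝓝 0) (𝓝 x) := by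
  have h := (T.tendsto_zero x).comp (continuous_real_toNNReal.tendsto' 0 0 (by simp))
  exact h

/-- The semigroup law pulls out `T.op (min a b)`, so an increment of the orbit is at most `M *
‖T.orbit x |b - a| - x‖`. This gives continuity from both sides out of strong continuity at `0`. -/
theorem continuousOn_orbit {τ M : ℝ} (hM : ∀ s : ℝ≥0, (s : ℝ) ≤ τ → ‖T.op s‖ ≤ M) (x : X) :
    ContinuousOn (T.orbit x) (Icc 0 τ) := by
  intro a ha
  have hM0 : 0 ≤ M := (norm_nonneg _).trans (hM 0 (by simpa using ha.1.trans ha.2))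
  have key : ∀ b ∈ Icc 0 τ, dist (T.orbit x b) (T.orbit x a) ≤ M * ‖T.orbit x |b - a| - x‖ := by
    have aux : ∀ a b : ℝ, 0 ≤ a → a ≤ b → b ≤ τ →
        ‖T.orbit x b - T.orbit x a‖ ≤ M * ‖T.orbit x |b - a| - x‖ := by
      intro a b ha hab hb
      have : T.orbit x b = T.op a.toNNReal (T.orbit x |b - a|) := by
        rw [← T.orbit_add x ha (abs_nonneg _), abs_of_nonneg (by linarith)]; congr 1; ring
      rw [this, show T.orbit x a = T.op a.toNNReal x from rfl, ← map_sub]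
      refine ((T.op a.toNNReal).le_opNorm _).trans ?_
      gcongr
      exact hM _ (by rw [Real.coe_toNNReal _ ha]; linarith)
    intro b hb
    rw [dist_eq_norm]
    rcases le_total a b with h | h
    · exact aux a b ha.1 h hb.2
    · rw [norm_sub_rev, abs_sub_comm]
      exact aux b a hb.1 h ha.2
  rw [ContinuousWithinAt, tendsto_iff_dist_tendsto_zero]
  refine squeeze_zero' (Eventually.of_forall fun _ => dist_nonneg)
    (eventually_mem_nhdsWithin.mono key) ?_
  have h1 : Tendsto (fun b => |b - a|) (𝓝[Icc 0 τ] a) (𝓝 0) := by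
    have : Continuous fun b : ℝ => |b - a| := by fun_prop
    simpa using (this.tendsto a).mono_left nhdsWithin_le_nhds
  have h2 := (((T.tendsto_orbit_zero x).comp h1).sub_const x).norm.const_mul M
  simpa using h2

theorem continuous_orbit (hM : ∀ τ : ℝ, ∃ M, ∀ s : ℝ≥0, (s : ℝ) ≤ τ → ‖T.op s‖ ≤ M) (x : X) :
    Continuous (T.orbit x) := by
  have h1 : ContinuousOn (T.orbit x) (Ici 0) := by
    intro a ha
    obtain ⟨M, hM⟩ := hM (a + 1)
    refine (T.continuousOn_orbit hM x a ⟨ha, by linarith⟩).mono_of_mem_nhdsWithin ?_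
    rw [← Ici_inter_Iic]
    exact inter_mem_nhdsWithin _ (Iic_mem_nhds (by linarith))
  have h2 : T.orbit x = fun t => T.orbit x (max t 0) := by
    funext t
    simp only [orbit]
    congr 2
    rw [Real.toNNReal_of_nonneg (le_max_right t 0)]; rfl
  rw [h2]
  exact h1.comp_continuous (by fun_prop) fun t => mem_Ici.2 (le_max_right _ _)

variable [NormedSpace ℝ X] [IsScalarTower ℝ 𝕜 X]

/-- `x` lies in the domain of the generator of `T`, which maps it to `y`: the orbit of `x` has
right derivative `y` at `0`. -/
def Gen (x y : X) : Prop := HasDerivWithinAt (T.orbit x) y (Ici 0) 0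

variable {T}

theorem ofReal_inv_smul_eq (t : ℝ) (x : X) : ((t : 𝕜))⁻¹ • x = t⁻¹ • x := by
  rw [← RCLike.ofReal_inv, ← algebraMap_smul 𝕜 t⁻¹ x]

theorem gen_iff_tendsto {x y : X} :
    T.Gen x y ↔ Tendsto (fun t : ℝ => t⁻¹ • (T.orbit x t - x)) (𝓝[>] 0) (𝓝 y) := by
  rw [Gen, ← hasDerivWithinAt_Ioi_iff_Ici, hasDerivWithinAt_iff_tendsto_slope' self_notMem_Ioi]
  refine tendsto_congr fun t => ?_
  simp [slope, orbit_zero]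

theorem gen_iff {x y : X} :
    T.Gen x y ↔
      Tendsto (fun t : ℝ≥0 => (((t : ℝ) : 𝕜))⁻¹ • (T.op t x - x)) (𝓝[>] 0) (𝓝 y) := by
  have hm : 𝓝[>] (0 : ℝ) = map ((↑) : ℝ≥0 → ℝ) (𝓝[>] 0) := by
    rw [NNReal.isEmbedding_coe.map_nhdsWithin_eq]
    congr 1
    ext t
    constructor
    · intro ht
      exact ⟨⟨t, le_of_lt ht⟩, ht, rfl⟩
    · rintro ⟨s, hs, rfl⟩
      exact hs
  rw [gen_iff_tendsto, hm, tendsto_map'_iff]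
  refine tendsto_congr fun t => ?_
  simp [orbit_coe, ofReal_inv_smul_eq]

theorem HasGenerator.mem_iff {A : Set (X × X)} (h : T.HasGenerator A) {x y : X} :
    (x, y) ∈ A ↔ T.Gen x y := (h x y).trans gen_iff.symm

theorem hasGenerator_of_forall {A : Set (X × X)} (h : ∀ x y, (x, y) ∈ A ↔ T.Gen x y) :
    T.HasGenerator A := fun x y => (h x y).trans gen_iff

theorem Gen.unique {x y y' : X} (h : T.Gen x y) (h' : T.Gen x y') : y = y' :=
  (uniqueDiffWithinAt_Ici (0 : ℝ)).eq_deriv _ h h'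

theorem Gen.op {x y : X} (h : T.Gen x y) (s : ℝ≥0) : T.Gen (T.op s x) (T.op s y) := by
  rw [gen_iff_tendsto] at h ⊢
  refine (((T.op s).continuous.tendsto y).comp h).congr fun t => ?_
  have e : T.orbit (T.op s x) t = T.op s (T.orbit x t) := by
    simp only [orbit]
    rw [← T.op_add_apply, ← T.op_add_apply, add_comm]
  rw [e, Function.comp_apply, ← map_sub, ← ofReal_inv_smul_eq (𝕜 := 𝕜), map_smul,
    ofReal_inv_smul_eq]

theorem Gen.hasDerivWithinAt {x y : X} (h : T.Gen x y) {s : ℝ} (hs : 0 ≤ s) :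
    HasDerivWithinAt (T.orbit x) (T.orbit y s) (Ici s) s := by
  have h1 : HasDerivWithinAt (T.orbit (T.orbit x s)) (T.orbit y s) (Ici 0) 0 := h.op s.toNNReal
  have h2 : HasDerivWithinAt (fun t : ℝ => T.orbit (T.orbit x s) (t - s))
      ((1 : ℝ) • T.orbit y s) (Ici s) s :=
    h1.scomp_of_eq s ((hasDerivAt_id s).sub_const s).hasDerivWithinAt
      (fun t ht => mem_Ici.2 (sub_nonneg.2 ht)) (sub_self s).symm
  rw [one_smul] at h2
  refine h2.congr (fun t ht => ?_) ?_
  · have ht' : s ≤ t := ht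
    have := T.orbit_add x (sub_nonneg.2 ht') hs
    rw [sub_add_cancel] at this
    exact this
  · simp [orbit_zero]

/-- Mean value inequality for `s ↦ T.orbit x s - s • w`, whose right derivative is `T.orbit y s -
w`. It stands in for the integral formula for `T(τ)x - x`, so completeness of `X` is not needed. -/
theorem Gen.norm_sub_sub_le {x y w : X} (h : T.Gen x y) {τ M D : ℝ} (hτ : 0 ≤ τ)
    (hM : ∀ s : ℝ≥0, (s : ℝ) ≤ τ → ‖T.op s‖ ≤ M)
    (hD : ∀ s ∈ Icc 0 τ, ‖T.orbit y s - w‖ ≤ D) : ‖T.orbit x τ - x - τ • w‖ ≤ D * τ := by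
  have hc : ContinuousOn (fun s : ℝ => T.orbit x s - s • w) (Icc 0 τ) :=
    (T.continuousOn_orbit hM x).sub (by fun_prop)
  have hd : ∀ s ∈ Ico 0 τ, HasDerivWithinAt (fun s : ℝ => T.orbit x s - s • w)
      (T.orbit y s - w) (Ici s) s := by
    intro s hs
    have := ((hasDerivAt_id s).smul_const w).hasDerivWithinAt (s := Ici s)
    simpa using! (h.hasDerivWithinAt hs.1).sub this
  have := norm_image_sub_le_of_norm_deriv_right_le_segment hc hd
    (fun s hs => hD s (Ico_subset_Icc_self hs)) τ ⟨hτ, le_rfl⟩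
  simpa [orbit_zero, sub_right_comm] using this

theorem Gen.norm_sub_le {x y : X} (h : T.Gen x y) {τ M : ℝ} (hτ : 0 ≤ τ)
    (hM : ∀ s : ℝ≥0, (s : ℝ) ≤ τ → ‖T.op s‖ ≤ M) :
    ‖T.orbit x τ - x‖ ≤ M * ‖y‖ * τ := by
  have := h.norm_sub_sub_le (w := 0) (D := M * ‖y‖) hτ hM (fun s hs => by
    rw [sub_zero]
    exact ((T.op s.toNNReal).le_opNorm _).trans (by
      gcongr
      exact hM _ (by rw [Real.coe_toNNReal _ hs.1]; exact hs.2)))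
  simpa using this

/-- A Landau–Kolmogorov type bound for the generator. -/
theorem Gen.norm_le_of_sq {x y z : X} (h : T.Gen x y) (h' : T.Gen y z) {M : ℝ}
    (hM : ∀ s : ℝ≥0, (s : ℝ) ≤ 1 → ‖T.op s‖ ≤ M) :
    ‖y‖ ≤ (M + 1) * (‖x‖ + ‖z‖) := by
  have hM0 : 0 ≤ M := (norm_nonneg _).trans (hM 0 (by simp))
  -- Taylor expansion to second order at time `1`, solved for the first-order term `y`.
  have h1 : ‖T.orbit x 1 - x - (1 : ℝ) • y‖ ≤ (M * ‖z‖) * 1 := by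
    refine h.norm_sub_sub_le zero_le_one hM fun s hs => ?_
    refine (h'.norm_sub_le (M := M) hs.1 fun r hr => hM r (hr.trans hs.2)).trans ?_
    exact mul_le_of_le_one_right (by positivity) hs.2
  have h2 : ‖T.orbit x 1‖ ≤ M * ‖x‖ :=
    ((T.op _).le_opNorm _).trans (by gcongr; exact hM _ (by simp))
  have e : y = T.orbit x 1 - x - (T.orbit x 1 - x - (1 : ℝ) • y) := by
    rw [one_smul]; abel
  calc ‖y‖ ≤ ‖T.orbit x 1‖ + ‖x‖ + ‖T.orbit x 1 - x - (1 : ℝ) • y‖ := by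
        conv_lhs => rw [e]
        exact (_root_.norm_sub_le _ _).trans (by gcongr; exact _root_.norm_sub_le _ _)
    _ ≤ M * ‖x‖ + ‖x‖ + M * ‖z‖ * 1 := by gcongr
    _ ≤ _ := by nlinarith [norm_nonneg x, norm_nonneg z]

/-- The generator is closed. -/
theorem gen_of_tendsto {τ M : ℝ} (hτ : 0 < τ) (hM : ∀ s : ℝ≥0, (s : ℝ) ≤ τ → ‖T.op s‖ ≤ M)
    {x y : ℕ → X} {a b : X} (h : ∀ n, T.Gen (x n) (y n)) (hx : Tendsto x atTop (𝓝 a))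
    (hy : Tendsto y atTop (𝓝 b)) : T.Gen a b := by
  have hM0 : 0 ≤ M := (norm_nonneg _).trans (hM 0 (by simpa using hτ.le))
  rw [gen_iff_tendsto, Metric.tendsto_nhdsWithin_nhds]
  intro ε hε
  obtain ⟨δ, hδ, hb⟩ := Metric.tendsto_nhds_nhds.1 (T.tendsto_orbit_zero b) (ε / 2) (by positivity)
  refine ⟨min δ τ, by positivity, fun {t} ht htd => ?_⟩
  have ht0 : 0 < t := ht
  rw [Real.dist_eq, sub_zero, abs_of_pos ht0, lt_min_iff] at htd
  -- The admissible range of `t` depends only on `b`, not on `n`, so the estimate survives the limit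
  -- `n → ∞`, in which the term with `y n - b` vanishes.
  have hn : ∀ n, ‖T.orbit (x n) t - x n - t • b‖ ≤ (M * ‖y n - b‖ + ε / 2) * t := by
    intro n
    refine (h n).norm_sub_sub_le ht0.le (fun s hs => hM s (hs.trans htd.2.le)) fun s hs => ?_
    have e : T.orbit (y n) s - b = T.op s.toNNReal (y n - b) + (T.orbit b s - b) := by
      simp [orbit]
    rw [e]
    refine (norm_add_le _ _).trans (add_le_add ?_ ?_)
    · refine ((T.op s.toNNReal).le_opNorm _).trans ?_
      gcongr
      exact hM _ (by rw [Real.coe_toNNReal _ hs.1]; exact hs.2.trans htd.2.le)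
    · have := hb (x := s) (by
        rw [Real.dist_eq, sub_zero, abs_of_nonneg hs.1]; exact hs.2.trans_lt htd.1)
      rw [dist_eq_norm] at this
      exact this.le
  have hlim : ‖T.orbit a t - a - t • b‖ ≤ (M * ‖b - b‖ + ε / 2) * t := by
    refine le_of_tendsto_of_tendsto' (b := atTop) ?_ ?_ hn
    · have h1 : Tendsto (fun n => T.orbit (x n) t) atTop (𝓝 (T.orbit a t)) :=
        ((T.op t.toNNReal).continuous.tendsto a).comp hx
      exact ((h1.sub hx).sub_const _).norm
    · exact ((((hy.sub_const b).norm).const_mul M).add_const _).mul_const t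
  rw [sub_self, norm_zero, mul_zero, zero_add] at hlim
  rw [dist_eq_norm]
  have e : t⁻¹ • (T.orbit a t - a) - b = t⁻¹ • (T.orbit a t - a - t • b) := by
    rw [smul_sub t⁻¹ (T.orbit a t - a), smul_smul, inv_mul_cancel₀ ht0.ne', one_smul]
  rw [e, norm_smul, norm_inv, Real.norm_of_nonneg ht0.le]
  calc t⁻¹ * ‖T.orbit a t - a - t • b‖ ≤ t⁻¹ * (ε / 2 * t) := by gcongr
    _ = ε / 2 := by field_simp
    _ < ε := by linarith

end C0Semigroup

end SemigroupGeneral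

/-! ### Existence and uniqueness of the Riemann–Stieltjes integral -/

section TaggedPartitions

/-- `t` is a partition of `[a,b]` into `n` pieces of length less than `δ`, with tags `s`. -/
structure IsTaggedPartition (a b δ : ℝ) (n : ℕ) (t s : ℕ → ℝ) : Prop where
  left : t 0 = a
  right : t n = b
  tag : ∀ i < n, t i ≤ s i ∧ s i ≤ t (i + 1) ∧ t (i + 1) - t i < δ

theorem IsTaggedPartition.mono {a b δ : ℝ} {n : ℕ} {t s : ℕ → ℝ}
    (h : IsTaggedPartition a b δ n t s) {i j : ℕ} (hij : i ≤ j) (hj : j ≤ n) : t i ≤ t j := by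
  induction j, hij using Nat.le_induction with
  | base => exact le_rfl
  | succ k _ ih =>
    exact (ih (by omega)).trans ((h.tag k (by omega)).1.trans (h.tag k (by omega)).2.1)

theorem IsTaggedPartition.mem {a b δ : ℝ} {n : ℕ} {t s : ℕ → ℝ}
    (h : IsTaggedPartition a b δ n t s) {i : ℕ} (hi : i ≤ n) : t i ∈ Icc a b :=
  ⟨h.left ▸ h.mono (Nat.zero_le i) hi, h.right ▸ h.mono hi le_rfl⟩

theorem IsTaggedPartition.tag_mem {a b δ : ℝ} {n : ℕ} {t s : ℕ → ℝ}
    (h : IsTaggedPartition a b δ n t s) {i : ℕ} (hi : i < n) : s i ∈ Icc a b :=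
  ⟨(h.mem hi.le).1.trans (h.tag i hi).1, (h.tag i hi).2.1.trans (h.mem hi).2⟩

/-- The mixed second difference of `(x, y) ↦ η (min x y)`: the increment of `η` over the
intersection of `[x, x']` and `[y, y']`. -/
def overlap {E : Type*} [AddCommGroup E] (η : ℝ → E) (x x' y y' : ℝ) : E :=
  (η (min x' y') - η (min x y')) - (η (min x' y) - η (min x y))

variable {E : Type*}

theorem overlap_comm [AddCommGroup E] (η : ℝ → E) (x x' y y' : ℝ) :
    overlap η x x' y y' = overlap η y y' x x' := by
  simp only [overlap, min_comm]
  abel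

theorem overlap_eq_zero [AddCommGroup E] (η : ℝ → E) {x x' y y' : ℝ} (hx : x ≤ x') (hy : y ≤ y')
    (h : x' ≤ y ∨ y' ≤ x) : overlap η x x' y y' = 0 := by
  rcases h with h | h
  · simp [overlap, min_eq_left (h.trans hy), min_eq_left h, min_eq_left (hx.trans h),
      min_eq_left (hx.trans (h.trans hy))]
  · simp [overlap, min_eq_right h, min_eq_right (h.trans hx), min_eq_right (hy.trans h),
      min_eq_right (hy.trans (h.trans hx))]

theorem overlap_eq_sub [AddCommGroup E] (η : ℝ → E) {x x' y y' : ℝ} (h : y ≤ x') (h' : x ≤ y') :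
    overlap η x x' y y' = η (min x' y') - η (max x y) := by
  rw [overlap, min_eq_left h', min_eq_right h]
  rcases le_total x y with g | g
  · rw [min_eq_left g, max_eq_right g]; abel
  · rw [min_eq_right g, max_eq_left g]; abel

/-- The second difference telescopes. Through this identity two partitions are compared without
constructing a common refinement. -/
theorem sum_overlap [AddCommGroup E] (η : ℝ → E) {a b δ : ℝ} {n : ℕ} {t s : ℕ → ℝ}
    (h : IsTaggedPartition a b δ n t s) {x x' : ℝ} (hx : x ∈ Icc a b) (hx' : x' ∈ Icc a b) :
    ∑ j ∈ Finset.range n, overlap η x x' (t j) (t (j + 1)) = η x' - η x := by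
  unfold overlap
  rw [Finset.sum_range_sub (fun j => η (min x' (t j)) - η (min x (t j))), h.left, h.right,
    min_eq_left hx.2, min_eq_left hx'.2, min_eq_right hx.1, min_eq_right hx'.1]
  abel

variable {𝕜 : Type*} [RCLike 𝕜] {H : Type*} [NormedAddCommGroup H] [NormedSpace 𝕜 H]

/-- An overlap is either zero or one increment of `η` over the intersection of the two intervals, so
it inherits the domination by `v`. -/
theorem norm_overlap_le [NormedAddCommGroup E] {η : ℝ → E} {v : ℝ → ℝ} {a b : ℝ}
    (hv : ∀ x y, a ≤ x → x ≤ y → y ≤ b → ‖η y - η x‖ ≤ v y - v x) {x x' y y' : ℝ}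
    (hxx : x ≤ x') (hyy : y ≤ y') (hx : a ≤ x) (hx' : x' ≤ b) :
    ‖overlap η x x' y y'‖ ≤ overlap v x x' y y' := by
  rcases le_or_gt x' y with h | h
  · rw [overlap_eq_zero _ hxx hyy (.inl h), overlap_eq_zero _ hxx hyy (.inl h), norm_zero]
  rcases le_or_gt y' x with h' | h'
  · rw [overlap_eq_zero _ hxx hyy (.inr h'), overlap_eq_zero _ hxx hyy (.inr h'), norm_zero]
  rw [overlap_eq_sub _ h.le h'.le, overlap_eq_sub _ h.le h'.le]
  exact hv _ _ (hx.trans (le_max_left _ _)) (max_le (le_min hxx h'.le) (le_min h.le hyy))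
    ((min_le_left _ _).trans hx')

/-- Both sums are written as double sums over pairs of cells, weighted by overlaps. Only cells that
meet contribute, and their tags are less than `2 * δ` apart; the overlaps of `v` add up to `v b - v
a`. -/
theorem norm_stieltjesSum_sub_le {η : ℝ → H →L[𝕜] H} {v : ℝ → ℝ} {a b : ℝ}
    (hv : ∀ x y, a ≤ x → x ≤ y → y ≤ b → ‖η y - η x‖ ≤ v y - v x) {δ ω : ℝ} {F : ℝ → H}
    (hF : ∀ x ∈ Icc a b, ∀ y ∈ Icc a b, |x - y| < 2 * δ → ‖F x - F y‖ ≤ ω)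
    {n m : ℕ} {t s t' s' : ℕ → ℝ} (h : IsTaggedPartition a b δ n t s)
    (h' : IsTaggedPartition a b δ m t' s') :
    ‖∑ i ∈ Finset.range n, (η (t (i + 1)) - η (t i)) (F (s i)) -
      ∑ j ∈ Finset.range m, (η (t' (j + 1)) - η (t' j)) (F (s' j))‖ ≤ (v b - v a) * ω := by
  have e1 : ∑ i ∈ Finset.range n, (η (t (i + 1)) - η (t i)) (F (s i)) =
      ∑ i ∈ Finset.range n, ∑ j ∈ Finset.range m,
        overlap η (t i) (t (i + 1)) (t' j) (t' (j + 1)) (F (s i)) := by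
    refine Finset.sum_congr rfl fun i hi => ?_
    have hi := Finset.mem_range.1 hi
    rw [← sum_overlap η h' (h.mem hi.le) (h.mem hi), sum_apply]
  have e2 : ∑ j ∈ Finset.range m, (η (t' (j + 1)) - η (t' j)) (F (s' j)) =
      ∑ i ∈ Finset.range n, ∑ j ∈ Finset.range m,
        overlap η (t i) (t (i + 1)) (t' j) (t' (j + 1)) (F (s' j)) := by
    rw [Finset.sum_comm]
    refine Finset.sum_congr rfl fun j hj => ?_
    have hj := Finset.mem_range.1 hj
    rw [← sum_overlap η h (h'.mem hj.le) (h'.mem hj), sum_apply]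
    simp only [overlap_comm]
  have e3 : (v b - v a) * ω = ∑ i ∈ Finset.range n, ∑ j ∈ Finset.range m,
      overlap v (t i) (t (i + 1)) (t' j) (t' (j + 1)) * ω := by
    simp_rw [← Finset.sum_mul]
    congr 1
    rw [← h.left, ← h.right, ← Finset.sum_range_sub (fun i => v (t i))]
    refine Finset.sum_congr rfl fun i hi => ?_
    have hi := Finset.mem_range.1 hi
    rw [sum_overlap v h' (h.mem hi.le) (h.mem hi)]
  rw [e1, e2, e3, ← Finset.sum_sub_distrib]
  refine norm_sum_le_of_le _ fun i hi => ?_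
  rw [← Finset.sum_sub_distrib]
  refine norm_sum_le_of_le _ fun j hj => ?_
  have hi := Finset.mem_range.1 hi
  have hj := Finset.mem_range.1 hj
  have hti := h.tag i hi
  have htj := h'.tag j hj
  have hxx := h.mono (Nat.le_succ i) hi
  have hyy := h'.mono (Nat.le_succ j) hj
  rcases le_or_gt (t (i + 1)) (t' j) with g | g
  · simp [overlap_eq_zero _ hxx hyy (.inl g)]
  rcases le_or_gt (t' (j + 1)) (t i) with g' | g'
  · simp [overlap_eq_zero _ hxx hyy (.inr g')]
  rw [← map_sub]
  have hn := norm_overlap_le hv hxx hyy (h.mem hi.le).1 (h.mem hi).2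
  refine (ContinuousLinearMap.le_opNorm _ _).trans
    (mul_le_mul hn (hF _ (h.tag_mem hi) _ (h'.tag_mem hj) ?_) (norm_nonneg _)
      ((norm_nonneg _).trans hn))
  rw [abs_lt]
  constructor <;> linarith [hti.1, hti.2.1, hti.2.2, htj.1, htj.2.1, htj.2.2]

/-- The nodes of the uniform partition of `[-1,0]` into `n` pieces. -/
noncomputable def uniformNode (n i : ℕ) : ℝ := -1 + (i : ℝ) / n

/-- The Riemann–Stieltjes sum over the uniform partition of `[-1,0]` into `n` pieces. -/
noncomputable def uniformSum (η : ℝ → H →L[𝕜] H) (F : ℝ → H) (n : ℕ) : H :=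
  ∑ i ∈ Finset.range n,
    (η (uniformNode n (i + 1)) - η (uniformNode n i)) (F (uniformNode n i))

theorem isTaggedPartition_uniform {n : ℕ} (hn : 0 < n) {δ : ℝ} (hδ : 1 / (n : ℝ) < δ) :
    IsTaggedPartition (-1) 0 δ n (uniformNode n) (uniformNode n) := by
  have hn' : (0 : ℝ) < n := by exact_mod_cast hn
  refine ⟨by simp [uniformNode], by simp [uniformNode, hn'.ne'], fun i _ => ⟨le_rfl, ?_, ?_⟩⟩
  · simp only [uniformNode]; push_cast; gcongr; linarith
  · simp only [uniformNode]; push_cast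
    calc -1 + ((i : ℝ) + 1) / n - (-1 + (i : ℝ) / n) = 1 / n := by ring
      _ < δ := hδ

theorem eventually_isTaggedPartition_uniform {δ : ℝ} (hδ : 0 < δ) : ∀ᶠ n : ℕ in atTop,
    IsTaggedPartition (-1) 0 δ n (uniformNode n) (uniformNode n) := by
  filter_upwards [eventually_gt_atTop 0,
    (tendsto_one_div_atTop_nhds_zero_nat (𝕜 := ℝ)).eventually (gt_mem_nhds hδ)] with n hn h
  exact isTaggedPartition_uniform hn h

/-- One concrete sequence of sums computes every integral. Uniqueness, linearity and all bounds for
the delay operator are read off from it. -/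
theorem HasStieltjesIntegral.tendsto_uniformSum {η : ℝ → H →L[𝕜] H} {F : ℝ → H} {I : H}
    (h : HasStieltjesIntegral η F (-1) 0 I) : Tendsto (uniformSum η F) atTop (𝓝 I) := by
  rw [Metric.tendsto_nhds]
  intro ε hε
  obtain ⟨δ, hδ, hI⟩ := h ε hε
  filter_upwards [eventually_isTaggedPartition_uniform hδ] with n hn
  rw [dist_eq_norm]
  exact hI n _ _ hn.left hn.right hn.tag

theorem HasStieltjesIntegral.unique {η : ℝ → H →L[𝕜] H} {F : ℝ → H} {I J : H}
    (hI : HasStieltjesIntegral η F (-1) 0 I) (hJ : HasStieltjesIntegral η F (-1) 0 J) : I = J :=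
  tendsto_nhds_unique hI.tendsto_uniformSum hJ.tendsto_uniformSum

theorem HasStieltjesIntegral.delayOp_eq {η : ℝ → H →L[𝕜] H} {F : ℝ → H} {I : H}
    (h : HasStieltjesIntegral η F (-1) 0 I) : delayOp η F = I := by
  have hex : ∃ I : H, HasStieltjesIntegral η F (-1) 0 I := ⟨I, h⟩
  rw [delayOp, dif_pos hex]
  exact hex.choose_spec.unique h

theorem HasStieltjesIntegral.congr {η : ℝ → H →L[𝕜] H} {F G : ℝ → H} {I : H} {a b : ℝ}
    (h : HasStieltjesIntegral η F a b I) (hFG : EqOn F G (Icc a b)) :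
    HasStieltjesIntegral η G a b I := by
  intro ε hε
  obtain ⟨δ, hδ, hI⟩ := h ε hε
  refine ⟨δ, hδ, fun n t s h0 hn ht => ?_⟩
  have e : ∑ i ∈ Finset.range n, (η (t (i + 1)) - η (t i)) (G (s i)) =
      ∑ i ∈ Finset.range n, (η (t (i + 1)) - η (t i)) (F (s i)) :=
    Finset.sum_congr rfl fun i hi => by
      rw [hFG (IsTaggedPartition.tag_mem ⟨h0, hn, ht⟩ (Finset.mem_range.1 hi))]
  rw [e]
  exact hI n t s h0 hn ht

theorem delayOp_congr {η : ℝ → H →L[𝕜] H} {F G : ℝ → H} (hFG : EqOn F G (Icc (-1) 0)) :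
    delayOp η F = delayOp η G := by
  by_cases h : ∃ I : H, HasStieltjesIntegral η F (-1) 0 I
  · obtain ⟨I, hI⟩ := h
    rw [hI.delayOp_eq, (hI.congr hFG).delayOp_eq]
  · have h' : ¬∃ I : H, HasStieltjesIntegral η G (-1) 0 I :=
      fun ⟨I, hI⟩ => h ⟨I, hI.congr hFG.symm⟩
    rw [delayOp, delayOp, dif_neg h, dif_neg h']

variable [CompleteSpace H]

theorem exists_hasStieltjesIntegral {η : ℝ → H →L[𝕜] H} {v : ℝ → ℝ}
    (hv : ∀ x y, -1 ≤ x → x ≤ y → y ≤ 0 → ‖η y - η x‖ ≤ v y - v x) {F : ℝ → H}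
    (hF : ContinuousOn F (Icc (-1) 0)) : ∃ I, HasStieltjesIntegral η F (-1) 0 I := by
  set W := v 0 - v (-1) with hW
  have hW0 : 0 ≤ W := (norm_nonneg _).trans (hv (-1) 0 le_rfl (by norm_num) le_rfl)
  have hu : ∀ ε > 0, ∃ δ > 0, ∀ (n m : ℕ) (t s t' s' : ℕ → ℝ),
      IsTaggedPartition (-1) 0 δ n t s → IsTaggedPartition (-1) 0 δ m t' s' →
      ‖∑ i ∈ Finset.range n, (η (t (i + 1)) - η (t i)) (F (s i)) -
        ∑ j ∈ Finset.range m, (η (t' (j + 1)) - η (t' j)) (F (s' j))‖ < ε := by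
    intro ε hε
    have huc := isCompact_Icc.uniformContinuousOn_of_continuous hF
    rw [Metric.uniformContinuousOn_iff] at huc
    obtain ⟨δ, hδ, hd⟩ := huc (ε / (W + 1)) (by positivity)
    -- Mesh `δ / 2`, because tags of overlapping cells may be two mesh widths apart; `W + 1` avoids
    -- division by zero when `η` has no variation.
    refine ⟨δ / 2, by positivity, fun n m t s t' s' h h' => ?_⟩
    refine (norm_stieltjesSum_sub_le hv (ω := ε / (W + 1)) (fun x hx y hy hxy => ?_) h h').trans_lt ?_
    · have := hd x hx y hy (by rw [Real.dist_eq]; linarith)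
      rw [dist_eq_norm] at this
      exact this.le
    · rw [← hW, ← mul_div_assoc, div_lt_iff₀ (by positivity)]
      nlinarith
  have hc : CauchySeq (uniformSum η F) := by
    rw [Metric.cauchySeq_iff]
    intro ε hε
    obtain ⟨δ, hδ, hd⟩ := hu ε hε
    obtain ⟨N, hN⟩ := eventually_atTop.1 (eventually_isTaggedPartition_uniform hδ)
    refine ⟨N, fun m hm n hn => ?_⟩
    rw [dist_eq_norm]
    exact hd _ _ _ _ _ _ (hN m hm) (hN n hn)
  obtain ⟨I, hI⟩ := cauchySeq_tendsto_of_complete hc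
  refine ⟨I, fun ε hε => ?_⟩
  obtain ⟨δ, hδ, hd⟩ := hu (ε / 2) (by positivity)
  refine ⟨δ, hδ, fun n t s h0 hn ht => ?_⟩
  refine lt_of_le_of_lt (b := ε / 2) ?_ (by linarith)
  refine le_of_tendsto ((tendsto_const_nhds.sub hI).norm) ?_
  filter_upwards [eventually_isTaggedPartition_uniform hδ] with m hm
  exact (hd _ _ _ _ _ _ ⟨h0, hn, ht⟩ hm).le

end TaggedPartitions

/-! ### The delay operator on continuous functions and its averaged bound -/

section DelayFunctional

variable {𝕜 : Type*} [RCLike 𝕜] {H : Type*} [NormedAddCommGroup H] [NormedSpace 𝕜 H]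

/-- The translate `σ ↦ u (s + σ)` of `u`, the history of `u` at time `s`. -/
def shift (s : ℝ) (u : C(ℝ, H)) : C(ℝ, H) := ⟨fun σ => u (s + σ), by fun_prop⟩

@[simp] theorem shift_apply (s : ℝ) (u : C(ℝ, H)) (σ : ℝ) : shift s u σ = u (s + σ) := rfl

theorem shift_add (s : ℝ) (u v : C(ℝ, H)) : shift s (u + v) = shift s u + shift s v := rfl

theorem shift_sub (s : ℝ) (u v : C(ℝ, H)) : shift s (u - v) = shift s u - shift s v := rfl

theorem shift_smul (s : ℝ) (c : 𝕜) (u : C(ℝ, H)) : shift s (c • u) = c • shift s u := rfl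

theorem shift_shift (s t : ℝ) (u : C(ℝ, H)) : shift s (shift t u) = shift (s + t) u := by
  ext σ; simp only [shift_apply]; congr 1; ring

/-- Translation is continuous, uniformly on the history interval. -/
theorem eventually_shift_sub_le (u : C(ℝ, H)) (s : ℝ) {ε : ℝ} (hε : 0 < ε) :
    ∀ᶠ r in 𝓝 s, ∀ σ ∈ Icc (-1 : ℝ) 0, ‖(shift r u - shift s u) σ‖ ≤ ε := by
  have huc := (isCompact_Icc (a := s - 2) (b := s + 1)).uniformContinuousOn_of_continuous
    u.continuous.continuousOn
  rw [Metric.uniformContinuousOn_iff] at huc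
  obtain ⟨δ, hδ, hd⟩ := huc ε hε
  filter_upwards [Metric.ball_mem_nhds s (lt_min hδ one_pos)] with r hr σ hσ
  rw [Metric.mem_ball, lt_min_iff, Real.dist_eq] at hr
  obtain ⟨h1, h2⟩ := abs_lt.1 hr.2
  have := hd (r + σ) ⟨by linarith [hσ.1], by linarith [hσ.2]⟩ (s + σ)
    ⟨by linarith [hσ.1], by linarith [hσ.2]⟩ (by rw [Real.dist_eq, add_sub_add_right_eq_sub]; exact hr.1)
  rw [dist_eq_norm] at this
  exact this.le

/-- The properties of the delay operator which the construction of the solutions uses: `Φ` is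
bounded for the supremum norm on `[-1,0]`, and the time integral of `‖Φ u_s‖` is controlled by the
integrals of `‖u‖` over windows. -/
structure IsDelayFunctional [NormedSpace ℝ H] (Φ : C(ℝ, H) →ₗ[𝕜] H) (K : ℝ) : Prop where
  one_le : 1 ≤ K
  norm_le : ∀ (u : C(ℝ, H)) (m : ℝ), (∀ σ ∈ Icc (-1 : ℝ) 0, ‖u σ‖ ≤ m) → ‖Φ u‖ ≤ K * m
  integral_le : ∀ (u : C(ℝ, H)) (t M : ℝ), 0 ≤ t →
    (∀ σ ∈ Icc (-1 : ℝ) 0, ∫ r in σ..σ + t, ‖u r‖ ≤ M) → ∫ s in 0..t, ‖Φ (shift s u)‖ ≤ K * M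

namespace IsDelayFunctional

variable [NormedSpace ℝ H] {Φ : C(ℝ, H) →ₗ[𝕜] H} {K : ℝ}

theorem pos (h : IsDelayFunctional Φ K) : 0 < K := zero_lt_one.trans_le h.one_le

theorem congr (h : IsDelayFunctional Φ K) {u v : C(ℝ, H)} (huv : EqOn u v (Icc (-1) 0)) :
    Φ u = Φ v := by
  rw [← sub_eq_zero, ← map_sub, ← norm_le_zero_iff]
  simpa using h.norm_le (u - v) 0 fun σ hσ => by simp [huv hσ]

theorem continuous_shift (h : IsDelayFunctional Φ K) (u : C(ℝ, H)) :
    Continuous fun s => Φ (shift s u) := by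
  rw [continuous_iff_continuousAt]
  intro s
  rw [ContinuousAt, Metric.tendsto_nhds]
  intro ε hε
  have hK := h.pos
  filter_upwards [eventually_shift_sub_le u s (ε := ε / (2 * K)) (by positivity)] with r hr
  rw [dist_eq_norm, ← map_sub]
  refine (h.norm_le _ _ hr).trans_lt ?_
  have : K * (ε / (2 * K)) = ε / 2 := by field_simp
  rw [this]; linarith

end IsDelayFunctional

variable [CompleteSpace H]

/-- The variation function is the monotone majorant `v` required in the comparison of Stieltjes
sums. -/
theorem variation_bound {η : ℝ → H →L[𝕜] H} (hη : BoundedVariationOn η (Icc (-1) 0)) (x y : ℝ)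
    (hx : -1 ≤ x) (hxy : x ≤ y) (hy : y ≤ 0) :
    ‖η y - η x‖ ≤ variationOnFromTo η (Icc (-1) 0) (-1) y -
      variationOnFromTo η (Icc (-1) 0) (-1) x := by
  have hl := hη.locallyBoundedVariationOn
  have hxm : x ∈ Icc (-1 : ℝ) 0 := ⟨hx, hxy.trans hy⟩
  have hym : y ∈ Icc (-1 : ℝ) 0 := ⟨hx.trans hxy, hy⟩
  rw [← variationOnFromTo.add hl (left_mem_Icc.2 (by norm_num)) hxm hym, add_sub_cancel_left,
    variationOnFromTo.eq_of_le _ _ hxy, ← dist_eq_norm, dist_edist, edist_comm]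
  refine ENNReal.toReal_mono (hl x y hxm hym) (eVariationOn.edist_le _ ⟨hxm, ?_⟩ ⟨hym, ?_⟩)
  · exact ⟨le_rfl, hxy⟩
  · exact ⟨hxy, le_rfl⟩

theorem hasStieltjesIntegral_delayOp {η : ℝ → H →L[𝕜] H}
    (hη : BoundedVariationOn η (Icc (-1) 0)) {F : ℝ → H} (hF : ContinuousOn F (Icc (-1) 0)) :
    HasStieltjesIntegral η F (-1) 0 (delayOp η F) := by
  obtain ⟨I, hI⟩ := exists_hasStieltjesIntegral (variation_bound hη) hF
  rwa [hI.delayOp_eq]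

theorem tendsto_uniformSum_delayOp {η : ℝ → H →L[𝕜] H}
    (hη : BoundedVariationOn η (Icc (-1) 0)) (u : C(ℝ, H)) :
    Tendsto (uniformSum η u) atTop (𝓝 (delayOp η u)) :=
  (hasStieltjesIntegral_delayOp hη u.continuous.continuousOn).tendsto_uniformSum

/-- The delay operator, as a linear map on continuous functions. -/
noncomputable def delayLin (η : ℝ → H →L[𝕜] H) (hη : BoundedVariationOn η (Icc (-1) 0)) :
    C(ℝ, H) →ₗ[𝕜] H where
  toFun u := delayOp η u
  map_add' u v := by
    refine tendsto_nhds_unique (tendsto_uniformSum_delayOp hη (u + v))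
      (((tendsto_uniformSum_delayOp hη u).add (tendsto_uniformSum_delayOp hη v)).congr fun n => ?_)
    simp only [uniformSum, ContinuousMap.coe_add, Pi.add_apply, map_add, Finset.sum_add_distrib]
  map_smul' c u := by
    refine tendsto_nhds_unique (tendsto_uniformSum_delayOp hη (c • u))
      (((tendsto_uniformSum_delayOp hη u).const_smul c).congr fun n => ?_)
    simp only [uniformSum, Finset.smul_sum, ContinuousMap.coe_smul, Pi.smul_apply, map_smul]

@[simp] theorem delayLin_apply (η : ℝ → H →L[𝕜] H) (hη : BoundedVariationOn η (Icc (-1) 0))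
    (u : C(ℝ, H)) : delayLin η hη u = delayOp η u := rfl

theorem norm_uniformSum_le (η : ℝ → H →L[𝕜] H) (F : ℝ → H) (n : ℕ) :
    ‖uniformSum η F n‖ ≤ ∑ i ∈ Finset.range n,
      ‖η (uniformNode n (i + 1)) - η (uniformNode n i)‖ * ‖F (uniformNode n i)‖ :=
  norm_sum_le_of_le _ fun _ _ => ContinuousLinearMap.le_opNorm _ _

theorem uniformNode_mem {n i : ℕ} (h : i ≤ n) (hn : 0 < n) : uniformNode n i ∈ Icc (-1 : ℝ) 0 :=
  (isTaggedPartition_uniform hn (lt_add_one _)).mem h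

theorem sum_increments_le {η : ℝ → H →L[𝕜] H} (hη : BoundedVariationOn η (Icc (-1) 0)) {n : ℕ}
    (hn : 0 < n) :
    ∑ i ∈ Finset.range n, ‖η (uniformNode n (i + 1)) - η (uniformNode n i)‖ ≤
      variationOnFromTo η (Icc (-1) 0) (-1) 0 := by
  have h := isTaggedPartition_uniform hn (lt_add_one (1 / (n : ℝ)))
  have := Finset.sum_range_sub
    (fun i => variationOnFromTo η (Icc (-1) 0) (-1) (uniformNode n i)) n
  rw [h.left, h.right, variationOnFromTo.self, sub_zero] at this
  rw [← this]
  refine Finset.sum_le_sum fun i hi => ?_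
  have hi := Finset.mem_range.1 hi
  exact variation_bound hη _ _ (h.mem hi.le).1 (h.mono (Nat.le_succ i) hi) (h.mem hi).2

/-- For the averaged bound, sum and time integral are interchanged in the uniform sums: each node
contributes the integral of `‖u‖` over one window, and the increments of `η` have total norm at most
the variation. Dominated convergence passes to the limit. The summand `1` in the constant secures `1
≤ K`. -/
theorem isDelayFunctional_delayLin [NormedSpace ℝ H] {η : ℝ → H →L[𝕜] H}
    (hη : BoundedVariationOn η (Icc (-1) 0)) :
    IsDelayFunctional (delayLin η hη) (variationOnFromTo η (Icc (-1) 0) (-1) 0 + 1) := by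
  set W := variationOnFromTo η (Icc (-1) 0) (-1) 0 with hW
  have hW0 : 0 ≤ W := variationOnFromTo.nonneg_of_le _ _ (by norm_num)
  have hsum : ∀ (n : ℕ) (c : ℕ → ℝ) (m : ℝ), 0 < n → (∀ i < n, c i ≤ m) → 0 ≤ m →
      ∑ i ∈ Finset.range n, ‖η (uniformNode n (i + 1)) - η (uniformNode n i)‖ * c i ≤ W * m := by
    intro n c m hn hc hm
    calc _ ≤ ∑ i ∈ Finset.range n, ‖η (uniformNode n (i + 1)) - η (uniformNode n i)‖ * m :=
          Finset.sum_le_sum fun i hi => by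
            gcongr; exact hc i (Finset.mem_range.1 hi)
      _ ≤ W * m := by
          rw [← Finset.sum_mul]; gcongr; exact sum_increments_le hη hn
  refine ⟨by linarith, fun u m hm => ?_, fun u t M ht hM => ?_⟩
  · have hm0 : 0 ≤ m := (norm_nonneg _).trans (hm 0 ⟨by norm_num, le_rfl⟩)
    have h1 : ‖delayOp η u‖ ≤ W * m := by
      refine le_of_tendsto (tendsto_uniformSum_delayOp hη u).norm ?_
      filter_upwards [eventually_gt_atTop 0] with n hn
      exact (norm_uniformSum_le η u n).trans
        (hsum n _ m hn (fun i hi => hm _ (uniformNode_mem hi.le hn)) hm0)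
    rw [delayLin_apply]; linarith
  · have hM0 : 0 ≤ M := by
      refine le_trans ?_ (hM 0 ⟨by norm_num, le_rfl⟩)
      exact intervalIntegral.integral_nonneg (by linarith) fun _ _ => norm_nonneg _
    obtain ⟨m, hm⟩ := (isCompact_Icc (a := -1) (b := t)).exists_bound_of_continuousOn
      u.continuous.continuousOn
    have hm0 : 0 ≤ m := (norm_nonneg _).trans (hm 0 ⟨by norm_num, ht⟩)
    have hcont : ∀ n : ℕ, Continuous fun s => uniformSum η (shift s u) n := by
      intro n
      refine continuous_finsetSum _ fun i _ => ?_
      exact (ContinuousLinearMap.continuous _).comp (by simp only [shift_apply]; fun_prop)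
    have hlim : Tendsto (fun n : ℕ => ∫ s in 0..t, ‖uniformSum η (shift s u) n‖) atTop
        (𝓝 (∫ s in 0..t, ‖delayLin η hη (shift s u)‖)) := by
      refine intervalIntegral.tendsto_integral_filter_of_dominated_convergence (fun _ => W * m)
        (Eventually.of_forall fun n => (hcont n).norm.aestronglyMeasurable) ?_ (by simp) ?_
      · filter_upwards [eventually_gt_atTop 0] with n hn
        refine Eventually.of_forall fun s hs => ?_
        rw [uIoc_of_le ht] at hs
        rw [norm_norm]
        refine (norm_uniformSum_le η _ n).trans (hsum n _ m hn (fun i hi => ?_) hm0)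
        have := uniformNode_mem hi.le hn
        exact hm _ ⟨by linarith [this.1, hs.1], by linarith [this.2, hs.2]⟩
      · exact Eventually.of_forall fun s _ => (tendsto_uniformSum_delayOp hη (shift s u)).norm
    have h1 : ∫ s in 0..t, ‖delayLin η hη (shift s u)‖ ≤ W * M := by
      refine le_of_tendsto hlim ?_
      filter_upwards [eventually_gt_atTop 0] with n hn
      have hc : ∀ i, Continuous fun s => ‖shift s u (uniformNode n i)‖ := by
        intro i; simp only [shift_apply]; fun_prop
      calc ∫ s in 0..t, ‖uniformSum η (shift s u) n‖
          ≤ ∫ s in 0..t, ∑ i ∈ Finset.range n,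
            ‖η (uniformNode n (i + 1)) - η (uniformNode n i)‖ * ‖shift s u (uniformNode n i)‖ := by
            refine intervalIntegral.integral_mono ht ((hcont n).norm.intervalIntegrable _ _) ?_
              fun s => norm_uniformSum_le η _ n
            exact (continuous_finsetSum _ fun i _ =>
              continuous_const.mul (hc i)).intervalIntegrable _ _
        _ = ∑ i ∈ Finset.range n, ‖η (uniformNode n (i + 1)) - η (uniformNode n i)‖ *
            ∫ s in 0..t, ‖shift s u (uniformNode n i)‖ := by
            rw [intervalIntegral.integral_finsetSum]
            · simp_rw [intervalIntegral.integral_const_mul]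
            · exact fun i _ => Continuous.intervalIntegrable (by fun_prop) _ _
        _ ≤ W * M := by
            refine hsum n _ M hn (fun i hi => ?_) hM0
            refine le_trans (le_of_eq ?_) (hM _ (uniformNode_mem hi.le hn))
            simp only [shift_apply]
            rw [intervalIntegral.integral_comp_add_right (fun r => ‖u r‖), zero_add, add_comm t]
    linarith

end DelayFunctional

/-! ### Mild solutions: Gronwall bound, existence, restarting -/

section Solutions

variable {𝕜 : Type*} [RCLike 𝕜] {H : Type*} [NormedAddCommGroup H] [NormedSpace 𝕜 H]

theorem C0Semigroup.norm_op_le {V : C0Semigroup 𝕜 H} (hV : ∀ t, ‖V.op t‖ ≤ 1) (t : ℝ≥0) (x : H) :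
    ‖V.op t x‖ ≤ ‖x‖ := by
  simpa using (V.op t).le_of_opNorm_le (hV t) x

theorem C0Semigroup.norm_orbit_le {V : C0Semigroup 𝕜 H} (hV : ∀ t, ‖V.op t‖ ≤ 1) (t : ℝ) (x : H) :
    ‖V.orbit x t‖ ≤ ‖x‖ := V.norm_op_le hV _ x

/-- Contractivity makes the map Lipschitz in the vector uniformly in time, so separate continuity
gives joint continuity. -/
theorem C0Semigroup.continuous_orbit_uncurry {V : C0Semigroup 𝕜 H} (hV : ∀ t, ‖V.op t‖ ≤ 1) :
    Continuous fun q : ℝ × H => V.orbit q.2 q.1 := by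
  refine continuous_prod_of_continuous_lipschitzWith' _ 1 (fun t => ?_) fun x => ?_
  · refine LipschitzWith.of_dist_le_mul fun x y => ?_
    simp only [C0Semigroup.orbit, dist_eq_norm, ← map_sub, NNReal.coe_one, one_mul]
    exact V.norm_op_le hV _ _
  · exact V.continuous_orbit (fun _ => ⟨1, fun s _ => hV s⟩) x

variable [NormedSpace ℝ H]

/-- The Duhamel integral `∫_0^t V(t-s) Φ u_s ds`, extended by zero to negative times. -/
noncomputable def duhamel (V : C0Semigroup 𝕜 H) (Φ : C(ℝ, H) →ₗ[𝕜] H) (u : C(ℝ, H)) (t : ℝ) : H :=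
  ∫ s in 0..max t 0, V.orbit (Φ (shift s u)) (t - s)

/-- `u` is the mild solution of `u' = B u + Φ u_t` (with `B` the generator of `V`) for the
history `F`. -/
def IsMildSolution (V : C0Semigroup 𝕜 H) (Φ : C(ℝ, H) →ₗ[𝕜] H) (F u : C(ℝ, H)) : Prop :=
  (∀ t ≤ 0, u t = F t) ∧ ∀ t, 0 ≤ t → u t = V.orbit (F 0) t + duhamel V Φ u t

variable {V : C0Semigroup 𝕜 H} (hV : ∀ t, ‖V.op t‖ ≤ 1) {Φ : C(ℝ, H) →ₗ[𝕜] H} {K : ℝ}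
  (hΦ : IsDelayFunctional Φ K)

theorem duhamel_of_nonpos (u : C(ℝ, H)) {t : ℝ} (ht : t ≤ 0) : duhamel V Φ u t = 0 := by
  simp [duhamel, max_eq_right ht]

theorem duhamel_of_nonneg (u : C(ℝ, H)) {t : ℝ} (ht : 0 ≤ t) :
    duhamel V Φ u t = ∫ s in 0..t, V.orbit (Φ (shift s u)) (t - s) := by
  simp [duhamel, max_eq_left ht]

include hV hΦ

theorem continuous_duhamel_integrand (u : C(ℝ, H)) :
    Continuous fun q : ℝ × ℝ => V.orbit (Φ (shift q.2 u)) (q.1 - q.2) :=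
  (V.continuous_orbit_uncurry hV).comp
    ((continuous_fst.sub continuous_snd).prodMk ((hΦ.continuous_shift u).comp continuous_snd))

theorem intervalIntegrable_duhamel (u : C(ℝ, H)) (t a b : ℝ) :
    IntervalIntegrable (fun s => V.orbit (Φ (shift s u)) (t - s)) volume a b :=
  ((continuous_duhamel_integrand hV hΦ u).comp
    (continuous_const.prodMk continuous_id)).intervalIntegrable _ _

theorem continuous_duhamel (u : C(ℝ, H)) : Continuous (duhamel V Φ u) :=
  intervalIntegral.continuous_parametric_intervalIntegral_of_continuous
    (f := fun t s => V.orbit (Φ (shift s u)) (t - s))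
    (continuous_duhamel_integrand hV hΦ u) (by fun_prop)

theorem duhamel_sub (u v : C(ℝ, H)) (t : ℝ) :
    duhamel V Φ (u - v) t = duhamel V Φ u t - duhamel V Φ v t := by
  rw [duhamel, duhamel, duhamel, ← intervalIntegral.integral_sub
    (intervalIntegrable_duhamel hV hΦ u _ _ _) (intervalIntegrable_duhamel hV hΦ v _ _ _)]
  simp [C0Semigroup.orbit, shift_sub]

theorem duhamel_add (u v : C(ℝ, H)) (t : ℝ) :
    duhamel V Φ (u + v) t = duhamel V Φ u t + duhamel V Φ v t := by
  rw [duhamel, duhamel, duhamel, ← intervalIntegral.integral_add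
    (intervalIntegrable_duhamel hV hΦ u _ _ _) (intervalIntegrable_duhamel hV hΦ v _ _ _)]
  simp [C0Semigroup.orbit, shift_add]

theorem norm_duhamel_le (u : C(ℝ, H)) {t : ℝ} (ht : 0 ≤ t) :
    ‖duhamel V Φ u t‖ ≤ ∫ s in 0..t, ‖Φ (shift s u)‖ := by
  rw [duhamel_of_nonneg u ht]
  exact intervalIntegral.norm_integral_le_of_norm_le ht
    (Eventually.of_forall fun s _ => V.norm_orbit_le hV _ _)
    ((hΦ.continuous_shift u).norm.intervalIntegrable _ _)

/-- Integrating the weight `e^{ls}` gains the factor `1 / l`, which turns the Duhamel map into a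
contraction for large `l`. -/
theorem norm_duhamel_le_of_exp {u : C(ℝ, H)} {l c : ℝ} (hl : 0 < l) (hc : 0 ≤ c)
    (h : ∀ s, 0 ≤ s → ‖Φ (shift s u)‖ ≤ c * Real.exp (l * s)) (t : ℝ) :
    ‖duhamel V Φ u t‖ ≤ c / l * Real.exp (l * t) := by
  rcases le_total t 0 with ht | ht
  · rw [duhamel_of_nonpos u ht, norm_zero]; positivity
  have hd : ∀ s ∈ uIcc 0 t, HasDerivAt (fun s => c / l * Real.exp (l * s))
      (c * Real.exp (l * s)) s := by
    intro s _
    have := (((hasDerivAt_id s).const_mul l).exp).const_mul (c / l)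
    convert! this using 1
    simp only [id, mul_one]
    field_simp
  have hi : IntervalIntegrable (fun s => c * Real.exp (l * s)) volume 0 t :=
    Continuous.intervalIntegrable (by fun_prop) _ _
  calc ‖duhamel V Φ u t‖ ≤ ∫ s in 0..t, ‖Φ (shift s u)‖ := norm_duhamel_le hV hΦ u ht
    _ ≤ ∫ s in 0..t, c * Real.exp (l * s) :=
        intervalIntegral.integral_mono_on ht ((hΦ.continuous_shift u).norm.intervalIntegrable _ _)
          hi fun s hs => h s hs.1
    _ = c / l * Real.exp (l * t) - c / l * Real.exp (l * 0) :=
        intervalIntegral.integral_eq_sub_of_hasDerivAt hd hi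
    _ ≤ _ := by simp; positivity

theorem IsMildSolution.norm_sub_le {F u : C(ℝ, H)} (h : IsMildSolution V Φ F u) {t M : ℝ}
    (ht : 0 ≤ t) (hM : ∀ σ ∈ Icc (-1 : ℝ) 0, ∫ r in σ..σ + t, ‖u r‖ ≤ M) :
    ‖u t - V.orbit (F 0) t‖ ≤ K * M := by
  rw [h.2 t ht, add_sub_cancel_left]
  exact (norm_duhamel_le hV hΦ u ht).trans (hΦ.integral_le u t M ht hM)

/-- All windows `[σ, σ+t]` lie in `[-1, t]`, so the averaged bound yields a Gronwall inequality for
`∫_0^t ‖u‖`. The past enters only through its `L^1` norm, which is what permits the extension to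
`L^p` histories. -/
theorem IsMildSolution.norm_le {F u : C(ℝ, H)} (h : IsMildSolution V Φ F u) {t : ℝ} (ht : 0 ≤ t) :
    ‖u t‖ ≤ (‖F 0‖ + K * ∫ r in (-1 : ℝ)..0, ‖F r‖) * Real.exp (K * t) := by
  have hK := hΦ.pos
  set a := ‖F 0‖ + K * ∫ r in (-1 : ℝ)..0, ‖F r‖ with ha
  have hint : ∀ a b, IntervalIntegrable (fun r => ‖u r‖) volume a b :=
    fun a b => u.continuous.norm.intervalIntegrable a b
  have h1 : ∀ t, 0 ≤ t → ‖u t‖ ≤ K * (∫ r in 0..t, ‖u r‖) + a := by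
    intro t ht
    have h2 := h.norm_sub_le hV hΦ ht (M := ∫ r in (-1 : ℝ)..t, ‖u r‖) fun σ hσ =>
      intervalIntegral.integral_mono_interval hσ.1 (by linarith) (by linarith [hσ.2])
        (Eventually.of_forall fun _ => norm_nonneg _) (hint _ _)
    have h3 : ∫ r in (-1 : ℝ)..0, ‖u r‖ = ∫ r in (-1 : ℝ)..0, ‖F r‖ := by
      refine intervalIntegral.integral_congr fun r hr => ?_
      rw [uIcc_of_le (by norm_num)] at hr
      simp only [h.1 r hr.2]
    rw [← intervalIntegral.integral_add_adjacent_intervals (hint (-1) 0) (hint 0 t), h3] at h2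
    have h4 := V.norm_orbit_le hV t (F 0)
    have h5 : ‖u t‖ ≤ ‖u t - V.orbit (F 0) t‖ + ‖V.orbit (F 0) t‖ := norm_le_norm_sub_add _ _
    rw [ha]; linarith
  have hnn : ∀ t, 0 ≤ t → 0 ≤ ∫ r in 0..t, ‖u r‖ := fun t ht =>
    intervalIntegral.integral_nonneg ht fun _ _ => norm_nonneg _
  have hd : ∀ x : ℝ, HasDerivAt (fun t => ∫ r in 0..t, ‖u r‖) ‖u x‖ x := fun x =>
    intervalIntegral.integral_hasDerivAt_right (hint _ _)
      (u.continuous.norm.stronglyMeasurableAtFilter _ _) u.continuous.norm.continuousAt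
  have hg := norm_le_gronwallBound_of_norm_deriv_right_le (f := fun t => ∫ r in 0..t, ‖u r‖)
    (f' := fun t => ‖u t‖) (δ := 0) (K := K) (ε := a) (a := 0) (b := t)
    (fun x _ => (hd x).continuousAt.continuousWithinAt) (fun x _ => (hd x).hasDerivWithinAt)
    (by simp) (fun x hx => by
      rw [norm_norm, Real.norm_of_nonneg (hnn x hx.1)]
      exact h1 x hx.1) t ⟨ht, le_rfl⟩
  rw [gronwallBound_of_K_ne_0 hK.ne', Real.norm_of_nonneg (hnn t ht)] at hg
  simp only [zero_mul, zero_add, sub_zero] at hg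
  calc ‖u t‖ ≤ K * (∫ r in 0..t, ‖u r‖) + a := h1 t ht
    _ ≤ K * (a / K * (Real.exp (K * t) - 1)) + a := by gcongr
    _ = a * Real.exp (K * t) := by field_simp; ring

theorem IsMildSolution.sub {F G u v : C(ℝ, H)} (h : IsMildSolution V Φ F u)
    (h' : IsMildSolution V Φ G v) : IsMildSolution V Φ (F - G) (u - v) := by
  refine ⟨fun t ht => by simp [h.1 t ht, h'.1 t ht], fun t ht => ?_⟩
  rw [duhamel_sub hV hΦ, ContinuousMap.sub_apply, h.2 t ht, h'.2 t ht]
  simp only [C0Semigroup.orbit, ContinuousMap.sub_apply, map_sub]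
  abel

theorem IsMildSolution.add {F G u v : C(ℝ, H)} (h : IsMildSolution V Φ F u)
    (h' : IsMildSolution V Φ G v) : IsMildSolution V Φ (F + G) (u + v) := by
  refine ⟨fun t ht => by simp [h.1 t ht, h'.1 t ht], fun t ht => ?_⟩
  rw [duhamel_add hV hΦ, ContinuousMap.add_apply, h.2 t ht, h'.2 t ht]
  simp only [C0Semigroup.orbit, ContinuousMap.add_apply, map_add]
  abel

theorem IsMildSolution.smul [IsScalarTower ℝ 𝕜 H] {F u : C(ℝ, H)} (h : IsMildSolution V Φ F u)
    (c : 𝕜) : IsMildSolution V Φ (c • F) (c • u) := by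
  have : SMulCommClass ℝ 𝕜 H := IsScalarTower.to_smulCommClass
  refine ⟨fun t ht => by simp [h.1 t ht], fun t ht => ?_⟩
  have e : duhamel V Φ (c • u) t = c • duhamel V Φ u t := by
    rw [duhamel, duhamel, ← intervalIntegral.integral_smul]
    simp [C0Semigroup.orbit, shift_smul]
  rw [e, ContinuousMap.smul_apply, h.2 t ht]
  simp only [C0Semigroup.orbit, ContinuousMap.smul_apply, map_smul, smul_add]

theorem IsMildSolution.unique {F u v : C(ℝ, H)} (h : IsMildSolution V Φ F u)
    (h' : IsMildSolution V Φ F v) : u = v := by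
  ext t
  rw [← sub_eq_zero, ← ContinuousMap.sub_apply]
  have hs := h.sub hV hΦ h'
  rw [sub_self] at hs
  rcases le_total t 0 with ht | ht
  · simp [hs.1 t ht]
  · simpa using hs.norm_le hV hΦ ht

variable [CompleteSpace H]

/-- Banach's fixed point theorem for the Duhamel part of the solution, in the supremum norm weighted
by `e^{-lt}`. The choice `l = 2 * K` gives contraction constant `1 / 2`. -/
theorem exists_isMildSolution (F : C(ℝ, H)) : ∃ u, IsMildSolution V Φ F u := by
  have hK := hΦ.pos
  set l := 2 * K with hl
  have hl0 : 0 < l := by positivity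
  -- The history and the free orbit in one formula: orbits at negative times are evaluated at `0`,
  -- so this is `F t` for `t ≤ 0` and `V(t) F(0)` afterwards.
  let base : C(ℝ, H) := ⟨fun t => V.orbit (F (min t 0)) t,
    (V.continuous_orbit_uncurry hV).comp (continuous_id.prodMk (by fun_prop))⟩
  let lift : BoundedContinuousFunction ℝ H → C(ℝ, H) :=
    fun v => ⟨fun t => Real.exp (l * t) • v t, by fun_prop⟩
  obtain ⟨m, hm⟩ := (isCompact_Icc (a := (-1 : ℝ)) (b := 0)).exists_bound_of_continuousOn
    F.continuous.continuousOn
  have hm0 : 0 ≤ m := (norm_nonneg _).trans (hm 0 ⟨by norm_num, le_rfl⟩)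
  have hbase : ∀ t, -1 ≤ t → ‖base t‖ ≤ m := fun t ht =>
    (V.norm_orbit_le hV _ _).trans (hm _ ⟨le_min ht (by norm_num), min_le_right _ _⟩)
  have hlift : ∀ (v : BoundedContinuousFunction ℝ H) (s : ℝ), ∀ σ ≤ 0,
      ‖lift v (s + σ)‖ ≤ ‖v‖ * Real.exp (l * s) := by
    intro v s σ hσ
    change ‖Real.exp (l * (s + σ)) • v (s + σ)‖ ≤ _
    rw [norm_smul, Real.norm_of_nonneg (Real.exp_pos _).le, mul_comm]
    have := v.norm_coe_le_norm (s + σ)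
    gcongr
    linarith
  have hexp : ∀ s, 0 ≤ s → 1 ≤ Real.exp (l * s) := fun s hs => Real.one_le_exp (by positivity)
  have hbound : ∀ (v : BoundedContinuousFunction ℝ H) (t : ℝ),
      ‖Real.exp (-(l * t)) • duhamel V Φ (base + lift v) t‖ ≤ K * (m + ‖v‖) / l := by
    intro v t
    have h1 := norm_duhamel_le_of_exp hV hΦ (u := base + lift v) hl0 (c := K * (m + ‖v‖))
      (by positivity) (fun s hs => by
        rw [mul_assoc]
        refine hΦ.norm_le _ _ fun σ hσ => ?_
        rw [shift_apply, ContinuousMap.add_apply]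
        refine (norm_add_le _ _).trans ?_
        rw [add_mul]
        refine add_le_add ?_ (hlift v s σ hσ.2)
        exact (hbase _ (by linarith [hσ.1])).trans (le_mul_of_one_le_right hm0 (hexp s hs))) t
    rw [norm_smul, Real.norm_of_nonneg (Real.exp_pos _).le]
    calc _ ≤ Real.exp (-(l * t)) * (K * (m + ‖v‖) / l * Real.exp (l * t)) := by gcongr
      _ = K * (m + ‖v‖) / l * (Real.exp (-(l * t)) * Real.exp (l * t)) := by ring
      _ = _ := by rw [← Real.exp_add]; simp
  let N : BoundedContinuousFunction ℝ H → BoundedContinuousFunction ℝ H := fun v =>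
    BoundedContinuousFunction.ofNormedAddCommGroup
      (fun t => Real.exp (-(l * t)) • duhamel V Φ (base + lift v) t)
      ((by fun_prop : Continuous fun t : ℝ => Real.exp (-(l * t))).smul
        (continuous_duhamel hV hΦ _)) _ (hbound v)
  have hN : ContractingWith (1 / 2) N := by
    refine ⟨by norm_num, LipschitzWith.of_dist_le_mul fun v w => ?_⟩
    rw [BoundedContinuousFunction.dist_le (by positivity)]
    intro t
    change dist (Real.exp (-(l * t)) • duhamel V Φ (base + lift v) t)
      (Real.exp (-(l * t)) • duhamel V Φ (base + lift w) t) ≤ _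
    have e : base + lift v - (base + lift w) = lift (v - w) := by
      ext t
      simp [lift, smul_sub]
    rw [dist_eq_norm, ← smul_sub, ← duhamel_sub hV hΦ, e, norm_smul,
      Real.norm_of_nonneg (Real.exp_pos _).le, dist_eq_norm]
    have h1 := norm_duhamel_le_of_exp hV hΦ (u := lift (v - w)) hl0 (c := K * ‖v - w‖)
      (by positivity) (fun s hs => by
        rw [mul_assoc]
        exact hΦ.norm_le _ _ fun σ hσ => hlift _ s σ hσ.2) t
    calc _ ≤ Real.exp (-(l * t)) * (K * ‖v - w‖ / l * Real.exp (l * t)) := by gcongr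
      _ = K * ‖v - w‖ / l * (Real.exp (-(l * t)) * Real.exp (l * t)) := by ring
      _ = K * ‖v - w‖ / l := by rw [← Real.exp_add]; simp
      _ = _ := by rw [hl]; push_cast; field_simp
  let v := ContractingWith.fixedPoint N hN
  have hv : ∀ t, lift v t = duhamel V Φ (base + lift v) t := by
    intro t
    have h1 : N v = v := hN.fixedPoint_isFixedPt
    have h2 : Real.exp (-(l * t)) • duhamel V Φ (base + lift v) t = v t :=
      congrArg (fun w : BoundedContinuousFunction ℝ H => w t) h1
    change Real.exp (l * t) • v t = _
    rw [← h2, smul_smul, ← Real.exp_add, add_neg_cancel, Real.exp_zero, one_smul]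
  refine ⟨base + lift v, fun t ht => ?_, fun t ht => ?_⟩
  · rw [ContinuousMap.add_apply, hv, duhamel_of_nonpos _ ht, add_zero]
    change V.orbit (F (min t 0)) t = F t
    rw [min_eq_left ht, C0Semigroup.orbit, Real.toNNReal_of_nonpos ht, V.op_zero_apply]
  · rw [ContinuousMap.add_apply, hv]
    congr 1
    change V.orbit (F (min t 0)) t = _
    rw [min_eq_right ht]

/-- Splitting the Duhamel integral at `t` and using the semigroup law of `V` restarts the solution
at time `t`. With uniqueness this becomes the semigroup law of the flow. -/
theorem IsMildSolution.shift {F u : C(ℝ, H)} (h : IsMildSolution V Φ F u) {t : ℝ} (ht : 0 ≤ t) :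
    IsMildSolution V Φ (shift t u) (shift t u) := by
  refine ⟨fun _ _ => rfl, fun r hr => ?_⟩
  rw [shift_apply, shift_apply, h.2 _ (add_nonneg ht hr), add_zero, h.2 _ ht,
    duhamel_of_nonneg _ (add_nonneg ht hr), duhamel_of_nonneg _ hr, duhamel_of_nonneg _ ht,
    ← intervalIntegral.integral_add_adjacent_intervals
      (intervalIntegrable_duhamel hV hΦ u _ 0 t) (intervalIntegrable_duhamel hV hΦ u _ t (t + r)),
    ← add_assoc]
  have e1 : V.orbit (F 0) (t + r) = V.op r.toNNReal (V.orbit (F 0) t) := by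
    rw [add_comm t r, V.orbit_add _ hr ht]
  have e2 : ∫ s in 0..t, V.orbit (Φ (DelaySplitting.shift s u)) (t + r - s) =
      V.op r.toNNReal (∫ s in 0..t, V.orbit (Φ (DelaySplitting.shift s u)) (t - s)) := by
    rw [← ContinuousLinearMap.intervalIntegral_comp_comm _
      (intervalIntegrable_duhamel hV hΦ u t 0 t)]
    refine intervalIntegral.integral_congr fun s hs => ?_
    rw [uIcc_of_le ht] at hs
    rw [← V.orbit_add _ hr (sub_nonneg.2 hs.2)]
    congr 1; ring
  have e3 : ∫ s in t..t + r, V.orbit (Φ (DelaySplitting.shift s u)) (t + r - s) =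
      ∫ s in 0..r, V.orbit (Φ (DelaySplitting.shift s (DelaySplitting.shift t u))) (r - s) := by
    have := intervalIntegral.integral_comp_add_left (a := 0) (b := r)
      (fun s => V.orbit (Φ (DelaySplitting.shift s u)) (t + r - s)) t
    rw [add_zero] at this
    rw [← this]
    refine intervalIntegral.integral_congr fun s _ => ?_
    simp only [shift_shift]
    congr 1
    · rw [add_comm]
    · ring
  rw [e1, e2, e3, ← map_add]
  rfl

end Solutions

/-! ### History space, translation and density of continuous histories -/

section HistorySpace

variable {H : Type*} [NormedAddCommGroup H] {p : ℝ≥0∞}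

instance isProbabilityMeasure_histMeasure : IsProbabilityMeasure histMeasure :=
  ⟨by simp [histMeasure]⟩

theorem ae_hist_iff {P : ℝ → Prop} :
    (∀ᵐ σ ∂histMeasure, P σ) ↔ ∀ᵐ σ, σ ∈ Icc (-1 : ℝ) 0 → P σ :=
  ae_restrict_iff' measurableSet_Icc

theorem ae_hist_of_forall {P : ℝ → Prop} (h : ∀ σ ∈ Icc (-1 : ℝ) 0, P σ) :
    ∀ᵐ σ ∂histMeasure, P σ := ae_hist_iff.2 (Eventually.of_forall h)

theorem eLpNorm_hist_le_of_ae_bound {f : ℝ → H} {C : ℝ}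
    (h : ∀ᵐ σ ∂histMeasure, ‖f σ‖ ≤ C) : eLpNorm f p histMeasure ≤ ENNReal.ofReal C := by
  simpa using eLpNorm_le_of_ae_bound (p := p) h

theorem memLp_hist_of_continuousOn {f : ℝ → H} (hf : ContinuousOn f (Icc (-1) 0)) :
    MemLp f p histMeasure := by
  obtain ⟨C, hC⟩ := (isCompact_Icc (a := (-1 : ℝ)) (b := 0)).exists_bound_of_continuousOn hf
  exact MemLp.of_bound (hf.aestronglyMeasurable measurableSet_Icc) C (ae_hist_of_forall hC)

theorem memLp_hist (u : C(ℝ, H)) : MemLp u p histMeasure :=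
  memLp_hist_of_continuousOn u.continuous.continuousOn

theorem norm_sub_toLp [Fact (1 ≤ p)] (f : Hist H p) {g : ℝ → H} (hg : MemLp g p histMeasure) :
    ‖f - hg.toLp g‖ = (eLpNorm (fun σ => f σ - g σ) p histMeasure).toReal := by
  conv_lhs => rw [← Lp.toLp_coeFn f (Lp.memLp f), ← MemLp.toLp_sub, Lp.norm_toLp]
  rfl

theorem norm_toReal_le_of_le {f : Hist H p} {C : ℝ} (hC : 0 ≤ C)
    (h : eLpNorm f p histMeasure ≤ ENNReal.ofReal C) : ‖f‖ ≤ C := by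
  rw [Lp.norm_def]
  exact ENNReal.toReal_le_of_le_ofReal hC h

theorem eLpNorm_coe_hist (f : Hist H p) : eLpNorm f p histMeasure = ENNReal.ofReal ‖f‖ := by
  rw [Lp.norm_def, ENNReal.ofReal_toReal (Lp.eLpNorm_ne_top f)]

theorem norm_hist_le_of_ae_bound {f : Hist H p} {C : ℝ} (hC : 0 ≤ C)
    (h : ∀ᵐ σ ∂histMeasure, ‖f σ‖ ≤ C) : ‖f‖ ≤ C :=
  norm_toReal_le_of_le hC (eLpNorm_hist_le_of_ae_bound h)

theorem integrableOn_of_memLp_hist [hp : Fact (1 ≤ p)] {f : ℝ → H} (hf : MemLp f p histMeasure) :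
    IntegrableOn f (Icc (-1) 0) := hf.integrable hp.out

theorem intervalIntegrable_of_memLp_hist [Fact (1 ≤ p)] {f : ℝ → H} (hf : MemLp f p histMeasure)
    {a b : ℝ} (ha : a ∈ Icc (-1 : ℝ) 0) (hb : b ∈ Icc (-1 : ℝ) 0) :
    IntervalIntegrable f volume a b :=
  ((integrableOn_of_memLp_hist hf).mono_set (uIcc_subset_Icc ha hb)).intervalIntegrable

/-- The history interval has measure one, so the `L^1` norm is dominated by the `L^p` norm without a
constant. -/
theorem integral_norm_le_eLpNorm [hp : Fact (1 ≤ p)] {f : ℝ → H} (hf : MemLp f p histMeasure) :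
    ∫ r in (-1 : ℝ)..0, ‖f r‖ ≤ (eLpNorm f p histMeasure).toReal := by
  rw [intervalIntegral.integral_of_le (by norm_num), ← integral_Icc_eq_integral_Ioc]
  change ∫ r, ‖f r‖ ∂histMeasure ≤ _
  rw [integral_norm_eq_lintegral_enorm hf.1, ← eLpNorm_one_eq_lintegral_enorm]
  exact ENNReal.toReal_mono hf.eLpNorm_ne_top (eLpNorm_le_eLpNorm_of_exponent_le hp.out hf.1)

/-- The history at time `t` of the curve that is `f` at negative times and `y` at positive
times. -/
noncomputable def glue (f y : ℝ → H) (t σ : ℝ) : H := if t + σ ≤ 0 then f (t + σ) else y (t + σ)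

theorem ae_hist_translate {P : ℝ → Prop} (h : ∀ᵐ σ ∂histMeasure, P σ) {t : ℝ} (ht : 0 ≤ t) :
    ∀ᵐ σ ∂histMeasure, t + σ ≤ 0 → P (t + σ) := by
  rw [ae_hist_iff] at h ⊢
  have h1 := (measurePreserving_add_left volume t).quasiMeasurePreserving.ae h
  filter_upwards [h1] with σ hσ hm hle
  exact hσ ⟨by linarith [hm.1], hle⟩

theorem glue_congr_ae {f g y : ℝ → H} (h : f =ᵐ[histMeasure] g) {t : ℝ} (ht : 0 ≤ t) :
    glue f y t =ᵐ[histMeasure] glue g y t := by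
  filter_upwards [ae_hist_translate h ht] with σ hσ
  unfold glue
  split_ifs with h'
  · exact hσ h'
  · rfl

theorem aestronglyMeasurable_past {f : ℝ → H} (hf : AEStronglyMeasurable f histMeasure) {t : ℝ}
    (ht : 0 ≤ t) : AEStronglyMeasurable (fun σ => if t + σ ≤ 0 then f (t + σ) else 0)
      histMeasure := by
  have h1 : AEStronglyMeasurable ((Icc (-1 : ℝ) 0).indicator f) volume :=
    (aestronglyMeasurable_indicator_iff measurableSet_Icc).2 hf
  have h2 := (h1.comp_measurePreserving (measurePreserving_add_left volume t)).mono_measure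
    (Measure.restrict_le_self (s := Icc (-1 : ℝ) 0))
  refine h2.congr (ae_hist_of_forall fun σ hσ => ?_)
  by_cases h : t + σ ≤ 0
  · simp [h, indicator_of_mem (show t + σ ∈ Icc (-1 : ℝ) 0 from ⟨by linarith [hσ.1], h⟩)]
  · simp [h]

/-- After extension by zero to the line, translation is an isometry and the retained past is a
truncation of the translate. -/
theorem eLpNorm_past_le {f : ℝ → H} (hf : AEStronglyMeasurable f histMeasure) {t : ℝ}
    (ht : 0 ≤ t) : eLpNorm (fun σ => if t + σ ≤ 0 then f (t + σ) else 0) p histMeasure ≤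
      eLpNorm f p histMeasure := by
  have h1 : AEStronglyMeasurable ((Icc (-1 : ℝ) 0).indicator f) volume :=
    (aestronglyMeasurable_indicator_iff measurableSet_Icc).2 hf
  have h2 := eLpNorm_comp_measurePreserving (p := p) h1 (measurePreserving_add_left volume t)
  rw [histMeasure, ← eLpNorm_indicator_eq_eLpNorm_restrict measurableSet_Icc,
    ← eLpNorm_indicator_eq_eLpNorm_restrict measurableSet_Icc, ← h2]
  refine eLpNorm_mono fun σ => ?_
  by_cases hσ : σ ∈ Icc (-1 : ℝ) 0
  · rw [indicator_of_mem hσ]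
    by_cases h : t + σ ≤ 0
    · simp [h, indicator_of_mem (show t + σ ∈ Icc (-1 : ℝ) 0 from ⟨by linarith [hσ.1], h⟩)]
    · simp [h]
  · simp [indicator_of_notMem hσ]

theorem aestronglyMeasurable_glue {f y : ℝ → H} (hf : AEStronglyMeasurable f histMeasure)
    (hy : Continuous y) {t : ℝ} (ht : 0 ≤ t) : AEStronglyMeasurable (glue f y t) histMeasure := by
  have hm : MeasurableSet {σ : ℝ | t + σ ≤ 0} :=
    measurableSet_le (by fun_prop) measurable_const
  have h2 : AEStronglyMeasurable ({σ : ℝ | t + σ ≤ 0}ᶜ.indicator fun σ => y (t + σ)) histMeasure :=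
    (hy.comp (by fun_prop : Continuous fun σ => t + σ)).aestronglyMeasurable.indicator hm.compl
  refine ((aestronglyMeasurable_past hf ht).add h2).congr (Eventually.of_forall fun σ => ?_)
  by_cases h : t + σ ≤ 0 <;> simp [glue, h]

theorem eLpNorm_glue_le {f y : ℝ → H} (hp : 1 ≤ p) (hf : AEStronglyMeasurable f histMeasure)
    (hy : Continuous y) {t R : ℝ} (ht : 0 ≤ t) (hR : 0 ≤ R) (hyR : ∀ r, 0 ≤ r → r ≤ t → ‖y r‖ ≤ R) :
    eLpNorm (glue f y t) p histMeasure ≤ eLpNorm f p histMeasure + ENNReal.ofReal R := by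
  have e : glue f y t = (fun σ => if t + σ ≤ 0 then f (t + σ) else 0) +
      glue (fun _ => (0 : H)) y t := by
    funext σ
    by_cases h : t + σ ≤ 0 <;> simp [glue, h]
  rw [e]
  refine (eLpNorm_add_le (aestronglyMeasurable_past hf ht)
    (aestronglyMeasurable_glue aestronglyMeasurable_const hy ht) hp).trans ?_
  refine add_le_add (eLpNorm_past_le hf ht) (eLpNorm_hist_le_of_ae_bound
    (ae_hist_of_forall fun σ hσ => ?_))
  unfold glue
  split_ifs with h
  · simpa using hR
  · exact hyR _ (not_le.1 h).le (by linarith [hσ.2])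

variable {𝕜 : Type*} [RCLike 𝕜] [NormedSpace 𝕜 H] [hp1 : Fact (1 ≤ p)]

variable (𝕜 H p) in
/-- The state `(F(0), [F])` given by a continuous history. -/
noncomputable def toState : C(ℝ, H) →ₗ[𝕜] State H p where
  toFun F := (F 0, (memLp_hist F).toLp F)
  map_add' _ _ := rfl
  map_smul' _ _ := rfl

@[simp] theorem toState_fst (F : C(ℝ, H)) : (toState H p 𝕜 F).1 = F 0 := rfl

theorem toState_snd (F : C(ℝ, H)) : (toState H p 𝕜 F).2 = (memLp_hist F).toLp F := rfl

theorem coeFn_toState_snd (F : C(ℝ, H)) : (toState H p 𝕜 F).2 =ᵐ[histMeasure] F :=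
  (memLp_hist F).coeFn_toLp

theorem norm_toState_snd (F : C(ℝ, H)) :
    ‖(toState H p 𝕜 F).2‖ = (eLpNorm F p histMeasure).toReal := Lp.norm_toLp _ (memLp_hist F)

theorem norm_toState_le {F : C(ℝ, H)} {C : ℝ} (h : ∀ σ ∈ Icc (-1 : ℝ) 0, ‖F σ‖ ≤ C) :
    ‖toState H p 𝕜 F‖ ≤ C := by
  have h0 := h 0 ⟨by norm_num, le_rfl⟩
  refine norm_prod_le_iff.2 ⟨h0, ?_⟩
  rw [norm_toState_snd]
  exact ENNReal.toReal_le_of_le_ofReal ((norm_nonneg _).trans h0)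
    (eLpNorm_hist_le_of_ae_bound (ae_hist_of_forall h))

theorem toState_congr {F G : C(ℝ, H)} (h : EqOn F G (Icc (-1) 0)) :
    toState H p 𝕜 F = toState H p 𝕜 G := by
  rw [← sub_eq_zero, ← map_sub, ← norm_le_zero_iff]
  exact norm_toState_le fun σ hσ => by simp [h hσ]

/-- The two components can be prescribed independently: after a continuous `L^p` approximation `G`
of `f`, a spike of height `x - G 0` and width `δ` corrects the value at `0`, at `L^p` cost at most
`‖x - G 0‖ δ^{1/p}`. This is where `p < ∞` matters. -/
theorem denseRange_toState [NormedSpace ℝ H] (hp : p ≠ ∞) : DenseRange (toState H p 𝕜) := by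
  rw [Metric.denseRange_iff]
  rintro ⟨x, f⟩ ε hε
  have hε' : ENNReal.ofReal (ε / 4) ≠ 0 := by
    rw [Ne, ENNReal.ofReal_eq_zero, not_le]; positivity
  obtain ⟨G, hG, hGm⟩ := (Lp.memLp f).exists_boundedContinuous_eLpNorm_sub_le hp hε'
  set w := x - G 0 with hw
  have hp0 : 0 < p.toReal := ENNReal.toReal_pos (zero_lt_one.trans_le hp1.out).ne' hp
  have hlim : Tendsto (fun δ : ℝ => ‖w‖ₑ * (ENNReal.ofReal δ) ^ (1 / p.toReal)) (𝓝[>] 0) (𝓝 0) := by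
    have h1 : Tendsto (fun δ : ℝ => (ENNReal.ofReal δ) ^ (1 / p.toReal)) (𝓝[>] 0) (𝓝 0) := by
      have : Continuous fun δ : ℝ => (ENNReal.ofReal δ) ^ (1 / p.toReal) :=
        ENNReal.continuous_rpow_const.comp ENNReal.continuous_ofReal
      refine (this.tendsto' 0 0 ?_).mono_left nhdsWithin_le_nhds
      simp [hp0]
    simpa using ENNReal.Tendsto.const_mul h1 (.inr (enorm_ne_top (x := w)))
  obtain ⟨δ, hδs, hδ⟩ := ((hlim.eventually (gt_mem_nhds
    (pos_iff_ne_zero.2 hε'))).and self_mem_nhdsWithin).exists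
  have hδ0 : 0 < δ := hδ
  let χ : ℝ → ℝ := fun σ => max 0 (min 1 (1 + σ / δ))
  have hχc : Continuous χ := by fun_prop
  let F : C(ℝ, H) := ⟨fun σ => G σ + χ σ • w, by fun_prop⟩
  have hχ0 : χ 0 = 1 := by simp [χ]
  have hχw : eLpNorm (fun σ => χ σ • w) p histMeasure ≤ ENNReal.ofReal (ε / 4) := by
    refine le_trans ?_ hδs.le
    calc eLpNorm (fun σ => χ σ • w) p histMeasure
        ≤ eLpNorm ((Icc (-δ) 0).indicator fun _ => w) p histMeasure := by
          refine eLpNorm_mono_ae (ae_hist_of_forall fun σ hσ => ?_)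
          by_cases h : -δ ≤ σ
          · rw [indicator_of_mem (show σ ∈ Icc (-δ) 0 from ⟨h, hσ.2⟩), norm_smul]
            refine mul_le_of_le_one_left (norm_nonneg _) ?_
            rw [Real.norm_of_nonneg (le_max_left _ _)]
            exact max_le zero_le_one (min_le_left _ _)
          · have : χ σ = 0 := by
              refine max_eq_left ((min_le_right _ _).trans ?_)
              have : σ / δ < -1 := by rw [div_lt_iff₀ hδ0]; linarith
              linarith
            simp [this]
      _ = ‖w‖ₑ * histMeasure (Icc (-δ) 0) ^ (1 / p.toReal) :=
          eLpNorm_indicator_const measurableSet_Icc (zero_lt_one.trans_le hp1.out).ne' hp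
      _ ≤ _ := by
          gcongr
          refine (Measure.restrict_le_self _).trans ?_
          simp
  refine ⟨F, ?_⟩
  rw [dist_eq_norm]
  refine lt_of_le_of_lt (norm_prod_le_iff.2 ⟨?_, ?_⟩) (show ε / 2 < ε by linarith)
  · rw [Prod.fst_sub, toState_fst]
    change ‖x - (G 0 + χ 0 • w)‖ ≤ _
    rw [hχ0, one_smul, hw]
    simp; positivity
  · rw [Prod.snd_sub, toState_snd, norm_sub_toLp]
    refine ENNReal.toReal_le_of_le_ofReal (by positivity) ?_
    have e : (fun σ => f σ - F σ) = (fun σ => (f - (G : ℝ → H)) σ - χ σ • w) := by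
      funext σ
      simp only [F, ContinuousMap.coe_mk, Pi.sub_apply]
      abel
    rw [e]
    refine (eLpNorm_sub_le ((Lp.memLp f).sub hGm).1
      (by fun_prop : Continuous fun σ => χ σ • w).aestronglyMeasurable hp1.out).trans ?_
    refine (add_le_add hG hχw).trans ?_
    rw [← ENNReal.ofReal_add (by positivity) (by positivity)]
    exact ENNReal.ofReal_le_ofReal (by linarith)

end HistorySpace

/-! ### The delay semigroup, by extension from continuous histories -/

section DelaySemigroup

variable {𝕜 : Type*} [RCLike 𝕜] {H : Type*} [NormedAddCommGroup H] [NormedSpace 𝕜 H]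
  [NormedSpace ℝ H] [IsScalarTower ℝ 𝕜 H] [CompleteSpace H]
  {V : C0Semigroup 𝕜 H} (hV : ∀ t, ‖V.op t‖ ≤ 1) {Φ : C(ℝ, H) →ₗ[𝕜] H} {K : ℝ}
  (hΦ : IsDelayFunctional Φ K)

/-- The linear map sending a continuous history to the mild solution it determines. -/
noncomputable def mildSolution : C(ℝ, H) →ₗ[𝕜] C(ℝ, H) where
  toFun F := (exists_isMildSolution hV hΦ F).choose
  map_add' F G := (exists_isMildSolution hV hΦ (F + G)).choose_spec.unique hV hΦ
    ((exists_isMildSolution hV hΦ F).choose_spec.add hV hΦ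
      (exists_isMildSolution hV hΦ G).choose_spec)
  map_smul' c F := (exists_isMildSolution hV hΦ (c • F)).choose_spec.unique hV hΦ
    ((exists_isMildSolution hV hΦ F).choose_spec.smul hV hΦ c)

theorem isMildSolution_mildSolution (F : C(ℝ, H)) :
    IsMildSolution V Φ F (mildSolution hV hΦ F) := (exists_isMildSolution hV hΦ F).choose_spec

theorem mildSolution_shift (F : C(ℝ, H)) {t : ℝ} (ht : 0 ≤ t) :
    mildSolution hV hΦ (shift t (mildSolution hV hΦ F)) = shift t (mildSolution hV hΦ F) :=
  (isMildSolution_mildSolution hV hΦ _).unique hV hΦ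
    ((isMildSolution_mildSolution hV hΦ F).shift hV hΦ ht)

variable {p : ℝ≥0∞} [hp1 : Fact (1 ≤ p)]

variable (p) in
/-- The map from a continuous history to the state at time `t` of its mild solution. -/
noncomputable def stateAt (t : ℝ) : C(ℝ, H) →ₗ[𝕜] State H p :=
  toState H p 𝕜 ∘ₗ
    { toFun := shift t, map_add' := shift_add t, map_smul' := shift_smul t } ∘ₗ mildSolution hV hΦ

theorem stateAt_apply (t : ℝ) (F : C(ℝ, H)) :
    stateAt hV hΦ p t F = toState H p 𝕜 (shift t (mildSolution hV hΦ F)) := rfl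

/-- The growth bound `(1+K) e^{Kt} + 1` of the delay semigroup. -/
noncomputable def growth (K t : ℝ) : ℝ := (1 + K) * Real.exp (K * t) + 1

theorem growth_mono {K : ℝ} (hK : 0 ≤ K) : Monotone (growth K) := by
  intro s t hst
  unfold growth
  gcongr

theorem one_le_growth {K : ℝ} (hK : 0 ≤ K) (t : ℝ) : 1 ≤ growth K t := by
  unfold growth
  have := Real.exp_pos (K * t)
  nlinarith [mul_nonneg hK this.le]

theorem norm_mildSolution_le (F : C(ℝ, H)) {t : ℝ} (ht : 0 ≤ t) :
    ‖mildSolution hV hΦ F t‖ ≤ (1 + K) * Real.exp (K * t) * ‖toState H p 𝕜 F‖ := by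
  have hK := hΦ.pos
  refine ((isMildSolution_mildSolution hV hΦ F).norm_le hV hΦ ht).trans ?_
  have h1 : ‖F 0‖ ≤ ‖toState H p 𝕜 F‖ := norm_fst_le (toState H p 𝕜 F)
  have h2 : ∫ r in (-1 : ℝ)..0, ‖F r‖ ≤ ‖toState H p 𝕜 F‖ := by
    refine (integral_norm_le_eLpNorm (memLp_hist (p := p) F)).trans ?_
    rw [← norm_toState_snd (𝕜 := 𝕜)]
    exact norm_snd_le (toState H p 𝕜 F)
  calc _ ≤ (‖toState H p 𝕜 F‖ + K * ‖toState H p 𝕜 F‖) * Real.exp (K * t) := by gcongr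
    _ = _ := by ring

/-- The right side contains the history only in `L^p`, as the extension by density demands. In
`growth`, the exponential term bounds the newly produced piece and the final `1` the retained past.
-/
theorem norm_stateAt_le {t : ℝ} (ht : 0 ≤ t) (F : C(ℝ, H)) :
    ‖stateAt hV hΦ p t F‖ ≤ growth K t * ‖toState H p 𝕜 F‖ := by
  have hK := hΦ.pos
  set u := mildSolution hV hΦ F with hu
  set N := ‖toState H p 𝕜 F‖ with hN
  have hN0 : 0 ≤ N := norm_nonneg _
  have hb : ∀ r, 0 ≤ r → r ≤ t → ‖u r‖ ≤ (1 + K) * Real.exp (K * t) * N := fun r hr hrt =>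
    (norm_mildSolution_le (p := p) hV hΦ F hr).trans (by gcongr)
  refine norm_prod_le_iff.2 ⟨?_, ?_⟩
  · rw [stateAt_apply, toState_fst, shift_apply, add_zero]
    refine (hb t ht le_rfl).trans ?_
    unfold growth
    gcongr
    linarith
  · rw [stateAt_apply, norm_toState_snd]
    refine ENNReal.toReal_le_of_le_ofReal (by unfold growth; positivity) ?_
    have e : (shift t u : ℝ → H) = glue F u t := by
      funext σ
      unfold glue
      split_ifs with h
      · exact (isMildSolution_mildSolution hV hΦ F).1 _ h
      · rfl
    rw [e]
    refine (eLpNorm_glue_le hp1.out (memLp_hist (p := p) F).1 u.continuous ht (by positivity)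
      hb).trans ?_
    have h1 : eLpNorm F p histMeasure ≤ ENNReal.ofReal N := by
      rw [← ENNReal.ofReal_toReal (memLp_hist F).eLpNorm_ne_top, ← norm_toState_snd (𝕜 := 𝕜)]
      exact ENNReal.ofReal_le_ofReal (norm_snd_le (toState H p 𝕜 F))
    refine (add_le_add_left h1 _).trans ?_
    rw [← ENNReal.ofReal_add hN0 (by positivity)]
    refine ENNReal.ofReal_le_ofReal ?_
    unfold growth
    linarith

variable (hp : p ≠ ∞)

/-- The operators of the delay semigroup. -/
noncomputable def delayFlow (t : ℝ≥0) : State H p →L[𝕜] State H p :=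
  (stateAt hV hΦ p t).extendOfNorm (toState H p 𝕜)

include hp in
theorem delayFlow_toState (t : ℝ≥0) (F : C(ℝ, H)) :
    delayFlow hV hΦ t (toState H p 𝕜 F) = toState H p 𝕜 (shift t (mildSolution hV hΦ F)) :=
  LinearMap.extendOfNorm_eq (denseRange_toState hp) ⟨_, norm_stateAt_le hV hΦ t.coe_nonneg⟩ F

include hp in
theorem norm_delayFlow_le (t : ℝ≥0) : ‖delayFlow (p := p) hV hΦ t‖ ≤ growth K t := by
  refine ContinuousLinearMap.opNorm_le_bound _
    (zero_le_one.trans (one_le_growth hΦ.pos.le _)) fun z => ?_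
  exact LinearMap.norm_extendOfNorm_apply_le (denseRange_toState hp) (growth K t)
    (norm_stateAt_le hV hΦ t.coe_nonneg) z

include hp in
theorem delayFlow_add (s t : ℝ≥0) : delayFlow (p := p) hV hΦ (s + t) =
    (delayFlow hV hΦ s).comp (delayFlow hV hΦ t) := by
  refine ContinuousLinearMap.ext fun z => ?_
  refine (denseRange_toState (𝕜 := 𝕜) hp).induction_on
    (p := fun z => delayFlow hV hΦ (s + t) z = ((delayFlow hV hΦ s).comp (delayFlow hV hΦ t)) z) z
    (isClosed_eq (ContinuousLinearMap.continuous _) (ContinuousLinearMap.continuous _)) fun F => ?_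
  rw [ContinuousLinearMap.comp_apply, delayFlow_toState hV hΦ hp, delayFlow_toState hV hΦ hp,
    delayFlow_toState hV hΦ hp, mildSolution_shift hV hΦ F t.coe_nonneg, shift_shift, NNReal.coe_add]

include hp in
theorem tendsto_delayFlow_zero (z : State H p) :
    Tendsto (fun t : ℝ≥0 => delayFlow hV hΦ t z) (𝓝 0) (𝓝 z) := by
  rw [Metric.tendsto_nhds]
  intro ε hε
  have hK := hΦ.pos
  set M := growth K 1 with hM
  have hM1 : 1 ≤ M := one_le_growth hK.le 1
  obtain ⟨F, hF⟩ := Metric.denseRange_iff.1 (denseRange_toState (𝕜 := 𝕜) hp) z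
    (ε / (3 * M)) (by positivity)
  have h1 : ∀ᶠ t : ℝ≥0 in 𝓝 0, ∀ σ ∈ Icc (-1 : ℝ) 0,
      ‖(shift t (mildSolution hV hΦ F) - shift 0 (mildSolution hV hΦ F)) σ‖ ≤ ε / 4 := by
    have := eventually_shift_sub_le (mildSolution hV hΦ F) 0 (ε := ε / 4) (by positivity)
    exact (NNReal.continuous_coe.tendsto' 0 0 rfl).eventually this
  have h2 : toState H p 𝕜 F = toState H p 𝕜 (shift 0 (mildSolution hV hΦ F)) :=
    toState_congr fun σ hσ => by
      rw [shift_apply, zero_add, (isMildSolution_mildSolution hV hΦ F).1 σ hσ.2]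
  filter_upwards [h1, Iic_mem_nhds (zero_lt_one (α := ℝ≥0))] with t ht ht1
  have ht1' : (t : ℝ) ≤ 1 := by exact_mod_cast ht1
  have h3 : dist (delayFlow hV hΦ t z) (delayFlow hV hΦ t (toState H p 𝕜 F)) ≤
      M * dist z (toState H p 𝕜 F) := by
    rw [dist_eq_norm, dist_eq_norm, ← map_sub]
    exact ContinuousLinearMap.le_of_opNorm_le _
      ((norm_delayFlow_le hV hΦ hp t).trans (growth_mono hK.le ht1')) _
  have h4 : dist (delayFlow hV hΦ t (toState H p 𝕜 F)) (toState H p 𝕜 F) ≤ ε / 4 := by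
    rw [delayFlow_toState hV hΦ hp, h2, dist_eq_norm, ← map_sub]
    exact norm_toState_le ht
  have h5 : M * dist z (toState H p 𝕜 F) ≤ ε / 3 := by
    calc _ ≤ M * (ε / (3 * M)) := by gcongr
      _ = ε / 3 := by field_simp
  have h6 : dist z (toState H p 𝕜 F) ≤ ε / 3 :=
    le_trans (le_mul_of_one_le_left dist_nonneg hM1) h5
  calc dist (delayFlow hV hΦ t z) z ≤ dist (delayFlow hV hΦ t z)
        (delayFlow hV hΦ t (toState H p 𝕜 F)) +
        dist (delayFlow hV hΦ t (toState H p 𝕜 F)) (toState H p 𝕜 F) +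
        dist (toState H p 𝕜 F) z := dist_triangle4 _ _ _ _
    _ ≤ ε / 3 + ε / 4 + ε / 3 := by
        rw [dist_comm _ z]
        exact add_le_add (add_le_add (h3.trans h5) h4) h6
    _ < ε := by linarith

/-- The semigroup of the delay equation `u' = B u + Φ u_t` on the state space. -/
noncomputable def delaySemigroup : C0Semigroup 𝕜 (State H p) where
  op := delayFlow hV hΦ
  op_zero := by
    refine ContinuousLinearMap.ext fun z => ?_
    refine (denseRange_toState (𝕜 := 𝕜) hp).induction_on
      (p := fun z => delayFlow hV hΦ 0 z = ContinuousLinearMap.id 𝕜 _ z) z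
      (isClosed_eq (ContinuousLinearMap.continuous _) (ContinuousLinearMap.continuous _))
      fun F => ?_
    rw [delayFlow_toState hV hΦ hp, ContinuousLinearMap.id_apply]
    refine toState_congr fun σ hσ => ?_
    rw [shift_apply, NNReal.coe_zero, zero_add, (isMildSolution_mildSolution hV hΦ F).1 σ hσ.2]
  op_add := delayFlow_add hV hΦ hp
  tendsto_zero := tendsto_delayFlow_zero hV hΦ hp

theorem delaySemigroup_toState (t : ℝ≥0) (F : C(ℝ, H)) :
    (delaySemigroup hV hΦ hp).op t (toState H p 𝕜 F) =
      toState H p 𝕜 (shift t (mildSolution hV hΦ F)) := delayFlow_toState hV hΦ hp t F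

theorem norm_delaySemigroup_le {t : ℝ≥0} {τ : ℝ} (ht : t ≤ τ) :
    ‖(delaySemigroup (p := p) hV hΦ hp).op t‖ ≤ growth K τ :=
  (norm_delayFlow_le hV hΦ hp t).trans (growth_mono hΦ.pos.le ht)

theorem norm_orbit_delaySemigroup_le {t τ : ℝ} (h0 : 0 ≤ t) (ht : t ≤ τ) (z : State H p) :
    ‖(delaySemigroup hV hΦ hp).orbit z t‖ ≤ growth K τ * ‖z‖ :=
  ContinuousLinearMap.le_of_opNorm_le _
    (norm_delaySemigroup_le hV hΦ hp (by rwa [Real.coe_toNNReal _ h0])) _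

theorem continuous_orbit_delaySemigroup (z : State H p) :
    Continuous ((delaySemigroup hV hΦ hp).orbit z) :=
  C0Semigroup.continuous_orbit _ (fun τ => ⟨growth K τ, fun _ hs =>
    norm_delaySemigroup_le hV hΦ hp hs⟩) z

theorem orbit_toState_fst (F : C(ℝ, H)) {r : ℝ} (hr : 0 ≤ r) :
    ((delaySemigroup hV hΦ hp).orbit (toState H p 𝕜 F) r).1 = mildSolution hV hΦ F r := by
  rw [C0Semigroup.orbit, delaySemigroup_toState, toState_fst, shift_apply, add_zero,
    Real.coe_toNNReal _ hr]

theorem orbit_sub (T : C0Semigroup 𝕜 (State H p)) (z w : State H p) (r : ℝ) :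
    T.orbit (z - w) r = T.orbit z r - T.orbit w r := map_sub _ _ _

/-- The second component of the delay semigroup is the history of the trajectory. -/
theorem delaySemigroup_snd_ae_eq (z : State H p) (t : ℝ≥0) :
    ((delaySemigroup hV hΦ hp).op t z).2 =ᵐ[histMeasure]
      glue z.2 (fun r => ((delaySemigroup hV hΦ hp).orbit z r).1) t := by
  set T := delaySemigroup (p := p) hV hΦ hp with hT
  have hK := hΦ.pos
  set M := growth K t with hM
  have hM1 : 1 ≤ M := one_le_growth hK.le _
  have hcont : ∀ z : State H p, Continuous fun r => (T.orbit z r).1 := fun z =>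
    continuous_fst.comp (continuous_orbit_delaySemigroup hV hΦ hp z)
  have hmeas : AEStronglyMeasurable (glue z.2 (fun r => (T.orbit z r).1) t) histMeasure :=
    aestronglyMeasurable_glue (Lp.aestronglyMeasurable z.2) (hcont z) t.coe_nonneg
  have hmeas' : AEStronglyMeasurable ((T.op t z).2 : ℝ → H) histMeasure :=
    Lp.aestronglyMeasurable _
  -- The identity is exact for continuous histories. In passing to `z`, the flow contributes `M *
  -- d`, the old history `d` and the glued new piece `M * d`.
  have key : ∀ F : C(ℝ, H), eLpNorm (fun σ => (T.op t z).2 σ -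
      glue z.2 (fun r => (T.orbit z r).1) t σ) p histMeasure ≤
      ENNReal.ofReal (3 * M * ‖z - toState H p 𝕜 F‖) := by
    intro F
    set d := ‖z - toState H p 𝕜 F‖ with hd
    set y := fun r => (T.orbit (toState H p 𝕜 F - z) r).1 with hy
    have e : (fun σ => (T.op t z).2 σ - glue z.2 (fun r => (T.orbit z r).1) t σ)
        =ᵐ[histMeasure] (fun σ => (T.op t (z - toState H p 𝕜 F)).2 σ +
          glue (toState H p 𝕜 F - z).2 y t σ) := by
      have h1 : (T.op t z).2 = (T.op t (z - toState H p 𝕜 F)).2 + (T.op t (toState H p 𝕜 F)).2 := by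
        rw [map_sub, Prod.snd_sub, sub_add_cancel]
      have h2 := coeFn_toState_snd (p := p) (𝕜 := 𝕜) (shift t (mildSolution hV hΦ F))
      rw [← delaySemigroup_toState hV hΦ hp t F] at h2
      have h3 : ((toState H p 𝕜 F - z).2 : ℝ → H) =ᵐ[histMeasure] fun r => F r - z.2 r := by
        filter_upwards [Lp.coeFn_sub (toState H p 𝕜 F).2 z.2,
          coeFn_toState_snd (p := p) (𝕜 := 𝕜) F] with r h h'
        rw [Prod.snd_sub, h, Pi.sub_apply, h']
      rw [h1]
      filter_upwards [Lp.coeFn_add (T.op t (z - toState H p 𝕜 F)).2 (T.op t (toState H p 𝕜 F)).2,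
        h2, glue_congr_ae h3 t.coe_nonneg (y := y)] with σ h4 h5 h6
      rw [h4, Pi.add_apply, h5, add_sub_assoc]
      congr 1
      refine Eq.trans ?_ h6.symm
      unfold glue
      by_cases h : (t : ℝ) + σ ≤ 0
      · rw [if_pos h, if_pos h, shift_apply, (isMildSolution_mildSolution hV hΦ F).1 _ h]
      · rw [if_neg h, if_neg h, shift_apply, hy]
        beta_reduce
        rw [orbit_sub, Prod.fst_sub, orbit_toState_fst hV hΦ hp F (not_le.1 h).le]
    rw [eLpNorm_congr_ae e]
    have hgm : AEStronglyMeasurable (glue (toState H p 𝕜 F - z).2 y t) histMeasure :=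
      aestronglyMeasurable_glue (Lp.aestronglyMeasurable _) (hcont _) t.coe_nonneg
    refine (eLpNorm_add_le (Lp.aestronglyMeasurable _) hgm hp1.out).trans ?_
    have hd' : ‖toState H p 𝕜 F - z‖ = d := norm_sub_rev _ _
    have h7 : eLpNorm (T.op t (z - toState H p 𝕜 F)).2 p histMeasure ≤
        ENNReal.ofReal (M * d) := by
      rw [eLpNorm_coe_hist]
      refine ENNReal.ofReal_le_ofReal ((norm_snd_le _).trans ?_)
      exact ContinuousLinearMap.le_of_opNorm_le _ (norm_delaySemigroup_le hV hΦ hp le_rfl) _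
    have h8 : eLpNorm (glue (toState H p 𝕜 F - z).2 y t) p histMeasure ≤
        ENNReal.ofReal d + ENNReal.ofReal (M * d) := by
      refine (eLpNorm_glue_le hp1.out (Lp.aestronglyMeasurable _) (hcont _) t.coe_nonneg
        (R := M * d) (by positivity) fun r hr hrt => ?_).trans ?_
      · refine (norm_fst_le _).trans ?_
        rw [← hd']
        exact norm_orbit_delaySemigroup_le hV hΦ hp hr hrt _
      · gcongr
        rw [eLpNorm_coe_hist, ← hd']
        exact ENNReal.ofReal_le_ofReal (norm_snd_le _)
    refine (add_le_add h7 h8).trans ?_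
    rw [← ENNReal.ofReal_add (by positivity) (by positivity),
      ← ENNReal.ofReal_add (by positivity) (by positivity)]
    refine ENNReal.ofReal_le_ofReal ?_
    have : d ≤ M * d := le_mul_of_one_le_left (norm_nonneg _) hM1
    linarith
  have hzero : eLpNorm (fun σ => (T.op t z).2 σ -
      glue z.2 (fun r => (T.orbit z r).1) t σ) p histMeasure = 0 := by
    refine le_antisymm (ENNReal.le_of_forall_pos_le_add fun ε hε _ => ?_) zero_le
    obtain ⟨F, hF⟩ := Metric.denseRange_iff.1 (denseRange_toState (𝕜 := 𝕜) hp) z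
      (ε / (3 * M)) (by positivity)
    rw [zero_add, ← ENNReal.ofReal_coe_nnreal]
    refine (key F).trans (ENNReal.ofReal_le_ofReal ?_)
    rw [dist_eq_norm] at hF
    calc _ ≤ 3 * M * (ε / (3 * M)) := by gcongr
      _ = ε := by field_simp
  filter_upwards [(eLpNorm_eq_zero_iff (hmeas'.sub hmeas)
    (zero_lt_one.trans_le hp1.out).ne').1 hzero] with σ hσ
  exact sub_eq_zero.1 hσ

/-- Short-time estimate in terms of a bound for the whole trajectory. -/
theorem norm_orbit_fst_sub_le (z : State H p) {s R : ℝ} (hs : 0 ≤ s)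
    (hz : ∀ᵐ σ ∂histMeasure, ‖z.2 σ‖ ≤ R)
    (hR : ∀ r, 0 ≤ r → r ≤ s → ‖((delaySemigroup hV hΦ hp).orbit z r).1‖ ≤ R) :
    ‖((delaySemigroup hV hΦ hp).orbit z s).1 - V.orbit z.1 s‖ ≤ K * s * R := by
  set T := delaySemigroup (p := p) hV hΦ hp with hT
  have hK := hΦ.pos
  set M := growth K s with hM
  have hM1 : 1 ≤ M := one_le_growth hK.le _
  have hR0 : 0 ≤ R := (norm_nonneg _).trans (hR 0 le_rfl hs)
  have key : ∀ F : C(ℝ, H), ‖(T.orbit z s).1 - V.orbit z.1 s‖ ≤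
      K * s * R + (K * (1 + s * M) + M + 1) * ‖z - toState H p 𝕜 F‖ := by
    intro F
    set d := ‖z - toState H p 𝕜 F‖ with hd
    have hd0 : 0 ≤ d := norm_nonneg _
    set u := mildSolution hV hΦ F with hu
    have hsol := isMildSolution_mildSolution hV hΦ F
    have horb : ∀ r, 0 ≤ r → r ≤ s → ‖(T.orbit z r).1 - u r‖ ≤ M * d := by
      intro r hr hrs
      rw [← orbit_toState_fst hV hΦ hp F hr, ← Prod.fst_sub, ← orbit_sub]
      exact (norm_fst_le _).trans (norm_orbit_delaySemigroup_le hV hΦ hp hr hrs _)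
    have hpast : ∫ r in (-1 : ℝ)..0, ‖F r - z.2 r‖ ≤ d := by
      refine (integral_norm_le_eLpNorm (f := fun r => F r - z.2 r)
        ((memLp_hist F).sub (Lp.memLp z.2))).trans ?_
      have e : (fun r => F r - z.2 r) = -(fun r => z.2 r - F r) := by
        funext r; simp
      rw [e, eLpNorm_neg, ← norm_sub_toLp z.2 (memLp_hist F)]
      exact norm_snd_le (z - toState H p 𝕜 F)
    -- The bound `R` concerns `z`, while the averaged estimate applies to the approximating solution
    -- `u`. They differ by at most `d` in `L^1` on the past and by `M * d` pointwise afterwards, so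
    -- the defect vanishes with `d` and the leading term stays `s * R`.
    have hwin : ∀ σ ∈ Icc (-1 : ℝ) 0, ∫ r in σ..σ + s, ‖u r‖ ≤ s * R + (1 + s * M) * d := by
      intro σ hσ
      let g : ℝ → ℝ := fun r => if r ≤ 0 then (Icc (-1 : ℝ) 0).indicator
        (fun r => ‖F r - z.2 r‖) r else 0
      have hgi : Integrable g volume := by
        have h1 : Integrable ((Icc (-1 : ℝ) 0).indicator fun r => ‖F r - z.2 r‖) volume := by
          rw [integrable_indicator_iff measurableSet_Icc]
          exact (integrableOn_of_memLp_hist ((memLp_hist (p := p) F).sub (Lp.memLp z.2))).norm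
        refine h1.congr (Eventually.of_forall fun r => ?_)
        simp only [g]
        split_ifs with h
        · rfl
        · exact indicator_of_notMem (fun h' => h h'.2) _
      have hg0 : ∀ r, 0 ≤ g r := fun r => by
        simp only [g]
        split_ifs
        · exact indicator_nonneg (fun _ _ => norm_nonneg _) _
        · exact le_rfl
      have hle : ∀ᵐ r, r ∈ Icc σ (σ + s) → ‖u r‖ ≤ R + M * d + g r := by
        have hz' := ae_hist_iff.1 hz
        filter_upwards [hz'] with r hr hrm
        rcases le_or_gt r 0 with h | h
        · have hm : r ∈ Icc (-1 : ℝ) 0 := ⟨hσ.1.trans hrm.1, h⟩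
          have e : g r = ‖F r - z.2 r‖ := by simp [g, h, indicator_of_mem hm]
          rw [e, hsol.1 r h]
          have h1 := norm_le_norm_sub_add (F r) (z.2 r)
          have h2 := hr hm
          have h3 : 0 ≤ M * d := by positivity
          linarith
        · have h1 := horb r h.le (by linarith [hrm.2, hσ.2])
          have h2 := hR r h.le (by linarith [hrm.2, hσ.2])
          have h3 := norm_le_norm_sub_add (u r) ((T.orbit z r).1)
          rw [norm_sub_rev] at h1
          linarith [hg0 r]
      have hss : σ ≤ σ + s := by linarith
      calc ∫ r in σ..σ + s, ‖u r‖ ≤ ∫ r in σ..σ + s, (R + M * d + g r) := by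
            refine intervalIntegral.integral_mono_ae_restrict hss
              (u.continuous.norm.intervalIntegrable _ _)
              (intervalIntegrable_const.add hgi.intervalIntegrable) ?_
            exact (ae_restrict_iff' measurableSet_Icc).2 hle
        _ = s * (R + M * d) + ∫ r in σ..σ + s, g r := by
            rw [intervalIntegral.integral_add intervalIntegrable_const hgi.intervalIntegrable,
              intervalIntegral.integral_const, smul_eq_mul, add_sub_cancel_left]
        _ ≤ s * (R + M * d) + d := by
            gcongr
            refine le_trans ?_ hpast
            rw [intervalIntegral.integral_of_le hss,
              intervalIntegral.integral_of_le (by norm_num), ← integral_Icc_eq_integral_Ioc (x := -1)]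
            refine (setIntegral_le_integral hgi (Eventually.of_forall hg0)).trans (le_of_eq ?_)
            rw [← integral_indicator measurableSet_Icc]
            refine integral_congr_ae (Eventually.of_forall fun r => ?_)
            simp only [g]
            split_ifs with h
            · rfl
            · exact (indicator_of_notMem (fun h' => h h'.2) _).symm
        _ = _ := by ring
    have h1 := hsol.norm_sub_le hV hΦ hs hwin
    have h2 := horb s hs le_rfl
    have h3 : ‖V.orbit (F 0) s - V.orbit z.1 s‖ ≤ d := by
      have : V.orbit (F 0) s - V.orbit z.1 s = V.orbit (F 0 - z.1) s := (map_sub _ _ _).symm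
      rw [this]
      refine (V.norm_orbit_le hV _ _).trans ?_
      rw [norm_sub_rev]
      exact norm_fst_le (z - toState H p 𝕜 F)
    have e : (T.orbit z s).1 - V.orbit z.1 s = ((T.orbit z s).1 - u s) +
        (u s - V.orbit (F 0) s) + (V.orbit (F 0) s - V.orbit z.1 s) := by abel
    rw [e]
    refine (norm_add₃_le).trans ?_
    nlinarith
  refine le_of_forall_pos_le_add fun ε hε => ?_
  set L := K * (1 + s * M) + M + 1 with hL
  have hL0 : 0 < L := by positivity
  obtain ⟨F, hF⟩ := Metric.denseRange_iff.1 (denseRange_toState (𝕜 := 𝕜) hp) z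
    (ε / L) (by positivity)
  rw [dist_eq_norm] at hF
  refine (key F).trans ?_
  gcongr
  calc _ ≤ L * (ε / L) := by gcongr
    _ = ε := by field_simp

end DelaySemigroup

/-! ### Sobolev histories as primitives -/

section Primitive

variable {H : Type*} [NormedAddCommGroup H] {p : ℝ≥0∞} [hp1 : Fact (1 ≤ p)]

/-- A history supported in `(-t, 0]` and bounded there by `R` has norm at most `R t^{1/p}`. -/
theorem norm_hist_le_of_tail {f : Hist H p} {t R : ℝ} (hp : p ≠ ∞) (ht : 0 ≤ t) (hR : 0 ≤ R)
    (h0 : ∀ᵐ σ ∂histMeasure, t + σ ≤ 0 → f σ = 0)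
    (h1 : ∀ᵐ σ ∂histMeasure, 0 < t + σ → ‖f σ‖ ≤ R) : ‖f‖ ≤ R * t ^ (1 / p.toReal) := by
  refine norm_toReal_le_of_le (by positivity) ?_
  calc eLpNorm f p histMeasure ≤ eLpNorm ((Icc (-t) 0).indicator fun _ => R) p histMeasure := by
        refine eLpNorm_mono_ae ?_
        filter_upwards [h0, h1, ae_hist_of_forall (P := fun σ => σ ∈ Icc (-1 : ℝ) 0) fun _ h => h]
          with σ g0 g1 hm
        rcases le_or_gt (t + σ) 0 with h | h
        · rw [g0 h, norm_zero]; positivity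
        · rw [indicator_of_mem (show σ ∈ Icc (-t) 0 from ⟨by linarith, hm.2⟩),
            Real.norm_of_nonneg hR]
          exact g1 h
    _ = ‖R‖ₑ * histMeasure (Icc (-t) 0) ^ (1 / p.toReal) :=
        eLpNorm_indicator_const measurableSet_Icc (zero_lt_one.trans_le hp1.out).ne' hp
    _ ≤ ENNReal.ofReal R * ENNReal.ofReal t ^ (1 / p.toReal) := by
        rw [Real.enorm_eq_ofReal hR]
        gcongr
        refine (Measure.restrict_le_self _).trans ?_
        simp
    _ = _ := by
        rw [ENNReal.ofReal_rpow_of_nonneg ht (by positivity), ENNReal.ofReal_mul hR]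

variable [NormedSpace ℝ H]

theorem integrable_indicator_hist (g : Hist H p) :
    Integrable ((Icc (-1 : ℝ) 0).indicator g) volume :=
  (integrable_indicator_iff measurableSet_Icc).2 (integrableOn_of_memLp_hist (Lp.memLp g))

/-- The primitive of `g` with value `x` at `0`, extended by constants outside `[-1,0]`. -/
noncomputable def prim (x : H) (g : Hist H p) : C(ℝ, H) :=
  ⟨fun σ => x + ∫ s in (0 : ℝ)..σ, (Icc (-1 : ℝ) 0).indicator g s,
    continuous_const.add (intervalIntegral.continuous_primitive
      (fun _ _ => (integrable_indicator_hist g).intervalIntegrable) 0)⟩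

theorem prim_apply (x : H) (g : Hist H p) (σ : ℝ) :
    prim x g σ = x + ∫ s in (0 : ℝ)..σ, (Icc (-1 : ℝ) 0).indicator g s := rfl

@[simp] theorem prim_zero (x : H) (g : Hist H p) : prim x g 0 = x := by simp [prim_apply]

theorem prim_sub_prim (x : H) (g : Hist H p) (a b : ℝ) :
    prim x g b - prim x g a = ∫ s in a..b, (Icc (-1 : ℝ) 0).indicator g s := by
  rw [prim_apply, prim_apply, add_sub_add_left_eq_sub, intervalIntegral.integral_interval_sub_left]
  all_goals exact (integrable_indicator_hist g).intervalIntegrable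

theorem prim_of_mem (x : H) (g : Hist H p) {σ : ℝ} (hσ : σ ∈ Icc (-1 : ℝ) 0) :
    prim x g σ = x + ∫ s in (0 : ℝ)..σ, g s := by
  rw [prim_apply]
  congr 1
  refine intervalIntegral.integral_congr fun s hs => ?_
  exact indicator_of_mem (uIcc_subset_Icc ⟨by norm_num, le_rfl⟩ hσ hs) _

theorem prim_of_nonneg (x : H) (g : Hist H p) {t : ℝ} (ht : 0 ≤ t) : prim x g t = x := by
  rw [prim_apply]
  have : ∫ s in (0 : ℝ)..t, (Icc (-1 : ℝ) 0).indicator g s = ∫ s in (0 : ℝ)..t, (0 : H) := by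
    refine intervalIntegral.integral_congr_ae (Eventually.of_forall fun s hs => ?_)
    rw [uIoc_of_le ht] at hs
    exact indicator_of_notMem (fun h => absurd h.2 (not_le.2 hs.1)) _
  rw [this]; simp

theorem norm_integral_hist_le (g : Hist H p) {a b : ℝ} (ha : a ∈ Icc (-1 : ℝ) 0)
    (hb : b ∈ Icc (-1 : ℝ) 0) : ‖∫ s in a..b, g s‖ ≤ ‖g‖ := by
  refine (intervalIntegral.norm_integral_le_abs_integral_norm).trans ?_
  have hi := intervalIntegrable_of_memLp_hist (Lp.memLp g) (a := -1) (b := 0)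
    ⟨le_rfl, by norm_num⟩ ⟨by norm_num, le_rfl⟩
  have h2 := integral_norm_le_eLpNorm (Lp.memLp g)
  rw [← Lp.norm_def] at h2
  refine le_trans ?_ h2
  rw [← abs_of_nonneg (intervalIntegral.integral_nonneg (μ := volume) (by norm_num : (-1 : ℝ) ≤ 0)
    fun s _ => norm_nonneg (g s))]
  refine intervalIntegral.abs_integral_mono_interval ?_ (Eventually.of_forall fun _ => norm_nonneg _)
    hi.norm
  rw [uIoc_of_le (by norm_num : (-1 : ℝ) ≤ 0)]
  exact Ioc_subset_Ioc (le_min ha.1 hb.1) (max_le ha.2 hb.2)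

theorem norm_prim_le (x : H) (g : Hist H p) {σ : ℝ} (hσ : σ ∈ Icc (-1 : ℝ) 0) :
    ‖prim x g σ‖ ≤ ‖x‖ + ‖g‖ := by
  rw [prim_of_mem x g hσ]
  exact (norm_add_le _ _).trans (by
    gcongr; exact norm_integral_hist_le g ⟨by norm_num, le_rfl⟩ hσ)

theorem prim_add_apply (x y : H) (g h : Hist H p) {σ : ℝ} (hσ : σ ∈ Icc (-1 : ℝ) 0) :
    prim (x + y) (g + h) σ = prim x g σ + prim y h σ := by
  have h0 : (0 : ℝ) ∈ Icc (-1 : ℝ) 0 := ⟨by norm_num, le_rfl⟩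
  rw [prim_of_mem _ _ hσ, prim_of_mem _ _ hσ, prim_of_mem _ _ hσ]
  have : ∫ s in (0 : ℝ)..σ, (g + h : Hist H p) s = ∫ s in (0 : ℝ)..σ, (g s + h s) := by
    refine intervalIntegral.integral_congr_ae ?_
    filter_upwards [ae_hist_iff.1 (Lp.coeFn_add g h)] with s hs hm
    exact hs (uIcc_subset_Icc h0 hσ (uIoc_subset_uIcc hm))
  rw [this, intervalIntegral.integral_add (intervalIntegrable_of_memLp_hist (Lp.memLp g) h0 hσ)
    (intervalIntegrable_of_memLp_hist (Lp.memLp h) h0 hσ)]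
  abel

theorem prim_smul_apply {𝕜 : Type*} [RCLike 𝕜] [NormedSpace 𝕜 H] [IsScalarTower ℝ 𝕜 H] (c : 𝕜)
    (x : H) (g : Hist H p) {σ : ℝ} (hσ : σ ∈ Icc (-1 : ℝ) 0) :
    prim (c • x) (c • g) σ = c • prim x g σ := by
  have : SMulCommClass ℝ 𝕜 H := IsScalarTower.to_smulCommClass
  have h0 : (0 : ℝ) ∈ Icc (-1 : ℝ) 0 := ⟨by norm_num, le_rfl⟩
  rw [prim_of_mem _ _ hσ, prim_of_mem _ _ hσ, smul_add, ← intervalIntegral.integral_smul]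
  congr 1
  refine intervalIntegral.integral_congr_ae ?_
  filter_upwards [ae_hist_iff.1 (Lp.coeFn_smul c g)] with s hs hm
  exact hs (uIcc_subset_Icc h0 hσ (uIoc_subset_uIcc hm))

theorem prim_sub_apply (x y : H) (g h : Hist H p) {σ : ℝ} (hσ : σ ∈ Icc (-1 : ℝ) 0) :
    prim (x - y) (g - h) σ = prim x g σ - prim y h σ := by
  rw [eq_sub_iff_add_eq, ← prim_add_apply _ _ _ _ hσ, sub_add_cancel, sub_add_cancel]

variable {𝕜 : Type*} [RCLike 𝕜] [NormedSpace 𝕜 H]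

theorem isSobolevRep_prim (x : H) (g : Hist H p) :
    IsSobolevRep (prim x g) (toState H p 𝕜 (prim x g)).2 g :=
  ⟨coeFn_toState_snd _, fun σ hσ => by rw [prim_zero, prim_of_mem x g hσ]⟩

theorem IsSobolevRep.eqOn_prim {F : ℝ → H} {f g : Hist H p} (h : IsSobolevRep F f g) :
    EqOn F (prim (F 0) g) (Icc (-1) 0) := fun σ hσ => by
  rw [prim_of_mem _ _ hσ, h.2 σ hσ]

theorem IsSobolevRep.eq_toState {F : ℝ → H} {f g : Hist H p} (h : IsSobolevRep F f g) :
    (F 0, f) = toState H p 𝕜 (prim (F 0) g) := by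
  refine Prod.ext (prim_zero _ _).symm (Lp.ext ?_)
  filter_upwards [h.1, coeFn_toState_snd (p := p) (𝕜 := 𝕜) (prim (F 0) g),
    ae_hist_of_forall h.eqOn_prim] with σ h1 h2 h3
  rw [h2, h1, h3]

/-- A point of the graph is determined by its head and the derivative of its history. The right side
no longer quantifies over representatives and has the same shape as the generator characterization
of the delay semigroup. -/
theorem mem_graphG_iff {B : H →ₗ.[𝕜] H} {η : ℝ → H →L[𝕜] H} {z w : State H p} :
    (z, w) ∈ graphG p B η ↔ z = toState H p 𝕜 (prim z.1 w.2) ∧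
      (z.1, w.1 - delayOp η (prim z.1 w.2)) ∈ B.graph := by
  constructor
  · rintro ⟨x, F, f, g, hS, hx, hq⟩
    obtain ⟨rfl, rfl⟩ := Prod.ext_iff.1 hq
    refine ⟨?_, ?_⟩
    · simp only
      rw [← hx]
      exact hS.eq_toState
    · simp only
      rw [← hx, delayOp_congr hS.eqOn_prim, add_sub_cancel_right, hx]
      exact LinearPMap.mem_graph _ _
  · rintro ⟨hz, hB⟩
    obtain ⟨x, hx, hBx⟩ := (LinearPMap.mem_graph_iff _).1 hB
    refine ⟨x, prim z.1 w.2, z.2, w.2, ?_, by rw [prim_zero]; exact hx.symm, ?_⟩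
    · have := isSobolevRep_prim (𝕜 := 𝕜) z.1 w.2
      rwa [← hz] at this
    · refine Prod.ext (Prod.ext hx.symm rfl) (Prod.ext ?_ rfl)
      simp [hBx]

theorem toPMap_zero_apply (x : ((0 : H →ₗ[𝕜] H).toPMap ⊤).domain) :
    ((0 : H →ₗ[𝕜] H).toPMap ⊤) x = 0 := rfl

/-- `A₂` is the delay generator for `B = 0` with full domain, so it needs no separate treatment. -/
theorem graphA₂_eq_graphG (η : ℝ → H →L[𝕜] H) :
    graphA₂ p η = graphG p ((0 : H →ₗ[𝕜] H).toPMap ⊤) η := by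
  ext q
  constructor
  · rintro ⟨x, F, f, g, hS, hx, rfl⟩
    exact ⟨⟨x, trivial⟩, F, f, g, hS, hx, by simp⟩
  · rintro ⟨x, F, f, g, hS, hx, rfl⟩
    exact ⟨x, F, f, g, hS, hx, by rw [toPMap_zero_apply, zero_add]⟩

end Primitive

/-! ### The model case `u' = 0` -/

section FrozenSemigroup

variable {𝕜 : Type*} [RCLike 𝕜] {H : Type*} [NormedAddCommGroup H] [NormedSpace 𝕜 H]

variable (𝕜 H) in
/-- The trivial semigroup. -/
def idSemigroup : C0Semigroup 𝕜 H where
  op _ := ContinuousLinearMap.id 𝕜 H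
  op_zero := rfl
  op_add _ _ := rfl
  tendsto_zero _ := tendsto_const_nhds

theorem norm_idSemigroup_le (t : ℝ≥0) : ‖(idSemigroup 𝕜 H).op t‖ ≤ 1 :=
  ContinuousLinearMap.norm_id_le

@[simp] theorem orbit_idSemigroup (x : H) (t : ℝ) : (idSemigroup 𝕜 H).orbit x t = x := rfl

variable [NormedSpace ℝ H] [IsScalarTower ℝ 𝕜 H]

theorem hasGenerator_idSemigroup :
    (idSemigroup 𝕜 H).HasGenerator (((0 : H →ₗ[𝕜] H).toPMap ⊤).graph : Set (H × H)) := by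
  refine C0Semigroup.hasGenerator_of_forall fun x y => ?_
  have h0 : (idSemigroup 𝕜 H).Gen x 0 := hasDerivWithinAt_const (0 : ℝ) _ x
  rw [SetLike.mem_coe, LinearPMap.mem_graph_iff]
  constructor
  · rintro ⟨z, rfl, hz⟩
    have hy : y = 0 := hz.symm
    rwa [hy]
  · intro h
    exact ⟨⟨x, trivial⟩, rfl, h0.unique h⟩

theorem isDelayFunctional_zero : IsDelayFunctional (0 : C(ℝ, H) →ₗ[𝕜] H) 1 where
  one_le := le_rfl
  norm_le u m hm := by
    simpa using (norm_nonneg _).trans (hm 0 ⟨by norm_num, le_rfl⟩)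
  integral_le u t M ht hM := by
    have h := hM 0 ⟨by norm_num, le_rfl⟩
    have h2 : 0 ≤ ∫ r in (0 : ℝ)..0 + t, ‖u r‖ :=
      intervalIntegral.integral_nonneg (by linarith) fun _ _ => norm_nonneg _
    simpa using h2.trans h

variable [CompleteSpace H] {p : ℝ≥0∞} [hp1 : Fact (1 ≤ p)]

variable (𝕜 H) in
/-- The semigroup of `u' = 0` on the state space: histories are frozen at time zero. -/
noncomputable def frozenSemigroup (hp : p ≠ ∞) : C0Semigroup 𝕜 (State H p) :=
  delaySemigroup (V := idSemigroup 𝕜 H) norm_idSemigroup_le isDelayFunctional_zero hp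

/-- Being constant after time `0`, the extended primitive is its own solution. -/
theorem frozen_orbit_prim (hp : p ≠ ∞) (x : H) (g : Hist H p) {t : ℝ} (ht : 0 ≤ t) :
    (frozenSemigroup 𝕜 H hp).orbit (toState H p 𝕜 (prim x g)) t =
      toState H p 𝕜 (shift t (prim x g)) := by
  have hs : IsMildSolution (idSemigroup 𝕜 H) 0 (prim x g) (prim x g) := by
    refine ⟨fun _ _ => rfl, fun t ht => ?_⟩
    simp [prim_of_nonneg x g ht, duhamel]
  rw [C0Semigroup.orbit, frozenSemigroup, delaySemigroup_toState, Real.coe_toNNReal _ ht,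
    (isMildSolution_mildSolution norm_idSemigroup_le isDelayFunctional_zero _).unique
      norm_idSemigroup_le isDelayFunctional_zero hs]

/-- Since `G 0 = 0`, the derivative of the primitive is continuous across the junction with its
constant continuation, and difference quotients converge uniformly by uniform continuity. -/
theorem gen_frozen_of_continuous (hp : p ≠ ∞) (x : H) {G : C(ℝ, H)} (hG : G 0 = 0) :
    (frozenSemigroup 𝕜 H hp).Gen (toState H p 𝕜 (prim x (toState H p 𝕜 G).2))
      (toState H p 𝕜 G) := by
  set g := (toState H p 𝕜 G).2 with hg
  rw [C0Semigroup.gen_iff_tendsto, Metric.tendsto_nhdsWithin_nhds]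
  intro ε hε
  let Gm : C(ℝ, H) := ⟨fun r => G (min r 0), by fun_prop⟩
  have huc := (isCompact_Icc (a := (-1 : ℝ)) (b := 1)).uniformContinuousOn_of_continuous
    Gm.continuous.continuousOn
  rw [Metric.uniformContinuousOn_iff] at huc
  obtain ⟨δ, hδ, hd⟩ := huc (ε / 2) (by positivity)
  refine ⟨min δ 1, by positivity, fun {t} ht htd => ?_⟩
  have ht0 : 0 < t := ht
  rw [Real.dist_eq, sub_zero, abs_of_pos ht0, lt_min_iff] at htd
  have hint : ∀ a b, IntervalIntegrable Gm volume a b :=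
    fun a b => Gm.continuous.intervalIntegrable a b
  have hdiff : ∀ σ ∈ Icc (-1 : ℝ) 0, prim x g (t + σ) - prim x g σ = ∫ r in σ..t + σ, Gm r := by
    intro σ hσ
    rw [prim_sub_prim]
    refine intervalIntegral.integral_congr_ae ?_
    filter_upwards [ae_hist_iff.1 (coeFn_toState_snd (p := p) (𝕜 := 𝕜) G)] with r hr hm
    rw [uIoc_of_le (by linarith)] at hm
    by_cases h : r ≤ 0
    · have hrm : r ∈ Icc (-1 : ℝ) 0 := ⟨by linarith [hσ.1, hm.1], h⟩
      rw [indicator_of_mem hrm, hr hrm]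
      simp [Gm, min_eq_left h]
    · rw [indicator_of_notMem (fun h' => h h'.2)]
      simp [Gm, min_eq_right (not_le.1 h).le, hG]
  rw [frozen_orbit_prim hp x g ht0.le, dist_eq_norm, ← map_sub,
    ← C0Semigroup.ofReal_inv_smul_eq (𝕜 := 𝕜), ← map_smul, ← map_sub]
  refine lt_of_le_of_lt (norm_toState_le fun σ hσ => ?_) (show ε / 2 < ε by linarith)
  rw [ContinuousMap.sub_apply, ContinuousMap.smul_apply, ContinuousMap.sub_apply, shift_apply,
    hdiff σ hσ, C0Semigroup.ofReal_inv_smul_eq]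
  have e : t⁻¹ • (∫ r in σ..t + σ, Gm r) - G σ = t⁻¹ • ∫ r in σ..t + σ, (Gm r - Gm σ) := by
    rw [intervalIntegral.integral_sub (hint _ _) intervalIntegrable_const,
      intervalIntegral.integral_const, add_sub_cancel_right,
      smul_sub t⁻¹ (∫ r in σ..t + σ, Gm r), smul_smul, inv_mul_cancel₀ ht0.ne', one_smul]
    simp [Gm, min_eq_left hσ.2]
  rw [e, norm_smul, norm_inv, Real.norm_of_nonneg ht0.le]
  have hb : ‖∫ r in σ..t + σ, (Gm r - Gm σ)‖ ≤ ε / 2 * |t + σ - σ| := by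
    refine intervalIntegral.norm_integral_le_of_norm_le_const fun r hr => ?_
    rw [uIoc_of_le (by linarith)] at hr
    have := hd r ⟨by linarith [hσ.1, hr.1], by linarith [hσ.2, hr.2]⟩ σ
      ⟨hσ.1, by linarith [hσ.2]⟩ (by rw [Real.dist_eq, abs_lt]; constructor <;> linarith [hr.1, hr.2])
    rw [dist_eq_norm] at this
    exact this.le
  rw [add_sub_cancel_right, abs_of_pos ht0] at hb
  calc _ ≤ t⁻¹ * (ε / 2 * t) := by gcongr
    _ = ε / 2 := by field_simp

/-- Continuous derivatives vanishing at `0` are dense in `L^p`, and the generator is closed.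
Subtracting the constant `F 0` from an approximant at most doubles the error, since the target head
is `0`. -/
theorem gen_frozen (hp : p ≠ ∞) (x : H) (g : Hist H p) :
    (frozenSemigroup 𝕜 H hp).Gen (toState H p 𝕜 (prim x g)) (0, g) := by
  have hF : ∀ n : ℕ, ∃ F : C(ℝ, H), F 0 = 0 ∧
      ‖toState H p 𝕜 F - (0, g)‖ ≤ 2 * (1 / ((n : ℝ) + 1)) := by
    intro n
    obtain ⟨F, hF⟩ := Metric.denseRange_iff.1 (denseRange_toState (𝕜 := 𝕜) hp)
      ((0, g) : State H p) (1 / ((n : ℝ) + 1)) (by positivity)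
    rw [dist_comm, dist_eq_norm] at hF
    refine ⟨F - ContinuousMap.const ℝ (F 0), by simp, ?_⟩
    have h1 : ‖F 0‖ ≤ ‖toState H p 𝕜 F - (0, g)‖ := by
      have := norm_fst_le (toState H p 𝕜 F - (0, g))
      simpa using this
    have h2 : ‖toState H p 𝕜 (ContinuousMap.const ℝ (F 0))‖ ≤ ‖F 0‖ :=
      norm_toState_le fun σ _ => by simp
    rw [map_sub, sub_right_comm]
    refine (norm_sub_le _ _).trans ?_
    linarith
  choose F hF0 hF using hF
  have hlim : Tendsto (fun n => toState H p 𝕜 (F n)) atTop (𝓝 (0, g)) := by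
    rw [tendsto_iff_norm_sub_tendsto_zero]
    refine squeeze_zero (fun _ => norm_nonneg _) hF ?_
    simpa using (tendsto_one_div_add_atTop_nhds_zero_nat (𝕜 := ℝ)).const_mul 2
  refine C0Semigroup.gen_of_tendsto zero_lt_one
    (fun s hs => norm_delaySemigroup_le norm_idSemigroup_le isDelayFunctional_zero hp hs)
    (fun n => gen_frozen_of_continuous hp x (hF0 n)) ?_ hlim
  rw [tendsto_iff_norm_sub_tendsto_zero]
  refine squeeze_zero (fun _ => norm_nonneg _) (fun n => ?_)
    (tendsto_iff_norm_sub_tendsto_zero.1 hlim)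
  rw [← map_sub]
  refine norm_toState_le fun σ hσ => ?_
  rw [ContinuousMap.sub_apply, ← prim_sub_apply _ _ _ _ hσ, sub_self]
  refine (norm_prim_le _ _ hσ).trans ?_
  rw [norm_zero, zero_add]
  exact norm_snd_le (toState H p 𝕜 (F n) - (0, g))

end FrozenSemigroup

/-! ### The generator of the delay semigroup -/

section Generator

variable {𝕜 : Type*} [RCLike 𝕜] {H : Type*} [NormedAddCommGroup H] [NormedSpace 𝕜 H]
  [NormedSpace ℝ H] [IsScalarTower ℝ 𝕜 H] [CompleteSpace H]
  {V : C0Semigroup 𝕜 H} (hV : ∀ t, ‖V.op t‖ ≤ 1) {Φ : C(ℝ, H) →ₗ[𝕜] H} {K : ℝ}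
  (hΦ : IsDelayFunctional Φ K)

include hV hΦ in
-- The Duhamel integrand is jointly continuous and equals `Φ u` at the origin.
theorem tendsto_inv_smul_duhamel (u : C(ℝ, H)) :
    Tendsto (fun t : ℝ => t⁻¹ • duhamel V Φ u t) (𝓝[>] 0) (𝓝 (Φ u)) := by
  rw [Metric.tendsto_nhdsWithin_nhds]
  intro ε hε
  have hc := (continuous_duhamel_integrand hV hΦ u).tendsto (0, 0)
  have e0 : V.orbit (Φ (shift (0, (0 : ℝ)).2 u)) ((0, (0 : ℝ)).1 - (0, (0 : ℝ)).2) = Φ u := by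
    have : shift 0 u = u := by ext σ; simp
    simp [this, C0Semigroup.orbit_zero]
  rw [e0] at hc
  obtain ⟨δ, hδ, hd⟩ := Metric.tendsto_nhds_nhds.1 hc (ε / 2) (by positivity)
  refine ⟨δ, hδ, fun {t} ht htd => ?_⟩
  have ht0 : 0 < t := ht
  rw [Real.dist_eq, sub_zero, abs_of_pos ht0] at htd
  have e : t⁻¹ • duhamel V Φ u t - Φ u =
      t⁻¹ • ∫ s in 0..t, (V.orbit (Φ (shift s u)) (t - s) - Φ u) := by
    rw [intervalIntegral.integral_sub (intervalIntegrable_duhamel hV hΦ u _ _ _)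
      intervalIntegrable_const, intervalIntegral.integral_const, sub_zero,
      duhamel_of_nonneg u ht0.le, smul_sub t⁻¹ (∫ s in 0..t, V.orbit (Φ (shift s u)) (t - s)),
      smul_smul, inv_mul_cancel₀ ht0.ne', one_smul]
  have hb : ‖∫ s in 0..t, (V.orbit (Φ (shift s u)) (t - s) - Φ u)‖ ≤ ε / 2 * |t - 0| := by
    refine intervalIntegral.norm_integral_le_of_norm_le_const fun s hs => ?_
    rw [uIoc_of_le ht0.le] at hs
    have := hd (x := (t, s)) (by
      rw [Prod.dist_eq, Real.dist_eq, Real.dist_eq, sub_zero, sub_zero, abs_of_pos ht0,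
        abs_of_pos hs.1]
      exact max_lt htd (hs.2.trans_lt htd))
    rw [dist_eq_norm] at this
    exact this.le
  rw [sub_zero, abs_of_pos ht0] at hb
  rw [dist_eq_norm, e, norm_smul, norm_inv, Real.norm_of_nonneg ht0.le]
  calc _ ≤ t⁻¹ * (ε / 2 * t) := by gcongr
    _ = ε / 2 := by field_simp
    _ < ε := by linarith

include hV hΦ in
/-- A mild solution is differentiable at `0` exactly when its initial value is in the domain of
the generator of `V`. -/
theorem IsMildSolution.tendsto_iff {F u : C(ℝ, H)} (h : IsMildSolution V Φ F u) {w : H} :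
    Tendsto (fun t : ℝ => t⁻¹ • (u t - F 0)) (𝓝[>] 0) (𝓝 w) ↔ V.Gen (F 0) (w - Φ F) := by
  have hΦu : Φ u = Φ F := hΦ.congr fun σ hσ => h.1 σ hσ.2
  have hD := tendsto_inv_smul_duhamel hV hΦ u
  rw [hΦu] at hD
  have e : ∀ t ∈ Ioi (0 : ℝ), t⁻¹ • (u t - F 0) =
      t⁻¹ • (V.orbit (F 0) t - F 0) + t⁻¹ • duhamel V Φ u t := fun t ht => by
    rw [h.2 t (le_of_lt ht), ← smul_add]
    congr 1; abel
  rw [C0Semigroup.gen_iff_tendsto]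
  constructor
  · intro hT
    refine (hT.sub hD).congr' ?_
    filter_upwards [self_mem_nhdsWithin] with t ht
    rw [e t ht, add_sub_cancel_right]
  · intro hT
    have := hT.add hD
    rw [sub_add_cancel] at this
    refine this.congr' ?_
    filter_upwards [self_mem_nhdsWithin] with t ht
    rw [e t ht]

variable {p : ℝ≥0∞} [hp1 : Fact (1 ≤ p)] (hp : p ≠ ∞)

/-- For the history component the frozen orbit serves as reference. The two histories differ only on
`(-t, 0]`, by at most `(‖w‖ + 1) t` for small `t`, hence by `O(t^{1+1/p})` in norm, which disappears
in the difference quotient. -/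
theorem gen_delaySemigroup_of_gen {x w : H} {g : Hist H p}
    (hx : V.Gen x (w - Φ (prim x g))) :
    (delaySemigroup hV hΦ hp).Gen (toState H p 𝕜 (prim x g)) (w, g) := by
  set P := prim x g with hP
  set u := mildSolution hV hΦ P with hu
  have hsol : IsMildSolution V Φ P u := isMildSolution_mildSolution hV hΦ P
  have hP0 : P 0 = x := prim_zero x g
  have h1 : Tendsto (fun t : ℝ => t⁻¹ • (u t - x)) (𝓝[>] 0) (𝓝 w) := by
    have := (hsol.tendsto_iff hV hΦ (w := w)).2 (by rw [hP0]; exact hx)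
    rwa [hP0] at this
  have horb : ∀ t ∈ Ioi (0 : ℝ), (delaySemigroup hV hΦ hp).orbit (toState H p 𝕜 P) t =
      toState H p 𝕜 (shift t u) := fun t ht => by
    rw [C0Semigroup.orbit, delaySemigroup_toState, Real.coe_toNNReal _ (le_of_lt ht)]
  rw [C0Semigroup.gen_iff_tendsto]
  refine Tendsto.prodMk_nhds (mx := fun t : ℝ => t⁻¹ • ((delaySemigroup hV hΦ hp).orbit
    (toState H p 𝕜 P) t - toState H p 𝕜 P).1) (my := fun t : ℝ => t⁻¹ • ((delaySemigroup hV hΦ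
    hp).orbit (toState H p 𝕜 P) t - toState H p 𝕜 P).2) ?_ ?_
  · refine h1.congr' ?_
    filter_upwards [self_mem_nhdsWithin] with t ht
    rw [horb t ht, Prod.fst_sub, toState_fst, toState_fst, shift_apply, add_zero, hP0]
  · have h2 := (continuous_snd.tendsto _).comp
      (C0Semigroup.gen_iff_tendsto.1 (gen_frozen (𝕜 := 𝕜) hp x g))
    have h3 : Tendsto (fun t : ℝ => t⁻¹ • (toState H p 𝕜 (shift t u - shift t P)).2) (𝓝[>] 0)
        (𝓝 0) := by
      have hev : ∀ᶠ t in 𝓝[>] (0 : ℝ), ‖t⁻¹ • (u t - x)‖ < ‖w‖ + 1 :=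
        h1.norm.eventually (gt_mem_nhds (by linarith))
      obtain ⟨δ, hδ, hd⟩ := mem_nhdsGT_iff_exists_Ioo_subset.1 hev
      have hp0 : 0 < p.toReal := ENNReal.toReal_pos (zero_lt_one.trans_le hp1.out).ne' hp
      have hz : Tendsto (fun t : ℝ => (‖w‖ + 1) * t ^ (1 / p.toReal)) (𝓝[>] 0) (𝓝 0) := by
        have : ContinuousAt (fun t : ℝ => (‖w‖ + 1) * t ^ (1 / p.toReal)) 0 :=
          continuousAt_const.mul (Real.continuousAt_rpow_const _ _ (.inr (by positivity)))
        have h := this.tendsto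
        rw [Real.zero_rpow (by positivity), mul_zero] at h
        exact h.mono_left nhdsWithin_le_nhds
      rw [tendsto_zero_iff_norm_tendsto_zero]
      refine squeeze_zero' (Eventually.of_forall fun _ => norm_nonneg _) ?_ hz
      filter_upwards [Ioo_mem_nhdsGT hδ] with t ht
      have hub : ∀ r, 0 < r → r ≤ t → ‖u r - x‖ ≤ (‖w‖ + 1) * t := by
        intro r hr hrt
        have hrd : ‖r⁻¹ • (u r - x)‖ < ‖w‖ + 1 := hd (show r ∈ Ioo 0 δ from ⟨hr, hrt.trans_lt ht.2⟩)
        rw [norm_smul, norm_inv, Real.norm_of_nonneg hr.le, inv_mul_lt_iff₀ hr] at hrd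
        calc _ ≤ r * (‖w‖ + 1) := hrd.le
          _ ≤ t * (‖w‖ + 1) := by gcongr
          _ = _ := mul_comm _ _
      have hn := norm_hist_le_of_tail (f := (toState H p 𝕜 (shift t u - shift t P)).2) hp ht.1.le
        (R := (‖w‖ + 1) * t) (mul_nonneg (by positivity) ht.1.le) ?_ ?_
      · rw [norm_smul, norm_inv, Real.norm_of_nonneg ht.1.le]
        have h0 := ht.1
        calc _ ≤ t⁻¹ * ((‖w‖ + 1) * t * t ^ (1 / p.toReal)) := by gcongr
          _ = _ := by field_simp
      · filter_upwards [coeFn_toState_snd (p := p) (𝕜 := 𝕜) (shift t u - shift t P)] with σ hσ h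
        rw [hσ, ContinuousMap.sub_apply, shift_apply, shift_apply, hsol.1 _ h, sub_self]
      · filter_upwards [coeFn_toState_snd (p := p) (𝕜 := 𝕜) (shift t u - shift t P),
          ae_hist_of_forall (P := fun σ => σ ∈ Icc (-1 : ℝ) 0) fun _ h => h] with σ hσ hm h
        rw [hσ, ContinuousMap.sub_apply, shift_apply, shift_apply, hP, prim_of_nonneg _ _ h.le]
        exact hub _ h (by linarith [hm.2])
    have h4 := h3.add h2
    rw [zero_add] at h4
    refine h4.congr' ?_
    filter_upwards [self_mem_nhdsWithin] with t ht
    rw [horb t ht, Function.comp_apply, frozen_orbit_prim hp x g (le_of_lt ht), Prod.smul_snd,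
      ← smul_add, ← Prod.snd_add, map_sub]
    congr 2
    abel

/-- The derivative of the orbit is tested against the continuous functional `∫_a^0` on histories.
Since the history is translated, the same quotient equals the mean of the head over `[0, t]` minus
the mean of `z.2` over `[a, a+t]`, which converges at almost every `a` by Lebesgue differentiation.
-/
theorem fst_eq_integral_of_gen {z w : State H p} (h : (delaySemigroup hV hΦ hp).Gen z w) :
    ∀ᵐ a ∂histMeasure, ∫ s in a..0, w.2 s = z.1 - z.2 a := by
  set T := delaySemigroup (p := p) hV hΦ hp with hT
  have h0 : (0 : ℝ) ∈ Icc (-1 : ℝ) 0 := ⟨by norm_num, le_rfl⟩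
  have hm1 : (-1 : ℝ) ∈ Icc (-1 : ℝ) 0 := ⟨le_rfl, by norm_num⟩
  have hii : ∀ (f : Hist H p) {a b : ℝ}, a ∈ Icc (-1 : ℝ) 0 → b ∈ Icc (-1 : ℝ) 0 →
      IntervalIntegrable f volume a b := fun f a b ha hb =>
    intervalIntegrable_of_memLp_hist (Lp.memLp f) ha hb
  have hleb := (hii z.2 hm1 h0).ae_hasDerivAt_integral
  have hne : ∀ᵐ a : ℝ, a ≠ 0 := by simp [ae_iff, measure_singleton]
  rw [ae_hist_iff]
  filter_upwards [hleb, hne] with a hda ha0 ham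
  have hneg : a < 0 := lt_of_le_of_ne ham.2 ha0
  have hder := hda (by rwa [uIcc_of_le (by norm_num)]) a (by rwa [uIcc_of_le (by norm_num)])
  set y := fun r => (T.orbit z r).1 with hy
  have hyc : Continuous y :=
    continuous_fst.comp (continuous_orbit_delaySemigroup hV hΦ hp z)
  have hy0 : y 0 = z.1 := by simp [hy, C0Semigroup.orbit_zero]
  have hdy : HasDerivAt (fun t => ∫ r in 0..t, y r) (y 0) 0 :=
    intervalIntegral.integral_hasDerivAt_right (hyc.intervalIntegrable _ _)
      (hyc.stronglyMeasurableAtFilter _ _) hyc.continuousAt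
  -- the difference quotients of the integral over `[a,0]`, computed in two ways
  have hL : Tendsto (fun t : ℝ => ∫ s in a..0, (t⁻¹ • (T.orbit z t - z)).2 s) (𝓝[>] 0)
      (𝓝 (∫ s in a..0, w.2 s)) := by
    rw [tendsto_iff_norm_sub_tendsto_zero]
    refine squeeze_zero (fun _ => norm_nonneg _) (fun t => ?_)
      (tendsto_iff_norm_sub_tendsto_zero.1 (C0Semigroup.gen_iff_tendsto.1 h))
    rw [← intervalIntegral.integral_sub (hii _ ham h0) (hii _ ham h0)]
    have e : ∫ s in a..0, ((t⁻¹ • (T.orbit z t - z)).2 s - w.2 s) =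
        ∫ s in a..0, ((t⁻¹ • (T.orbit z t - z) - w).2 : Hist H p) s := by
      refine intervalIntegral.integral_congr_ae ?_
      filter_upwards [ae_hist_iff.1 (Lp.coeFn_sub (t⁻¹ • (T.orbit z t - z)).2 w.2)] with s hs hm
      rw [uIoc_of_le ham.2] at hm
      rw [Prod.snd_sub, hs ⟨ham.1.trans hm.1.le, hm.2⟩, Pi.sub_apply]
    rw [e]
    exact (norm_integral_hist_le _ ham h0).trans (norm_snd_le _)
  have hR : Tendsto (fun t : ℝ => t⁻¹ • ((∫ r in 0..t, y r) - 0) -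
      t⁻¹ • ((∫ r in a..a + t, z.2 r) - 0)) (𝓝[>] 0) (𝓝 (z.1 - z.2 a)) := by
    have h1 := hdy.tendsto_slope_zero_right
    have h2 := hder.tendsto_slope_zero_right
    simp only [zero_add, intervalIntegral.integral_same] at h1 h2
    rw [hy0] at h1
    exact h1.sub h2
  refine tendsto_nhds_unique hL (hR.congr' ?_)
  filter_upwards [Ioo_mem_nhdsGT (neg_pos.2 hneg)] with t ht
  have ht0 : 0 < t := ht.1
  have hta : t < -a := ht.2
  have hat : a + t ∈ Icc (-1 : ℝ) 0 := ⟨by linarith [ham.1], by linarith⟩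
  have hmt : -t ∈ Icc (-1 : ℝ) 0 := ⟨by linarith [ham.1], by linarith⟩
  have hae := delaySemigroup_snd_ae_eq hV hΦ hp z t.toNNReal
  rw [Real.coe_toNNReal _ ht0.le] at hae
  have hgi : ∀ {a b : ℝ}, a ∈ Icc (-1 : ℝ) 0 → b ∈ Icc (-1 : ℝ) 0 →
      IntervalIntegrable (glue z.2 y t) volume a b := fun ha hb =>
    intervalIntegrable_of_memLp_hist
      ((memLp_congr_ae hae).1 (Lp.memLp ((T.op t.toNNReal z).2 : Hist H p))) ha hb
  have e1 : ∫ s in a..0, (t⁻¹ • (T.orbit z t - z)).2 s =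
      t⁻¹ • ∫ s in a..0, (glue z.2 y t s - z.2 s) := by
    rw [← intervalIntegral.integral_smul]
    refine intervalIntegral.integral_congr_ae ?_
    filter_upwards [ae_hist_iff.1 hae, ae_hist_iff.1 (Lp.coeFn_sub (T.orbit z t).2 z.2),
      ae_hist_iff.1 (Lp.coeFn_smul t⁻¹ ((T.orbit z t).2 - z.2))] with s hs1 hs2 hs3 hm
    rw [uIoc_of_le ham.2] at hm
    have hm' : s ∈ Icc (-1 : ℝ) 0 := ⟨ham.1.trans hm.1.le, hm.2⟩
    rw [Prod.smul_snd, Prod.snd_sub, hs3 hm', Pi.smul_apply, hs2 hm', Pi.sub_apply, ← hs1 hm']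
    rfl
  have e2 : ∫ s in a..-t, glue z.2 y t s = ∫ r in a + t..0, z.2 r := by
    have := intervalIntegral.integral_comp_add_left (a := a) (b := -t) (fun r => z.2 r) t
    rw [add_neg_cancel, add_comm t a] at this
    rw [← this]
    refine intervalIntegral.integral_congr fun s hs => ?_
    rw [uIcc_of_le (by linarith)] at hs
    exact if_pos (by linarith [hs.2])
  have e3 : ∫ s in -t..0, glue z.2 y t s = ∫ r in 0..t, y r := by
    have := intervalIntegral.integral_comp_add_left (a := -t) (b := 0) y t
    rw [add_neg_cancel, add_zero] at this
    rw [← this]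
    refine intervalIntegral.integral_congr_ae (Eventually.of_forall fun s hs => ?_)
    rw [uIoc_of_le (by linarith)] at hs
    exact if_neg (by linarith [hs.1])
  have e4 := intervalIntegral.integral_add_adjacent_intervals (hii z.2 ham hat) (hii z.2 hat h0)
  rw [e1, intervalIntegral.integral_sub (hgi ham h0) (hii z.2 ham h0),
    ← intervalIntegral.integral_add_adjacent_intervals (hgi ham hmt) (hgi hmt h0), e2, e3, ← e4,
    sub_zero, sub_zero, ← smul_sub t⁻¹ (∫ r in 0..t, y r)]
  congr 1
  abel

theorem eq_toState_of_gen {z w : State H p} (h : (delaySemigroup hV hΦ hp).Gen z w) :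
    z = toState H p 𝕜 (prim z.1 w.2) := by
  refine Prod.ext (prim_zero _ _).symm (Lp.ext ?_)
  filter_upwards [fst_eq_integral_of_gen hV hΦ hp h,
    coeFn_toState_snd (p := p) (𝕜 := 𝕜) (prim z.1 w.2),
    ae_hist_of_forall (P := fun σ => σ ∈ Icc (-1 : ℝ) 0) fun _ h => h] with a h1 h2 h3
  rw [h2, prim_of_mem _ _ h3, intervalIntegral.integral_symm, h1]
  abel

theorem gen_delaySemigroup_iff {z w : State H p} :
    (delaySemigroup hV hΦ hp).Gen z w ↔ z = toState H p 𝕜 (prim z.1 w.2) ∧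
      V.Gen z.1 (w.1 - Φ (prim z.1 w.2)) := by
  constructor
  · intro h
    have hz := eq_toState_of_gen hV hΦ hp h
    refine ⟨hz, ?_⟩
    set P := prim z.1 w.2 with hP
    have hsol := isMildSolution_mildSolution hV hΦ P
    have hP0 : P 0 = z.1 := prim_zero _ _
    rw [← hP0]
    refine (hsol.tendsto_iff hV hΦ).1 ?_
    have h1 := (continuous_fst.tendsto _).comp (C0Semigroup.gen_iff_tendsto.1 h)
    refine h1.congr' ?_
    filter_upwards [self_mem_nhdsWithin] with t ht
    rw [Function.comp_apply, Prod.smul_fst, Prod.fst_sub, hP0]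
    congr 2
    conv_lhs => rw [hz]
    exact orbit_toState_fst hV hΦ hp P (le_of_lt ht)
  · rintro ⟨hz, hx⟩
    rw [hz]
    exact gen_delaySemigroup_of_gen hV hΦ hp hx

theorem hasGenerator_delaySemigroup {B : H →ₗ.[𝕜] H} (hB : V.HasGenerator (B.graph : Set (H × H)))
    {η : ℝ → H →L[𝕜] H} (hη : BoundedVariationOn η (Icc (-1) 0)) :
    (delaySemigroup hV (isDelayFunctional_delayLin hη) hp).HasGenerator (graphG p B η) :=
  C0Semigroup.hasGenerator_of_forall fun z w => by
    rw [mem_graphG_iff, gen_delaySemigroup_iff, delayLin_apply, ← hB.mem_iff, SetLike.mem_coe]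

end Generator

/-! ### Local and global error of the splitting -/

section Splitting

variable {𝕜 : Type*} [RCLike 𝕜] {H : Type*} [NormedAddCommGroup H] [NormedSpace 𝕜 H]

/-- The semigroup acting by `V` on the first component of the state and trivially on the second. -/
noncomputable def fstSemigroup (V : C0Semigroup 𝕜 H) (p : ℝ≥0∞) [Fact (1 ≤ p)] :
    C0Semigroup 𝕜 (State H p) where
  op t := (V.op t).prodMap (ContinuousLinearMap.id 𝕜 (Hist H p))
  op_zero := by
    refine ContinuousLinearMap.ext fun z => ?_
    simp [V.op_zero]
  op_add s t := by
    refine ContinuousLinearMap.ext fun z => ?_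
    exact Prod.ext (V.op_add_apply s t z.1) rfl
  tendsto_zero z := (V.tendsto_zero z.1).prodMk_nhds tendsto_const_nhds

variable {p : ℝ≥0∞} [hp1 : Fact (1 ≤ p)]

theorem fstSemigroup_apply (V : C0Semigroup 𝕜 H) (t : ℝ≥0) (z : State H p) :
    (fstSemigroup V p).op t z = (V.op t z.1, z.2) := rfl

variable [NormedSpace ℝ H] [IsScalarTower ℝ 𝕜 H]

theorem C0Semigroup.Gen.add {V : C0Semigroup 𝕜 H} {x y x' y' : H} (h : V.Gen x y)
    (h' : V.Gen x' y') : V.Gen (x + x') (y + y') := by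
  have e : V.orbit (x + x') = V.orbit x + V.orbit x' := by
    funext t; exact map_add _ _ _
  rw [C0Semigroup.Gen, e]
  exact HasDerivWithinAt.add h h'

theorem C0Semigroup.Gen.smul {V : C0Semigroup 𝕜 H} {x y : H} (h : V.Gen x y) (c : 𝕜) :
    V.Gen (c • x) (c • y) := by
  have : SMulCommClass ℝ 𝕜 H := IsScalarTower.to_smulCommClass
  have e : V.orbit (c • x) = c • V.orbit x := by
    funext t; exact map_smul _ _ _
  rw [C0Semigroup.Gen, e]
  exact HasDerivWithinAt.const_smul c h

theorem gen_fstSemigroup_iff {V : C0Semigroup 𝕜 H} {z w : State H p} :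
    (fstSemigroup V p).Gen z w ↔ V.Gen z.1 w.1 ∧ w.2 = 0 := by
  have h0 : ∀ f : Hist H p, HasDerivWithinAt (fun _ : ℝ => f) 0 (Ici 0) 0 :=
    fun f => hasDerivWithinAt_const (0 : ℝ) _ f
  constructor
  · intro h
    have h1 : HasDerivWithinAt (fun t => ((fstSemigroup V p).orbit z t).1) w.1 (Ici 0) 0 :=
      ((ContinuousLinearMap.fst ℝ H (Hist H p)).hasFDerivAt.comp_hasDerivWithinAt (0 : ℝ) h)
    have h2 : HasDerivWithinAt (fun t => ((fstSemigroup V p).orbit z t).2) w.2 (Ici 0) 0 :=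
      (ContinuousLinearMap.snd ℝ H (Hist H p)).hasFDerivAt.comp_hasDerivWithinAt
        (f := (fstSemigroup V p).orbit z) (0 : ℝ) h
    exact ⟨h1, (uniqueDiffWithinAt_Ici (0 : ℝ)).eq_deriv _ h2 (h0 z.2)⟩
  · rintro ⟨h1, h2⟩
    have := HasDerivWithinAt.prodMk h1 (h0 z.2)
    rw [← h2] at this
    exact this

theorem hasGenerator_fstSemigroup {V : C0Semigroup 𝕜 H} {B : H →ₗ.[𝕜] H}
    (hB : V.HasGenerator (B.graph : Set (H × H))) :
    (fstSemigroup V p).HasGenerator (graphA₁ p B) :=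
  C0Semigroup.hasGenerator_of_forall fun z w => by
    rw [gen_fstSemigroup_iff, ← hB.mem_iff, SetLike.mem_coe]
    constructor
    · rintro ⟨x, f, hq⟩
      obtain ⟨rfl, rfl⟩ := Prod.ext_iff.1 hq
      exact ⟨LinearPMap.mem_graph _ _, rfl⟩
    · rintro ⟨h1, h2⟩
      obtain ⟨x, hx, hBx⟩ := (LinearPMap.mem_graph_iff _).1 h1
      exact ⟨x, z.2, Prod.ext (Prod.ext hx.symm rfl) (Prod.ext hBx.symm h2)⟩

/-- Continuous functions equal almost everywhere on an interval agree on it, so `Φ` of a solution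
segment can be computed from its Sobolev representative. -/
theorem toState_injective {F G : C(ℝ, H)} (h : toState H p 𝕜 F = toState H p 𝕜 G) :
    EqOn F G (Icc (-1) 0) := by
  have hae : (F : ℝ → H) =ᵐ[volume.restrict (Icc (-1) 0)] G := by
    have h1 := coeFn_toState_snd (p := p) (𝕜 := 𝕜) F
    rw [h] at h1
    exact h1.symm.trans (coeFn_toState_snd G)
  exact Measure.eqOn_Icc_of_ae_eq volume (by norm_num) hae F.continuous.continuousOn
    G.continuous.continuousOn

variable [CompleteSpace H]
  {V : C0Semigroup 𝕜 H} (hV : ∀ t, ‖V.op t‖ ≤ 1) {Φ : C(ℝ, H) →ₗ[𝕜] H} {K : ℝ}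
  (hΦ : IsDelayFunctional Φ K)

include hΦ in
theorem norm_delay_prim_le (x : H) (g : Hist H p) : ‖Φ (prim x g)‖ ≤ K * (‖x‖ + ‖g‖) :=
  hΦ.norm_le _ _ fun _ hσ => norm_prim_le x g hσ

include hV hΦ in
/-- By the closed graph theorem, the generator of `V` composed with `Φ` is bounded on
`W^{1,p}`. -/
theorem exists_bound_generator_delay
    (hdom : ∀ (x : H) (g : Hist H p), ∃ y, V.Gen (Φ (prim x g)) y) :
    ∃ L : ℝ, 0 ≤ L ∧ ∀ (x : H) (g : Hist H p) (y : H), V.Gen (Φ (prim x g)) y →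
      ‖y‖ ≤ L * (‖x‖ + ‖g‖) := by
  choose Ψ hΨ using hdom
  let Λ : State H p →ₗ[𝕜] H :=
    { toFun := fun q => Ψ q.1 q.2
      map_add' := fun q r => by
        have e : Φ (prim (q + r).1 (q + r).2) = Φ (prim q.1 q.2) + Φ (prim r.1 r.2) := by
          rw [← map_add]
          exact hΦ.congr fun σ hσ => prim_add_apply _ _ _ _ hσ
        have h := hΨ (q + r).1 (q + r).2
        rw [e] at h
        exact h.unique ((hΨ _ _).add (hΨ _ _))
      map_smul' := fun c q => by
        have e : Φ (prim (c • q).1 (c • q).2) = c • Φ (prim q.1 q.2) := by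
          rw [← map_smul]
          exact hΦ.congr fun σ hσ => prim_smul_apply _ _ _ hσ
        have h := hΨ (c • q).1 (c • q).2
        rw [e] at h
        exact h.unique ((hΨ _ _).smul c) }
  -- The graph is closed because `Φ` of the primitive depends continuously on head and derivative,
  -- and the generator of `V` is closed.
  have hΛ : Continuous Λ := by
    refine LinearMap.continuous_of_seq_closed_graph _ fun q x y hq hy => ?_
    have hlim : Tendsto (fun n => Φ (prim (q n).1 (q n).2)) atTop (𝓝 (Φ (prim x.1 x.2))) := by
      rw [tendsto_iff_norm_sub_tendsto_zero] at hq ⊢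
      refine squeeze_zero (fun _ => norm_nonneg _) (fun n => ?_)
        (g := fun n => K * (‖q n - x‖ + ‖q n - x‖)) (by simpa using (hq.add hq).const_mul K)
      have e : Φ (prim (q n).1 (q n).2) - Φ (prim x.1 x.2) =
          Φ (prim ((q n).1 - x.1) ((q n).2 - x.2)) := by
        rw [← map_sub]
        exact hΦ.congr fun σ hσ => (prim_sub_apply _ _ _ _ hσ).symm
      rw [e]
      refine (norm_delay_prim_le hΦ _ _).trans ?_
      have hK := hΦ.pos
      gcongr
      · exact norm_fst_le (q n - x)
      · exact norm_snd_le (q n - x)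
    exact (C0Semigroup.gen_of_tendsto zero_lt_one (fun s _ => hV s)
      (fun n => hΨ (q n).1 (q n).2) hlim hy).unique (hΨ x.1 x.2)
  let Λc : State H p →L[𝕜] H := ⟨Λ, hΛ⟩
  refine ⟨‖Λc‖, norm_nonneg _, fun x g y hy => ?_⟩
  have e : y = Λc (x, g) := hy.unique (hΨ x g)
  rw [e]
  refine (Λc.le_opNorm _).trans ?_
  gcongr
  exact norm_prod_le_iff.2 ⟨le_add_of_nonneg_right (norm_nonneg _),
    le_add_of_nonneg_left (norm_nonneg _)⟩

variable (hp : p ≠ ∞)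

variable (p) in
/-- The semigroup of the pure delay equation `u' = Φ u_t`. -/
noncomputable def pureDelaySemigroup : C0Semigroup 𝕜 (State H p) :=
  delaySemigroup (V := idSemigroup 𝕜 H) norm_idSemigroup_le hΦ hp

theorem gen_pureDelaySemigroup (x : H) (g : Hist H p) :
    (pureDelaySemigroup p hΦ hp).Gen (toState H p 𝕜 (prim x g)) (Φ (prim x g), g) :=
  gen_delaySemigroup_of_gen norm_idSemigroup_le hΦ hp (by
    rw [sub_self]
    exact hasDerivWithinAt_const (0 : ℝ) _ x)

/-- For the pure delay equation `y h = P 0 + ∫ Φ y_s`. After applying `V(h) = V(h-s) V(s)` under the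
integral, the terms `V(h) (P 0)` cancel. -/
theorem splitting_fst_sub_eq_integral (P : C(ℝ, H)) {h : ℝ} (hh : 0 ≤ h) :
    V.orbit (mildSolution norm_idSemigroup_le hΦ P h) h - mildSolution hV hΦ P h =
      ∫ s in 0..h, V.op (h - s).toNNReal
        (V.orbit (Φ (shift s (mildSolution norm_idSemigroup_le hΦ P))) s -
          Φ (shift s (mildSolution hV hΦ P))) := by
  set y := mildSolution norm_idSemigroup_le hΦ P with hy
  set u := mildSolution hV hΦ P with hu
  have hyS := isMildSolution_mildSolution norm_idSemigroup_le hΦ P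
  have huS := isMildSolution_mildSolution hV hΦ P
  have hi : IntervalIntegrable (fun s => Φ (shift s y)) volume 0 h :=
    (hΦ.continuous_shift y).intervalIntegrable _ _
  have h1 : V.orbit (y h) h = V.orbit (P 0) h + ∫ s in 0..h, V.orbit (Φ (shift s y)) h := by
    rw [hyS.2 h hh, duhamel_of_nonneg _ hh]
    simp only [orbit_idSemigroup]
    simp only [C0Semigroup.orbit]
    rw [map_add, ContinuousLinearMap.intervalIntegral_comp_comm _ hi]
  have hi' : IntervalIntegrable (fun s => V.orbit (Φ (shift s y)) h) volume 0 h :=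
    ((V.op h.toNNReal).continuous.comp (hΦ.continuous_shift y)).intervalIntegrable _ _
  rw [h1, huS.2 h hh, duhamel_of_nonneg _ hh, add_sub_add_left_eq_sub,
    ← intervalIntegral.integral_sub hi' (intervalIntegrable_duhamel hV hΦ u _ _ _)]
  refine intervalIntegral.integral_congr fun s hs => ?_
  rw [uIcc_of_le hh] at hs
  rw [map_sub, ← V.orbit_add _ (sub_nonneg.2 hs.2) hs.1, sub_add_cancel]
  rfl

/-- The local error of the sequential splitting, component by component. -/
theorem exists_local_error (hdom : ∀ (x : H) (g : Hist H p), ∃ y, V.Gen (Φ (prim x g)) y)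
    (τ : ℝ) :
    ∃ C : ℝ, 0 ≤ C ∧ ∀ z w : State H p, (delaySemigroup hV hΦ hp).Gen z w →
      ∀ h : ℝ≥0, (h : ℝ) ≤ τ → ∀ d : State H p,
        d = (fstSemigroup V p).op h ((pureDelaySemigroup p hΦ hp).op h z) -
          (delaySemigroup hV hΦ hp).op h z →
        ‖d.1‖ ≤ C * (h : ℝ) ^ 2 * (‖z‖ + ‖w‖) ∧
        (∀ᵐ σ ∂histMeasure, (h : ℝ) + σ ≤ 0 → d.2 σ = 0) ∧
        (∀ᵐ σ ∂histMeasure, 0 < (h : ℝ) + σ → ‖d.2 σ‖ ≤ C * h * (‖z‖ + ‖w‖)) := by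
  obtain ⟨L, hL0, hL⟩ := exists_bound_generator_delay hV hΦ hdom
  have hK := hΦ.pos
  have hK1 := hΦ.one_le
  set M := growth K τ with hM
  have hM1 : 1 ≤ M := one_le_growth hK.le _
  -- The first summand comes from the bound `L` for `B Φ`, the second from `Φ (y_s - u_s)`; as `1 ≤
  -- K`, the sum also dominates the Lipschitz bound `M + M * K` used for the histories.
  set C₀ := L * (M + M * K) + K * (M + M * K) with hC₀
  have hC₀M : M + M * K ≤ C₀ := by
    rw [hC₀]
    have h1 : 0 ≤ L * (M + M * K) := by positivity
    have h2 : 0 ≤ M + M * K := by positivity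
    nlinarith
  refine ⟨C₀, by positivity, fun z w hzw h hh d hd => ?_⟩
  set T := delaySemigroup (p := p) hV hΦ hp with hT
  set T₂ := pureDelaySemigroup p hΦ hp with hT₂
  set N := ‖z‖ + ‖w‖ with hN
  have hN0 : 0 ≤ N := by positivity
  have hzN : ‖z‖ ≤ N := le_add_of_nonneg_right (norm_nonneg _)
  have hwN : ‖w‖ ≤ N := le_add_of_nonneg_left (norm_nonneg _)
  set P := prim z.1 w.2 with hP
  have hz : z = toState H p 𝕜 P := eq_toState_of_gen hV hΦ hp hzw
  have hP0 : P 0 = z.1 := prim_zero _ _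
  set y := mildSolution norm_idSemigroup_le hΦ P with hy
  set u := mildSolution hV hΦ P with hu
  have hyS := isMildSolution_mildSolution norm_idSemigroup_le hΦ P
  have huS := isMildSolution_mildSolution hV hΦ P
  have hΦP : ‖Φ P‖ ≤ K * N := by
    refine (norm_delay_prim_le hΦ _ _).trans ?_
    exact mul_le_mul_of_nonneg_left (add_le_add (norm_fst_le z) (norm_snd_le w)) hK.le
  have hgen₂ : T₂.Gen z (Φ P, w.2) := by
    have := gen_pureDelaySemigroup hΦ hp z.1 w.2
    rwa [← hP, ← hz] at this
  have hw₂ : ‖((Φ P, w.2) : State H p)‖ ≤ K * N := by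
    refine norm_prod_le_iff.2 ⟨hΦP, ((norm_snd_le w).trans hwN).trans ?_⟩
    exact le_mul_of_one_le_left hN0 hK1
  have hbT : ∀ s : ℝ≥0, (s : ℝ) ≤ τ → ‖T.op s‖ ≤ M := fun s hs =>
    norm_delaySemigroup_le hV hΦ hp hs
  have hbT₂ : ∀ s : ℝ≥0, (s : ℝ) ≤ τ → ‖T₂.op s‖ ≤ M := fun s hs =>
    norm_delaySemigroup_le norm_idSemigroup_le hΦ hp hs
  have hu_orb : ∀ r, 0 ≤ r → (T.orbit z r).1 = u r := fun r hr => by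
    rw [hz]; exact orbit_toState_fst hV hΦ hp P hr
  have hy_orb : ∀ r, 0 ≤ r → (T₂.orbit z r).1 = y r := fun r hr => by
    rw [hz]; exact orbit_toState_fst norm_idSemigroup_le hΦ hp P hr
  have hu_sub : ∀ r, 0 ≤ r → r ≤ τ → ‖u r - z.1‖ ≤ M * N * r := by
    intro r hr hrτ
    rw [← hu_orb r hr, ← Prod.fst_sub]
    refine (norm_fst_le _).trans ((hzw.norm_sub_le hr fun s hs => hbT s (hs.trans hrτ)).trans ?_)
    gcongr
  have hy_sub : ∀ r, 0 ≤ r → r ≤ τ → ‖y r - z.1‖ ≤ M * (K * N) * r := by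
    intro r hr hrτ
    rw [← hy_orb r hr, ← Prod.fst_sub]
    refine (norm_fst_le _).trans ((hgen₂.norm_sub_le hr fun s hs => hbT₂ s (hs.trans hrτ)).trans ?_)
    gcongr
  -- Both solutions have the same past and leave the same head `z.1` at bounded speed.
  have hyu : ∀ r s : ℝ, r ≤ s → 0 ≤ s → s ≤ τ → ‖y r - u r‖ ≤ (M + M * K) * s * N := by
    intro r s hrs hs0 hsτ
    rcases le_total r 0 with hr | hr
    · rw [hyS.1 r hr, huS.1 r hr, sub_self, norm_zero]; positivity
    · have e : y r - u r = (y r - z.1) - (u r - z.1) := by abel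
      rw [e]
      refine (norm_sub_le _ _).trans ?_
      have h1 := hy_sub r hr (hrs.trans hsτ)
      have h2 := hu_sub r hr (hrs.trans hsτ)
      calc _ ≤ M * (K * N) * r + M * N * r := add_le_add h1 h2
        _ ≤ M * (K * N) * s + M * N * s := by gcongr
        _ = _ := by ring
  -- The domain of the generator is invariant under `T₂`, so the state at time `s` is again a
  -- primitive, with head and derivative bounded by `M * N` and `M * (K * N)`. Thus `B Φ y_s` is
  -- bounded and `V(s)` moves `Φ y_s` by `O(s)`.
  have hΦy : ∀ s, 0 ≤ s → s ≤ τ → ‖V.orbit (Φ (shift s y)) s - Φ (shift s y)‖ ≤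
      L * (M + M * K) * N * s := by
    intro s hs hsτ
    set x' := (T₂.orbit z s).1 with hx'
    set g' := (T₂.orbit (Φ P, w.2) s).2 with hg'
    have h1 : T₂.Gen (T₂.orbit z s) (T₂.orbit (Φ P, w.2) s) := hgen₂.op s.toNNReal
    have h2 := eq_toState_of_gen norm_idSemigroup_le hΦ hp h1
    have h3 : T₂.orbit z s = toState H p 𝕜 (shift s y) := by
      conv_lhs => rw [hz]
      rw [C0Semigroup.orbit, hT₂, pureDelaySemigroup, delaySemigroup_toState,
        Real.coe_toNNReal _ hs]
    have h4 : Φ (shift s y) = Φ (prim x' g') := hΦ.congr (toState_injective (h3.symm.trans h2))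
    obtain ⟨b, hb⟩ := hdom x' g'
    have h5 := hL x' g' b hb
    rw [← h4] at hb
    have h6 := hb.norm_sub_le (M := 1) hs fun r _ => hV r
    have h7 : ‖x'‖ ≤ M * N := (norm_fst_le _).trans
      ((norm_orbit_delaySemigroup_le norm_idSemigroup_le hΦ hp hs hsτ z).trans (by gcongr))
    have h8 : ‖g'‖ ≤ M * (K * N) := (norm_snd_le _).trans
      ((norm_orbit_delaySemigroup_le norm_idSemigroup_le hΦ hp hs hsτ _).trans (by gcongr))
    calc _ ≤ 1 * ‖b‖ * s := h6
      _ ≤ 1 * (L * (M * N + M * (K * N))) * s := by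
          gcongr
          exact h5.trans (by gcongr)
      _ = _ := by ring
  have hT₁T₂ : (fstSemigroup V p).op h (T₂.op h z) = (V.op h (y h), (toState H p 𝕜 (shift h y)).2) := by
    rw [fstSemigroup_apply]
    have : T₂.op h z = toState H p 𝕜 (shift h y) := by
      conv_lhs => rw [hz]
      exact delaySemigroup_toState norm_idSemigroup_le hΦ hp h P
    rw [this, toState_fst, shift_apply, add_zero]
  have hTh : T.op h z = toState H p 𝕜 (shift h u) := by
    conv_lhs => rw [hz]
    exact delaySemigroup_toState hV hΦ hp h P
  have hd2 : d.2 = (toState H p 𝕜 (shift h y - shift h u)).2 := by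
    rw [hd, hT₁T₂, hTh, map_sub]; rfl
  have hd1 : d.1 = V.orbit (y h) h - u h := by
    rw [hd, hT₁T₂, hTh, Prod.fst_sub, toState_fst, shift_apply, add_zero, V.orbit_coe]
  have hh0 : (0 : ℝ) ≤ h := h.coe_nonneg
  refine ⟨?_, ?_, ?_⟩
  · rw [hd1, splitting_fst_sub_eq_integral hV hΦ P hh0]
    have hb := intervalIntegral.norm_integral_le_of_norm_le_const (a := 0) (b := (h : ℝ))
      (C := C₀ * h * N) (f := fun s => V.op (h - s).toNNReal (V.orbit (Φ (shift s y)) s -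
          Φ (shift s u))) (fun s hs => by
        rw [uIoc_of_le hh0] at hs
        have hsτ := hs.2.trans hh
        refine (V.norm_op_le hV _ _).trans ?_
        have e : V.orbit (Φ (shift s y)) s - Φ (shift s u) =
          (V.orbit (Φ (shift s y)) s - Φ (shift s y)) + Φ (shift s y - shift s u) := by
          rw [map_sub]; abel
        rw [e]
        have h1 := hΦy s hs.1.le hsτ
        have h2 := hΦ.norm_le (shift s y - shift s u) ((M + M * K) * s * N) fun σ hσ => by
          rw [ContinuousMap.sub_apply, shift_apply, shift_apply]
          exact hyu _ _ (by linarith [hσ.2]) hs.1.le hsτ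
        calc _ ≤ L * (M + M * K) * N * s + K * ((M + M * K) * s * N) :=
              (norm_add_le _ _).trans (add_le_add h1 h2)
          _ = C₀ * s * N := by rw [hC₀]; ring
          _ ≤ C₀ * h * N := by gcongr; exact hs.2)
    rw [sub_zero, abs_of_nonneg hh0] at hb
    calc _ ≤ C₀ * h * N * h := hb
      _ = _ := by ring
  · rw [hd2]
    filter_upwards [coeFn_toState_snd (p := p) (𝕜 := 𝕜) (shift h y - shift h u)] with σ hσ hle
    rw [hσ, ContinuousMap.sub_apply, shift_apply, shift_apply, hyS.1 _ hle, huS.1 _ hle, sub_self]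
  · rw [hd2]
    filter_upwards [coeFn_toState_snd (p := p) (𝕜 := 𝕜) (shift h y - shift h u),
      ae_hist_of_forall (P := fun σ => σ ∈ Icc (-1 : ℝ) 0) fun _ h => h] with σ hσ hm _
    rw [hσ, ContinuousMap.sub_apply, shift_apply, shift_apply]
    refine (hyu _ h (by linarith [hm.2]) hh0 hh).trans ?_
    gcongr

include hV in
/-- One step of the splitting, in terms of bounds for the two components. -/
theorem splitting_step_bound {e : State H p} {h : ℝ≥0} {τ a r : ℝ} (hh : (h : ℝ) ≤ τ)
    (h1 : ‖e.1‖ ≤ a) (har : a ≤ r) (h2 : ∀ᵐ σ ∂histMeasure, ‖e.2 σ‖ ≤ r) :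
    ‖((fstSemigroup V p).op h ((pureDelaySemigroup p hΦ hp).op h e)).1‖ ≤
        a + K * growth K τ * h * r ∧
      ∀ᵐ σ ∂histMeasure,
        ((h : ℝ) + σ ≤ 0 → ‖((fstSemigroup V p).op h ((pureDelaySemigroup p hΦ hp).op h e)).2 σ‖ ≤ r) ∧
        (0 < (h : ℝ) + σ → ‖((fstSemigroup V p).op h ((pureDelaySemigroup p hΦ hp).op h e)).2 σ‖ ≤
          a + K * growth K τ * h * r) := by
  set T₂ := pureDelaySemigroup p hΦ hp with hT₂
  have hK := hΦ.pos
  set M := growth K τ with hM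
  have hM1 : 1 ≤ M := one_le_growth hK.le _
  have hr0 : 0 ≤ r := (norm_nonneg _).trans (h1.trans har)
  have he : ‖e‖ ≤ r := norm_prod_le_iff.2 ⟨h1.trans har, norm_hist_le_of_ae_bound hr0 h2⟩
  have hb : ∀ s, 0 ≤ s → s ≤ (h : ℝ) → ‖(T₂.orbit e s).1‖ ≤ M * r := fun s hs hsh =>
    (norm_fst_le _).trans ((norm_orbit_delaySemigroup_le norm_idSemigroup_le hΦ hp hs
      (hsh.trans hh) e).trans (by gcongr))
  have hrM : r ≤ M * r := le_mul_of_one_le_left hr0 hM1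
  -- The crude growth bound `M * r` is fed into the short-time estimate. The point is the
  -- coefficient `1` in front of `a`: the factor `M` appears only multiplied by `h`.
  have hy : ∀ s, 0 ≤ s → s ≤ (h : ℝ) → ‖(T₂.orbit e s).1‖ ≤ a + K * M * h * r := by
    intro s hs hsh
    have h3 := norm_orbit_fst_sub_le norm_idSemigroup_le hΦ hp e hs (R := M * r)
      (h2.mono fun σ hσ => hσ.trans hrM) fun t ht hts => hb t ht (hts.trans hsh)
    rw [orbit_idSemigroup] at h3
    change ‖(T₂.orbit e s).1 - e.1‖ ≤ _ at h3
    have h4 := norm_le_norm_sub_add (T₂.orbit e s).1 e.1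
    have h5 : K * s * (M * r) ≤ K * M * h * r := by
      calc K * s * (M * r) ≤ K * h * (M * r) := by gcongr
        _ = _ := by ring
    exact h4.trans (by linarith [h3.trans h5])
  rw [fstSemigroup_apply]
  refine ⟨(V.norm_op_le hV _ _).trans ?_, ?_⟩
  · have := hy h h.coe_nonneg le_rfl
    rwa [T₂.orbit_coe] at this
  · filter_upwards [delaySemigroup_snd_ae_eq norm_idSemigroup_le hΦ hp e h,
      ae_hist_translate h2 h.coe_nonneg,
      ae_hist_of_forall (P := fun σ => σ ∈ Icc (-1 : ℝ) 0) fun _ h => h] with σ hσ h6 hm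
    constructor
    · intro hle
      have h7 : (T₂.op h e).2 σ = e.2 (h + σ) := hσ.trans (if_pos hle)
      change ‖(T₂.op h e).2 σ‖ ≤ r
      rw [h7]
      exact h6 hle
    · intro hlt
      have h7 : (T₂.op h e).2 σ = (T₂.orbit e (h + σ)).1 := hσ.trans (if_neg (not_le.2 hlt))
      change ‖(T₂.op h e).2 σ‖ ≤ _
      rw [h7]
      exact hy _ hlt.le (by linarith [hm.2])

/-- The global error of the sequential splitting on the domain of the generator. -/
theorem norm_splitting_pow_sub_le {C τ : ℝ} (hC : 0 ≤ C)
    (hloc : ∀ z w : State H p, (delaySemigroup hV hΦ hp).Gen z w →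
      ∀ h : ℝ≥0, (h : ℝ) ≤ τ → ∀ d : State H p,
        d = (fstSemigroup V p).op h ((pureDelaySemigroup p hΦ hp).op h z) -
          (delaySemigroup hV hΦ hp).op h z →
        ‖d.1‖ ≤ C * (h : ℝ) ^ 2 * (‖z‖ + ‖w‖) ∧
        (∀ᵐ σ ∂histMeasure, (h : ℝ) + σ ≤ 0 → d.2 σ = 0) ∧
        (∀ᵐ σ ∂histMeasure, 0 < (h : ℝ) + σ → ‖d.2 σ‖ ≤ C * h * (‖z‖ + ‖w‖)))
    {z w : State H p} (hzw : (delaySemigroup hV hΦ hp).Gen z w) {h : ℝ≥0} {n : ℕ}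
    (hn : 1 ≤ n) (hnh : (n : ℝ) * h ≤ τ) :
    ‖(((fstSemigroup V p).op h * (pureDelaySemigroup p hΦ hp).op h) ^ n) z -
        (delaySemigroup hV hΦ hp).op (n * h) z‖ ≤
      C * h * (growth K τ * (‖z‖ + ‖w‖)) * (1 + (K * growth K τ + 1) * h) ^ n := by
  set T := delaySemigroup (p := p) hV hΦ hp with hT
  set S := (fstSemigroup V p).op h * (pureDelaySemigroup p hΦ hp).op h with hS
  have hK := hΦ.pos
  set M := growth K τ with hM
  have hM1 : 1 ≤ M := one_le_growth hK.le _
  set N := M * (‖z‖ + ‖w‖) with hN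
  have hN0 : 0 ≤ N := by positivity
  have hh0 : (0 : ℝ) ≤ h := h.coe_nonneg
  have hhτ : (h : ℝ) ≤ τ := by
    refine le_trans (le_mul_of_one_le_left hh0 ?_) hnh
    exact_mod_cast hn
  set D := C * h * N with hD
  have hD0 : 0 ≤ D := by positivity
  set q := 1 + (K * M + 1) * (h : ℝ) with hq
  have hq1 : 1 ≤ q := by
    rw [hq]; exact le_add_of_nonneg_right (by positivity)
  -- The head is kept a margin `D` below the history bound. That margin absorbs the local history
  -- error `D`, which is only `O(h)` and is made once on the newly written window.
  have key : ∀ k : ℕ, k ≤ n → ‖((S ^ k) z - T.op (k * h) z).1‖ ≤ D * q ^ k - D ∧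
      ∀ᵐ σ ∂histMeasure, ‖((S ^ k) z - T.op (k * h) z).2 σ‖ ≤ D * q ^ k := by
    intro k
    induction k with
    | zero =>
      intro _
      have e0 : (S ^ 0) z - T.op ((0 : ℕ) * h) z = 0 := by
        simp [T.op_zero]
      rw [e0]
      refine ⟨by simp, ?_⟩
      filter_upwards [Lp.coeFn_zero H p histMeasure] with σ hσ
      rw [Prod.snd_zero, hσ, Pi.zero_apply, norm_zero]
      positivity
    | succ k ih =>
      intro hk
      obtain ⟨ih1, ih2⟩ := ih (by omega)
      set e := (S ^ k) z - T.op (k * h) z with he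
      have hqk : 1 ≤ q ^ k := one_le_pow₀ hq1
      have hDk : D ≤ D * q ^ k := le_mul_of_one_le_right hD0 hqk
      have hkτ : ((k * h : ℝ≥0) : ℝ) ≤ τ := by
        rw [NNReal.coe_mul, NNReal.coe_natCast]
        refine le_trans ?_ hnh
        gcongr
        omega
      have hNk : ‖T.op (k * h) z‖ + ‖T.op (k * h) w‖ ≤ N := by
        rw [hN, mul_add]
        exact add_le_add
          (ContinuousLinearMap.le_of_opNorm_le _ (norm_delaySemigroup_le hV hΦ hp hkτ) _)
          (ContinuousLinearMap.le_of_opNorm_le _ (norm_delaySemigroup_le hV hΦ hp hkτ) _)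
      obtain ⟨d1, d2, d3⟩ := hloc _ _ (hzw.op (k * h)) h hhτ _ rfl
      set d := (fstSemigroup V p).op h ((pureDelaySemigroup p hΦ hp).op h (T.op (k * h) z)) -
        T.op h (T.op (k * h) z) with hd
      obtain ⟨s1, s2⟩ := splitting_step_bound hV hΦ hp hhτ ih1 (by linarith) ih2
      set f := (fstSemigroup V p).op h ((pureDelaySemigroup p hΦ hp).op h e) with hf
      have hdec : (S ^ (k + 1)) z - T.op ((k + 1 : ℕ) * h) z = f + d := by
        have e1 : (S ^ (k + 1)) z = S ((S ^ k) z) := by rw [pow_succ']; rfl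
        have e2 : ((k + 1 : ℕ) : ℝ≥0) * h = h + k * h := by push_cast; ring
        have e3 : f = S ((S ^ k) z) - S (T.op (k * h) z) := by
          rw [← map_sub]; rfl
        rw [e1, e2, T.op_add_apply, e3, hd]
        change _ = _ - S (T.op (k * h) z) + (S (T.op (k * h) z) - _)
        abel
      have hd1 : ‖d.1‖ ≤ h * D := by
        refine d1.trans ?_
        calc _ ≤ C * (h : ℝ) ^ 2 * N := by gcongr
          _ = _ := by rw [hD]; ring
      -- In `q`, the part `K * M * h` pays for the feedback of the history through `Φ`, and the
      -- extra `h` for the local head error `h * D`.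
      have hstep : D * q ^ k - D + K * M * h * (D * q ^ k) + h * D ≤ D * q ^ (k + 1) - D := by
        have : h * D ≤ h * (D * q ^ k) := by gcongr
        rw [pow_succ, hq]
        rw [hq] at this
        nlinarith
      have hmono : D * q ^ k ≤ D * q ^ (k + 1) := by
        gcongr
        omega
      rw [hdec]
      refine ⟨?_, ?_⟩
      · rw [Prod.fst_add]
        exact (norm_add_le _ _).trans ((add_le_add s1 hd1).trans hstep)
      · filter_upwards [s2, d2, d3, Lp.coeFn_add f.2 d.2] with σ g1 g2 g3 g4
        rw [Prod.snd_add, g4, Pi.add_apply]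
        rcases le_or_gt ((h : ℝ) + σ) 0 with hle | hlt
        · rw [g2 hle, add_zero]
          exact (g1.1 hle).trans hmono
        · have g5 : ‖d.2 σ‖ ≤ D := (g3 hlt).trans (by rw [hD]; gcongr)
          refine (norm_add_le _ _).trans ((add_le_add (g1.2 hlt) g5).trans ?_)
          have : 0 ≤ h * D := by positivity
          linarith
  obtain ⟨k1, k2⟩ := key n le_rfl
  have hqn : 0 ≤ D * q ^ n := by positivity
  exact norm_prod_le_iff.2 ⟨k1.trans (by linarith), norm_hist_le_of_ae_bound hqn k2⟩

end Splitting

/-! ### Scalar estimates -/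

theorem le_mul_rpow_one_div {p h τ : ℝ} (hp : 1 ≤ p) (h0 : 0 ≤ h) (hh : h ≤ τ) :
    h ≤ (1 + τ) * h ^ (1 / p) := by
  have h1 : 1 / p ≤ 1 := by rw [div_le_one (by linarith)]; exact hp
  have h2 : 0 ≤ h ^ (1 / p) := Real.rpow_nonneg h0 _
  -- For `h ≤ 1` the smaller exponent gives the larger power; for `h ≥ 1` the power is at least `1`
  -- and the factor `1 + τ` suffices.
  rcases le_total h 1 with hle | hge
  · have := Real.rpow_le_rpow_of_exponent_ge_of_imp h0 hle h1 (by
      intro _ h3; exact absurd h3 (by positivity))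
    rw [Real.rpow_one] at this
    nlinarith [mul_nonneg (h0.trans hh) h2]
  · have := Real.one_le_rpow hge (show 0 ≤ 1 / p by positivity)
    nlinarith

/-- With step `t / n` the `n` growth factors multiply to at most `e^{Qt}`, leaving the single factor
`t / n` that carries the order of convergence. -/
theorem div_mul_one_add_pow_le {Q t τ : ℝ} (hQ : 0 ≤ Q) (ht : 0 ≤ t) (hτ : t ≤ τ) {n : ℕ}
    (hn : 1 ≤ n) : t / n * (1 + Q * (t / n)) ^ n ≤ τ * Real.exp (Q * τ) / n := by
  have hn0 : (0 : ℝ) < n := by exact_mod_cast hn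
  have hτ0 : 0 ≤ τ := ht.trans hτ
  have h1 : (1 + Q * (t / n)) ^ n ≤ Real.exp (Q * τ) := by
    calc (1 + Q * (t / n)) ^ n ≤ Real.exp (Q * (t / n)) ^ n := by
          gcongr
          rw [add_comm]
          exact Real.add_one_le_exp _
      _ = Real.exp (Q * t) := by
          rw [← Real.exp_nat_mul]
          congr 1
          field_simp
      _ ≤ Real.exp (Q * τ) := by gcongr
  calc t / n * (1 + Q * (t / n)) ^ n ≤ τ / n * Real.exp (Q * τ) := by
        gcongr
    _ = τ * Real.exp (Q * τ) / n := by ring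

end DelaySplitting

open DelaySplitting

/-! ### Assembly of the constants -/

theorem theorem3p2 {𝕜 : Type*} [RCLike 𝕜] {H : Type*} [NormedAddCommGroup H]
    [InnerProductSpace 𝕜 H] [CompleteSpace H] [NormedSpace ℝ H] [IsScalarTower ℝ 𝕜 H]
    (p : ℝ≥0∞) [Fact (1 ≤ p)] (hp : p ≠ ∞)
    -- `B` generates a linear contraction semigroup
    (B : H →ₗ.[𝕜] H) (hB : GeneratesContractionSemigroup B)
    -- `Φ f = ∫ dη f` with `η` of bounded variation, and `ran Φ ⊆ D(B)`
    (η : ℝ → H →L[𝕜] H) (hη : BoundedVariationOn η (Icc (-1) 0))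
    (hran : ∀ (F : ℝ → H) (f g : Hist H p), IsSobolevRep F f g → delayOp η F ∈ B.domain) :
    -- `A₁`, `A₂` and `G` generate semigroups `T₁`, `T₂` and `T` on `H × L^p([-1,0]; H)`
    ∃ T₁ T₂ T : C0Semigroup 𝕜 (State H p),
      T₁.HasGenerator (graphA₁ p B) ∧ T₂.HasGenerator (graphA₂ p η) ∧
      T.HasGenerator (graphG p B η) ∧
      ∀ T₀ : ℝ≥0, ∃ C : ℝ, ∀ z z₁ z₂ : State H p,
        -- `z ∈ D(G²)`, `z₁ = G z`, `z₂ = G² z`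
        (z, z₁) ∈ graphG p B η → (z₁, z₂) ∈ graphG p B η →
          -- local error of the split solution
          (∀ h : ℝ≥0, h ≤ T₀ →
            ‖(T₁.op h (T₂.op h z) - T.op h z).1‖ ≤ C * (h : ℝ) ^ 2 * (‖z‖ + ‖z₂‖)) ∧
          -- local error of the whole state
          (∀ h : ℝ≥0, h ≤ T₀ →
            ‖T₁.op h (T₂.op h z) - T.op h z‖
              ≤ C * (h : ℝ) ^ (1 + 1 / p.toReal) * (‖z‖ + ‖z₂‖)) ∧
          -- first order convergence
          (∀ t : ℝ≥0, t ≤ T₀ → ∀ n : ℕ, 1 ≤ n →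
            ‖((T₁.op (t / n) * T₂.op (t / n)) ^ n) z - T.op t z‖
              ≤ C / n * (‖z‖ + ‖z₂‖)) := by
  obtain ⟨V, hV, hVB⟩ := hB
  set K := variationOnFromTo η (Icc (-1) 0) (-1) 0 + 1 with hKdef
  have hΦ : IsDelayFunctional (delayLin η hη) K := isDelayFunctional_delayLin hη
  have hdom : ∀ (x : H) (g : Hist H p), ∃ y, V.Gen (delayLin η hη (prim x g)) y := fun x g =>
    ⟨B ⟨_, hran _ _ g (isSobolevRep_prim (𝕜 := 𝕜) x g)⟩,
      hVB.mem_iff.1 (LinearPMap.mem_graph B ⟨delayOp η (prim x g), _⟩)⟩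
  have hG : (delaySemigroup hV hΦ hp).HasGenerator (graphG p B η) :=
    hasGenerator_delaySemigroup hV hp hVB hη
  refine ⟨fstSemigroup V p, pureDelaySemigroup p hΦ hp, delaySemigroup hV hΦ hp,
    hasGenerator_fstSemigroup hVB, ?_, hG, fun T₀ => ?_⟩
  · rw [graphA₂_eq_graphG (𝕜 := 𝕜)]
    exact hasGenerator_delaySemigroup norm_idSemigroup_le hp hasGenerator_idSemigroup hη
  have hK := hΦ.pos
  obtain ⟨C, hC, hloc⟩ := exists_local_error hV hΦ hp hdom T₀
  -- The Landau–Kolmogorov bound for `‖z₁‖` has constant `growth K 1 + 1`; one more unit covers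
  -- `‖z‖`.
  set L := growth K 1 + 2 with hL
  set Q := K * growth K T₀ + 1 with hQ
  have hM : 0 ≤ growth K T₀ := zero_le_one.trans (one_le_growth hK.le _)
  have hL0 : 0 ≤ L := by have := one_le_growth hK.le 1; linarith
  set E := C * growth K T₀ * (T₀ * Real.exp (Q * T₀)) * L with hE
  have hE0 : 0 ≤ E := by positivity
  set D := C * (1 + T₀) * L with hD
  have hCD : C * L ≤ D := by
    have := mul_nonneg (mul_nonneg hC hL0) T₀.coe_nonneg
    rw [hD]; linarith
  have hD0 : 0 ≤ D := by positivity
  have hp1 : 1 ≤ p.toReal := by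
    rw [← ENNReal.toReal_one]
    exact ENNReal.toReal_mono hp Fact.out
  refine ⟨D + E, fun z z₁ z₂ hz hz' => ?_⟩
  have hg := hG.mem_iff.1 hz
  set N := ‖z‖ + ‖z₂‖ with hN
  have hN0 : 0 ≤ N := by positivity
  have hNz : ‖z‖ + ‖z₁‖ ≤ L * N := by
    have h1 := hg.norm_le_of_sq (hG.mem_iff.1 hz') (M := growth K 1)
      fun s hs => norm_delaySemigroup_le hV hΦ hp hs
    have h2 : ‖z‖ ≤ N := le_add_of_nonneg_right (norm_nonneg _)
    rw [hL]
    linarith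
  refine ⟨fun h hh => ?_, fun h hh => ?_, fun t ht n hn => ?_⟩
  · calc _ ≤ C * (h : ℝ) ^ 2 * (‖z‖ + ‖z₁‖) := (hloc z z₁ hg h hh _ rfl).1
      _ ≤ C * (h : ℝ) ^ 2 * (L * N) := by gcongr
      _ = C * L * (h : ℝ) ^ 2 * N := by ring
      _ ≤ (D + E) * (h : ℝ) ^ 2 * N := by gcongr; linarith
  · obtain ⟨l1, l2, l3⟩ := hloc z z₁ hg h hh _ rfl
    have hr : (h : ℝ) ^ (1 + 1 / p.toReal) = h * (h : ℝ) ^ (1 / p.toReal) := by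
      rw [Real.rpow_add_of_nonneg h.coe_nonneg zero_le_one (by positivity), Real.rpow_one]
    have hr0 : 0 ≤ (h : ℝ) ^ (1 / p.toReal) := by positivity
    refine norm_prod_le_iff.2 ⟨?_, ?_⟩
    · calc _ ≤ C * (h : ℝ) ^ 2 * (‖z‖ + ‖z₁‖) := l1
        -- The head error `h^2` is traded for `h * h^{1/p}`, at the price of `1 + T₀`, to match the
        -- history component.
        _ = C * (h * h) * (‖z‖ + ‖z₁‖) := by ring
        _ ≤ C * (h * ((1 + T₀) * (h : ℝ) ^ (1 / p.toReal))) * (L * N) := by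
            gcongr
            exact le_mul_rpow_one_div hp1 h.coe_nonneg hh
        _ = D * (h : ℝ) ^ (1 + 1 / p.toReal) * N := by rw [hr, hD]; ring
        _ ≤ _ := by gcongr; linarith
    · calc _ ≤ C * h * (‖z‖ + ‖z₁‖) * (h : ℝ) ^ (1 / p.toReal) :=
            norm_hist_le_of_tail hp h.coe_nonneg (by positivity) l2 l3
        _ ≤ C * h * (L * N) * (h : ℝ) ^ (1 / p.toReal) := by gcongr
        _ = C * L * (h : ℝ) ^ (1 + 1 / p.toReal) * N := by rw [hr]; ring
        _ ≤ _ := by gcongr; linarith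
  · have hn0 : (n : ℝ≥0) ≠ 0 := by positivity
    have hnt : (n : ℝ≥0) * (t / n) = t := mul_div_cancel₀ t hn0
    have hb := norm_splitting_pow_sub_le hV hΦ hp hC hloc hg (h := t / n) hn
      (by exact_mod_cast hnt.le.trans ht)
    rw [hnt] at hb
    calc _ ≤ _ := hb
      _ = C * growth K T₀ * ((t : ℝ) / n * (1 + Q * ((t : ℝ) / n)) ^ n) * (‖z‖ + ‖z₁‖) := by
          push_cast; ring
      _ ≤ C * growth K T₀ * (T₀ * Real.exp (Q * T₀) / n) * (L * N) := by
          gcongr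
          exact div_mul_one_add_pow_le (by positivity) t.coe_nonneg ht hn
      _ = E / n * N := by rw [hE]; ring
      _ ≤ (D + E) / n * N := by gcongr; linarith
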